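/- **Setting.** For $i=1,\dots,N$ let $\mathcal T^{(i)}=(A^{(i)},B^{(i)},C^{(i)},W^{(i)},V^{(i)},Q^{(i)},R^{(i)})$ be an LQG task $$x_{t+1}=A^{(i)}x_t+B^{(i)}u_t+w_t,\qquad y_t=C^{(i)}x_t+v_t,\qquad x_0=0,$$ with independent noises $w_t\sim\mathcal N(0,W^{(i)})$, $v_t\sim\mathcal N(0,V^{(i)})$, $W^{(i)}\succeq0$, $V^{(i)}\succ0$, costs $Q^{(i)}\succeq0$, $R^{(i)}\succ0$, $(A^{(i)},B^{(i)})$ controllable and $(A^{(i)},C^{(i)})$ observable. Let $\mathtt{dare}(A,B,Q,R)$ be the stabilizing solution of $P=Q+A^\top PA-A^\top PB(R+B^\top PB)^{-1}B^\top PA$, and put $$\widetilde\Sigma=\mathtt{dare}(A^\top,C^\top,W,V),\quad \mathcal L=\widetilde\Sigma C^\top(C\widetilde\Sigma C^\top+V)^{-1},\quad \Sigma_\nu=\mathcal L(C\widetilde\Sigma C^\top+V)\mathcal L^\top,\quad \widetilde Q=C^\top QC$$ (task index suppressed). Assume $\Sigma_\nu^{(i)}\succ0$ for all $i$. Let $\hat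 x_t$ be the estimate of the stationary Kalman filter with gain $\mathcal L$ (started at $\hat x_0=0$), and for a gain $K$ let $\mathcal C^{(i)}(K)=\limsup_{T\to\infty}\frac1T\mathbb E\sum_{t<T}(y_t^\top Q^{(i)}y_t+u_t^\top R^{(i)}u_t)$ under $u_t=K\hat x_t$. Fix a history length $p$ and let $z_{t,p}=(u_{t-1},\dots,u_{t-p},y_t,\dots,y_{t-p+1})$. Let $S^{(i)}_\star$ be a matrix with $\hat x_t=S^{(i)}_\star z_{t,p}$ for all $t\ge p$ and all output sequences when the inputs are generated by the optimal LQG gain $-(R+B^\top PB)^{-1}B^\top PA$, $P=\mathtt{dare}(A,B,\widetilde Q,R)$. Write $\dagger$ for the Moore–Penrose inverse. For a lifted controller $\widetilde K\in\mathbb R^{n_u\times p(n_u+n_y)}$ let $$J^{(i)}(\widetilde K)=\mathcal C^{(i)}(\widetilde KS_\star^{(i)\dagger}),\quad A^{(i)}_{\widetilde K}=A^{(i)}+B^{(i)}\widetilde KS_\star^{(i)\dagger},\quad \widetilde{\mathcal K}^{(i)}=\{\widetilde K:\rho(A^{(i)}_{\widetilde K})<1\},$$ and let $\widetilde K^{(i)}_\star$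 minimize $J^{(i)}$ over $\widetilde{\mathcal K}^{(i)}$, such a minimizer being assumed to exist. Let $P_{\widetilde K}=\widetilde Q+S_\star^{\dagger\top}\widetilde K^\top R\widetilde KS_\star^\dagger+A_{\widetilde K}^\top P_{\widetilde K}A_{\widetilde K}$ and $\Sigma_{\widetilde K}=\Sigma_\nu+A_{\widetilde K}\Sigma_{\widetilde K}A_{\widetilde K}^\top$, and $$E_{\widetilde K}=2\big((R+B^\top P_{\widetilde K}B)\widetilde KS_\star^\dagger+B^\top P_{\widetilde K}A\big),\qquad \nabla J(\widetilde K)=E_{\widetilde K}\Sigma_{\widetilde K}S_\star^{\dagger\top}.$$ *Heterogeneity.* With $F^{(i)}=A^{(i)}_{\widetilde K}\otimes A^{(i)}_{\widetilde K}$, $C^{(i)}_{\widetilde K}=S_\star^{(i)\dagger}\otimes E^{(i)}_{\widetilde K}$, $\nu^{(i)}=\operatorname{vec}\Sigma_\nu^{(i)}$, put $F^{(ij)}=\operatorname{diag}(F^{(i)},F^{(j)})$, $C^{(ij)}=[C^{(i)}_{\widetilde K}\;\;-C^{(j)}_{\widetilde K}]$, $\nu^{(ij)}=(\nu^{(i)},\nu^{(j)})$.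 Then $$b_{ij}(\widetilde K)=\inf_{M,\lambda}\ \frac{(1+\eta^{-1})\,\nu^{(ij)\top}M\nu^{(ij)}}{\lambda-\eta(1-\lambda)},\qquad \eta=\frac1{\sqrt{1-\lambda}}-1,$$ over $\lambda\in(0,1)$ and symmetric $M$ with $M\succeq C^{(ij)\top}C^{(ij)}$ and $F^{(ij)\top}MF^{(ij)}-M\preceq-\lambda M$; and $b_i=\frac1{N-1}\sum_{j\ne i}b_{ij}$ (read as $0$ if $N=1$). *Constants.* $\gamma_i=\dfrac{4\lambda_{\min}(\Sigma_\nu^{(i)})^2\lambda_{\min}(R^{(i)})}{\|\Sigma^{(i)}_{\widetilde K_\star^{(i)}}\|\,\|S^{(i)}_\star\|^2}$ (spectral norms). Given $\widetilde K_0$ that stabilizes all tasks and $\beta_1,\dots,\beta_N\ge1$, let $\widetilde{\mathcal K}_{\mathrm{stab},\mathcal S}$ be the set of $\widetilde K\in\bigcap_i\widetilde{\mathcal K}^{(i)}$ with $J^{(i)}(\widetilde K)-J^{(i)}(\widetilde K^{(i)}_\star)\le\beta_i\big(J^{(i)}(\widetilde K_0)-J^{(i)}(\widetilde K_\star^{(i)})\big)$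 for all $i$. Let $L_i>0$ be a Lipschitz constant of $\nabla J^{(i)}$ on $\widetilde{\mathcal K}_{\mathrm{stab},\mathcal S}$ in the Frobenius norm. **Theorem V.2.** Let $\widetilde K_{n+1}=\widetilde K_n-\frac\alpha N\sum_{i=1}^N\nabla J^{(i)}(\widetilde K_n)$ with $$0<\alpha<\min\Big\{\frac1{4\max_iL_i},\ \frac4{\max_i\gamma_i}\Big\},$$ and suppose that for every $i$ $$\sup_{\widetilde K\in\widetilde{\mathcal K}_{\mathrm{stab},\mathcal S}}b_i(\widetilde K)\le\frac{\gamma_i}6\big(J^{(i)}(\widetilde K_0)-J^{(i)}(\widetilde K^{(i)}_\star)\big).$$ Then $\widetilde K_n\in\widetilde{\mathcal K}_{\mathrm{stab},\mathcal S}$ for all $n$, and for every $i$ $$\limsup_{n\to\infty}\big(J^{(i)}(\widetilde K_n)-J^{(i)}(\widetilde K_\star^{(i)})\big)\le\frac3{\gamma_i}\limsup_{n\to\infty}b_i(\widetilde K_n).$$ Moreover, if $\widetilde K_n\to\widetilde K_{\infty,\mathcal S}$, then $\widetilde K_{\infty,\mathcal S}\in\widetilde{\mathcal K}_{\mathrm{stab},\mathcal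 S}$ and $J^{(i)}(\widetilde K_{\infty,\mathcal S})-J^{(i)}(\widetilde K_\star^{(i)})\le\frac3{\gamma_i}b_i(\widetilde K_{\infty,\mathcal S})$ for every $i$. -/

import Mathlib

open Matrix Filter Topology MeasureTheory ProbabilityTheory
open scoped Kronecker

noncomputable section

namespace MTLQG

/-! ### Linear algebra -/

/-- The spectral norm (largest singular value) of a real matrix. -/
def specNorm {m n : Type*} [Fintype m] [Fintype n] [DecidableEq n] (M : Matrix m n ℝ) : ℝ :=
  ‖(Matrix.toLpLin 2 2 M).toContinuousLinearMap‖

/-- The Frobenius norm of a real matrix. -/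
def frobNorm {m n : Type*} [Fintype m] [Fintype n] (M : Matrix m n ℝ) : ℝ :=
  Real.sqrt (∑ i, ∑ j, M i j ^ 2)

/-- The smallest eigenvalue (used for symmetric matrices). -/
def lambdaMin {n : Type*} [Fintype n] [DecidableEq n] (M : Matrix n n ℝ) : ℝ :=
  sInf (spectrum ℝ M)

/-- `ρ(A) < 1`, the spectral radius being taken over the complex eigenvalues. -/
def IsSchur {n : Type*} [Fintype n] [DecidableEq n] (A : Matrix n n ℝ) : Prop :=
  spectralRadius ℂ (A.map (algebraMap ℝ ℂ)) < 1

/-- Controllability of `(A, B)`: the ranges of `B, A B, …, A ^ (n - 1) B` span the state space. -/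
def Controllable {n m : ℕ} (A : Matrix (Fin n) (Fin n) ℝ) (B : Matrix (Fin n) (Fin m) ℝ) : Prop :=
  (⨆ k : Fin n, LinearMap.range (A ^ (k : ℕ) * B).mulVecLin) = ⊤

/-- Observability of `(A, C)`, as controllability of the dual pair. -/
def Observable {n m : ℕ} (A : Matrix (Fin n) (Fin n) ℝ) (C : Matrix (Fin m) (Fin n) ℝ) : Prop :=
  Controllable Aᵀ Cᵀ

/-- The four Penrose conditions: `X` is the Moore–Penrose inverse of the real matrix `M`. -/
structure IsMoorePenrose {m n : Type*} [Fintype m] [Fintype n]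
    (M : Matrix m n ℝ) (X : Matrix n m ℝ) : Prop where
  mul_mul_left : M * X * M = M
  mul_mul_right : X * M * X = X
  symm_left : (M * X)ᵀ = M * X
  symm_right : (X * M)ᵀ = X * M

open Classical in
/-- The Moore–Penrose inverse (it always exists and is unique). -/
def pinv {m n : Type*} [Fintype m] [Fintype n] (M : Matrix m n ℝ) : Matrix n m ℝ :=
  if h : ∃ X, IsMoorePenrose M X then h.choose else 0

/-- `P` is a stabilizing solution of the discrete-time algebraic Riccati equation
`P = Q + Aᵀ P A - Aᵀ P B (R + Bᵀ P B)⁻¹ Bᵀ P A`. Such a solution is unique. -/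
structure IsDareSolution {n m : ℕ} (A : Matrix (Fin n) (Fin n) ℝ) (B : Matrix (Fin n) (Fin m) ℝ)
    (Q : Matrix (Fin n) (Fin n) ℝ) (R : Matrix (Fin m) (Fin m) ℝ)
    (P : Matrix (Fin n) (Fin n) ℝ) : Prop where
  symm : Pᵀ = P
  isUnit : IsUnit (R + Bᵀ * P * B).det
  eq : P = Q + Aᵀ * P * A - Aᵀ * P * B * (R + Bᵀ * P * B)⁻¹ * Bᵀ * P * A
  stabilizing : IsSchur (A - B * ((R + Bᵀ * P * B)⁻¹ * Bᵀ * P * A))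

open Classical in
/-- The stabilizing solution of the Riccati equation (`0` if there is none). -/
def dare {n m : ℕ} (A : Matrix (Fin n) (Fin n) ℝ) (B : Matrix (Fin n) (Fin m) ℝ)
    (Q : Matrix (Fin n) (Fin n) ℝ) (R : Matrix (Fin m) (Fin m) ℝ) : Matrix (Fin n) (Fin n) ℝ :=
  if h : ∃ P, IsDareSolution A B Q R P then h.choose else 0

open Classical in
/-- The solution of the discrete Lyapunov equation `X = Q + A X Aᵀ`; it exists and is unique
whenever `A` is Schur stable. -/
def dlyap {n : ℕ} (A Q : Matrix (Fin n) (Fin n) ℝ) : Matrix (Fin n) (Fin n) ℝ :=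
  if h : ∃ X, X = Q + A * X * Aᵀ then h.choose else 0

/-! ### LQG tasks -/

/-- An LQG task: dynamics `x⁺ = A x + B u + w`, `y = C x + v`, noise covariances `W`, `V`, and
output and input cost matrices `Q`, `R`. -/
structure LQGTask (nx nu ny : ℕ) where
  A : Matrix (Fin nx) (Fin nx) ℝ
  B : Matrix (Fin nx) (Fin nu) ℝ
  C : Matrix (Fin ny) (Fin nx) ℝ
  W : Matrix (Fin nx) (Fin nx) ℝ
  V : Matrix (Fin ny) (Fin ny) ℝ
  Q : Matrix (Fin ny) (Fin ny) ℝ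
  R : Matrix (Fin nu) (Fin nu) ℝ
  hW : W.PosSemidef
  hV : V.PosDef
  hQ : Q.PosSemidef
  hR : R.PosDef

/-- Index type of the history vector `(u_{t-1}, …, u_{t-p}, y_t, …, y_{t-p+1})`, which has
`p (nu + ny)` entries. -/
abbrev Hist (p nu ny : ℕ) : Type := (Fin p × Fin nu) ⊕ (Fin p × Fin ny)

/-- Lifted controllers. -/
abbrev Ctrl (p nu ny : ℕ) : Type := Matrix (Fin nu) (Hist p nu ny) ℝ

/-- The history vector `z_{t,p}` (used for `t ≥ p`). -/
def history {nu ny : ℕ} (p : ℕ) (u : ℕ → Fin nu → ℝ) (y : ℕ → Fin ny → ℝ) (t : ℕ) :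
    Hist p nu ny → ℝ :=
  Sum.elim (fun q => u (t - 1 - (q.1 : ℕ)) q.2) (fun q => y (t - (q.1 : ℕ)) q.2)

namespace LQGTask

variable {nx nu ny p : ℕ}

/-- The state cost `Q̃ = Cᵀ Q C`. -/
def Qt (T : LQGTask nx nu ny) : Matrix (Fin nx) (Fin nx) ℝ := T.Cᵀ * T.Q * T.C

/-- The stationary one-step prediction error covariance of the Kalman filter. -/
def predCov (T : LQGTask nx nu ny) : Matrix (Fin nx) (Fin nx) ℝ := dare T.Aᵀ T.Cᵀ T.W T.V

/-- The stationary Kalman filter gain `L`. -/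
def kalmanGain (T : LQGTask nx nu ny) : Matrix (Fin nx) (Fin ny) ℝ :=
  T.predCov * T.Cᵀ * (T.C * T.predCov * T.Cᵀ + T.V)⁻¹

/-- `Σ_ν = L (C Σ̃ Cᵀ + V) Lᵀ`, the covariance of the noise driving the state estimate. -/
def noiseCov (T : LQGTask nx nu ny) : Matrix (Fin nx) (Fin nx) ℝ :=
  T.kalmanGain * (T.C * T.predCov * T.Cᵀ + T.V) * T.kalmanGainᵀ

/-- The optimal LQG control gain `K_⋆`, for inputs `u = K x̂`. -/
def optGain (T : LQGTask nx nu ny) : Matrix (Fin nu) (Fin nx) ℝ :=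
  -((T.R + T.Bᵀ * dare T.A T.B T.Qt T.R * T.B)⁻¹ * T.Bᵀ * dare T.A T.B T.Qt T.R * T.A)

/-- One step of the stationary Kalman filter under `u = K x̂`: from the current estimate `xh` and
the next output `y` to the next estimate. -/
def filterStep (T : LQGTask nx nu ny) (K : Matrix (Fin nu) (Fin nx) ℝ)
    (xh : Fin nx → ℝ) (y : Fin ny → ℝ) : Fin nx → ℝ :=
  (T.A *ᵥ xh + T.B *ᵥ (K *ᵥ xh)) +
    T.kalmanGain *ᵥ (y - T.C *ᵥ (T.A *ᵥ xh + T.B *ᵥ (K *ᵥ xh)))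

/-- State and state estimate `(x_t, x̂_t)` under `u_t = K x̂_t` for the noise realization
`ω t = (w_t, v_t)`, started from `x_0 = x̂_0 = 0`. -/
def closedLoop (T : LQGTask nx nu ny) (K : Matrix (Fin nu) (Fin nx) ℝ)
    (ω : ℕ → EuclideanSpace ℝ (Fin nx) × EuclideanSpace ℝ (Fin ny)) :
    ℕ → (Fin nx → ℝ) × (Fin nx → ℝ)
  | 0 => (0, 0)
  | t + 1 =>
    (T.A *ᵥ (closedLoop T K ω t).1 + T.B *ᵥ (K *ᵥ (closedLoop T K ω t).2) + (ω t).1.ofLp,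
      T.filterStep K (closedLoop T K ω t).2
        (T.C *ᵥ (T.A *ᵥ (closedLoop T K ω t).1 + T.B *ᵥ (K *ᵥ (closedLoop T K ω t).2)
          + (ω t).1.ofLp) + (ω (t + 1)).2.ofLp))

/-- The cost `y_tᵀ Q y_t + u_tᵀ R u_t` at time `t`, with `y_t = C x_t + v_t` and `u_t = K x̂_t`. -/
def stageCost (T : LQGTask nx nu ny) (K : Matrix (Fin nu) (Fin nx) ℝ)
    (ω : ℕ → EuclideanSpace ℝ (Fin nx) × EuclideanSpace ℝ (Fin ny)) (t : ℕ) : ℝ :=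
  (T.C *ᵥ (T.closedLoop K ω t).1 + (ω t).2.ofLp) ⬝ᵥ
      (T.Q *ᵥ (T.C *ᵥ (T.closedLoop K ω t).1 + (ω t).2.ofLp)) +
    (K *ᵥ (T.closedLoop K ω t).2) ⬝ᵥ (T.R *ᵥ (K *ᵥ (T.closedLoop K ω t).2))

/-- The law of the noise: `w_t ∼ N(0, W)` and `v_t ∼ N(0, V)`, all independent. -/
def noiseLaw (T : LQGTask nx nu ny) :
    Measure (ℕ → EuclideanSpace ℝ (Fin nx) × EuclideanSpace ℝ (Fin ny)) :=
  Measure.infinitePi fun _ => (multivariateGaussian 0 T.W).prod (multivariateGaussian 0 T.V)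

/-- The LQG cost of the gain `K`: the long-run average expected cost under `u_t = K x̂_t`. -/
def lqgCost (T : LQGTask nx nu ny) (K : Matrix (Fin nu) (Fin nx) ℝ) : ℝ :=
  limsup (fun n : ℕ => (1 / (n : ℝ)) *
    ∫ ω, ∑ t ∈ Finset.range n, T.stageCost K ω t ∂T.noiseLaw) atTop

/-! ### The history representation -/

/-- The optimally controlled Kalman filter estimate, as a function of the output sequence `y`. -/
def optFilter (T : LQGTask nx nu ny) (y : ℕ → Fin ny → ℝ) : ℕ → Fin nx → ℝ
  | 0 => 0
  | t + 1 => T.filterStep T.optGain (optFilter T y t) (y (t + 1))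

/-- `S` is an input-output (history) representation of the state estimate: along the optimal LQG
closed loop, `x̂_t = S z_{t,p}` for all output sequences and all `t ≥ p`. -/
def IsHistoryMap (T : LQGTask nx nu ny) (S : Matrix (Fin nx) (Hist p nu ny) ℝ) : Prop :=
  ∀ y : ℕ → Fin ny → ℝ, ∀ t : ℕ, p ≤ t →
    T.optFilter y t = S *ᵥ history p (fun s => T.optGain *ᵥ T.optFilter y s) y t

/-- The cost `J(K̃)` of a lifted controller, which acts on the estimate by the gain `K̃ S†`. -/
def J (T : LQGTask nx nu ny) (S : Matrix (Fin nx) (Hist p nu ny) ℝ) (K : Ctrl p nu ny) : ℝ :=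
  T.lqgCost (K * pinv S)

/-- `A_K̃ = A + B K̃ S†`. -/
def Acl (T : LQGTask nx nu ny) (S : Matrix (Fin nx) (Hist p nu ny) ℝ) (K : Ctrl p nu ny) :
    Matrix (Fin nx) (Fin nx) ℝ :=
  T.A + T.B * K * pinv S

/-- The set of lifted controllers that stabilize the task. -/
def stabilizing (T : LQGTask nx nu ny) (S : Matrix (Fin nx) (Hist p nu ny) ℝ) :
    Set (Ctrl p nu ny) :=
  {K | IsSchur (T.Acl S K)}

/-- `K` minimizes the cost over the stabilizing lifted controllers. -/
def IsOptimal (T : LQGTask nx nu ny) (S : Matrix (Fin nx) (Hist p nu ny) ℝ)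
    (K : Ctrl p nu ny) : Prop :=
  K ∈ T.stabilizing S ∧ ∀ K' ∈ T.stabilizing S, T.J S K ≤ T.J S K'

/-! ### Policy gradient -/

/-- `P_K̃`, from `P = Q̃ + S†ᵀ K̃ᵀ R K̃ S† + A_K̃ᵀ P A_K̃`. -/
def valueMat (T : LQGTask nx nu ny) (S : Matrix (Fin nx) (Hist p nu ny) ℝ) (K : Ctrl p nu ny) :
    Matrix (Fin nx) (Fin nx) ℝ :=
  dlyap (T.Acl S K)ᵀ (T.Qt + (pinv S)ᵀ * Kᵀ * T.R * K * pinv S)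

/-- `Σ_K̃`, from `Σ = Σ_ν + A_K̃ Σ A_K̃ᵀ`. -/
def stateCov (T : LQGTask nx nu ny) (S : Matrix (Fin nx) (Hist p nu ny) ℝ) (K : Ctrl p nu ny) :
    Matrix (Fin nx) (Fin nx) ℝ :=
  dlyap (T.Acl S K) T.noiseCov

/-- `E_K̃ = 2 ((R + Bᵀ P B) K̃ S† + Bᵀ P A)`. -/
def gradE (T : LQGTask nx nu ny) (S : Matrix (Fin nx) (Hist p nu ny) ℝ) (K : Ctrl p nu ny) :
    Matrix (Fin nu) (Fin nx) ℝ :=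
  (2 : ℝ) • ((T.R + T.Bᵀ * T.valueMat S K * T.B) * K * pinv S + T.Bᵀ * T.valueMat S K * T.A)

/-- The policy gradient `∇J(K̃) = E_K̃ Σ_K̃ S†ᵀ`. -/
def gradJ (T : LQGTask nx nu ny) (S : Matrix (Fin nx) (Hist p nu ny) ℝ) (K : Ctrl p nu ny) :
    Ctrl p nu ny :=
  T.gradE S K * T.stateCov S K * (pinv S)ᵀ

/-- The gradient dominance constant
`γ = 4 λ_min(Σ_ν)² λ_min(R) / (‖Σ_{K̃⋆}‖ ‖S‖²)`, for an optimal lifted controller `K̃⋆`. -/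
def gam (T : LQGTask nx nu ny) (S : Matrix (Fin nx) (Hist p nu ny) ℝ) (Kopt : Ctrl p nu ny) : ℝ :=
  4 * lambdaMin T.noiseCov ^ 2 * lambdaMin T.R / (specNorm (T.stateCov S Kopt) * specNorm S ^ 2)

/-! ### Bisimulation-based heterogeneity -/

/-- `F_K̃ = A_K̃ ⊗ A_K̃`. -/
def F (T : LQGTask nx nu ny) (S : Matrix (Fin nx) (Hist p nu ny) ℝ) (K : Ctrl p nu ny) :
    Matrix (Fin nx × Fin nx) (Fin nx × Fin nx) ℝ :=
  T.Acl S K ⊗ₖ T.Acl S K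

/-- `C_K̃ = S† ⊗ E_K̃`; it maps `vec Σ` to `vec (E_K̃ Σ S†ᵀ)`. -/
def Cout (T : LQGTask nx nu ny) (S : Matrix (Fin nx) (Hist p nu ny) ℝ) (K : Ctrl p nu ny) :
    Matrix (Hist p nu ny × Fin nu) (Fin nx × Fin nx) ℝ :=
  pinv S ⊗ₖ T.gradE S K

end LQGTask

/-- The function of `(M, λ)` whose minimum is the bisimulation-based heterogeneity, with
`η = 1 / √(1 - λ) - 1`. -/
def bisimValue {ι : Type*} [Fintype ι] (ν : ι → ℝ) (M : Matrix ι ι ℝ) (lam : ℝ) : ℝ :=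
  (1 + (1 / Real.sqrt (1 - lam) - 1)⁻¹) * (ν ⬝ᵥ (M *ᵥ ν)) /
    (lam - (1 / Real.sqrt (1 - lam) - 1) * (1 - lam))

/-- The constraints on `(M, λ)`: `λ ∈ (0, 1)`, `M ⪰ Cᵀ C` and `Fᵀ M F - M ⪯ - λ M`
(so `M` is symmetric positive semidefinite). -/
structure BisimFeasible {ι κ : Type*} [Fintype ι] [Fintype κ]
    (F : Matrix ι ι ℝ) (C : Matrix κ ι ℝ) (M : Matrix ι ι ℝ) (lam : ℝ) : Prop where
  pos : 0 < lam
  lt_one : lam < 1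
  output : (M - Cᵀ * C).PosSemidef
  decay : (-(lam • M) - (Fᵀ * M * F - M)).PosSemidef

section Multitask

variable {nx nu ny p N : ℕ}

/-- The bisimulation-based heterogeneity `b_ij(K̃)` between two tasks. -/
def bisimHet (T₁ T₂ : LQGTask nx nu ny) (S₁ S₂ : Matrix (Fin nx) (Hist p nu ny) ℝ)
    (K : Ctrl p nu ny) : ℝ :=
  sInf {b : ℝ | ∃ M lam,
    BisimFeasible (Matrix.fromBlocks (T₁.F S₁ K) 0 0 (T₂.F S₂ K))
      (Matrix.fromCols (T₁.Cout S₁ K) (-(T₂.Cout S₂ K))) M lam ∧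
    b = bisimValue (Sum.elim T₁.noiseCov.vec T₂.noiseCov.vec) M lam}

/-- The average heterogeneity `b_i(K̃) = (N - 1)⁻¹ ∑_{j ≠ i} b_ij(K̃)`; it is `0` for `N = 1`. -/
def avgHet (T : Fin N → LQGTask nx nu ny) (S : Fin N → Matrix (Fin nx) (Hist p nu ny) ℝ)
    (i : Fin N) (K : Ctrl p nu ny) : ℝ :=
  (1 / ((N : ℝ) - 1)) * ∑ j ∈ Finset.univ.erase i, bisimHet (T i) (T j) (S i) (S j) K

/-- The common stabilizing set with parameters `β_i`, for the initial controller `K₀` and the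
optimal lifted controllers `Kopt i`. -/
def stabSet (T : Fin N → LQGTask nx nu ny) (S : Fin N → Matrix (Fin nx) (Hist p nu ny) ℝ)
    (Kopt : Fin N → Ctrl p nu ny) (β : Fin N → ℝ) (K₀ : Ctrl p nu ny) : Set (Ctrl p nu ny) :=
  {K | ∀ i, K ∈ (T i).stabilizing (S i) ∧
    (T i).J (S i) K - (T i).J (S i) (Kopt i) ≤
      β i * ((T i).J (S i) K₀ - (T i).J (S i) (Kopt i))}

/-- The multitask policy gradient iterates `K̃_{n+1} = K̃_n - (α / N) ∑_i ∇J^{(i)}(K̃_n)`. -/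
def pgIter (T : Fin N → LQGTask nx nu ny) (S : Fin N → Matrix (Fin nx) (Hist p nu ny) ℝ)
    (α : ℝ) (K₀ : Ctrl p nu ny) : ℕ → Ctrl p nu ny
  | 0 => K₀
  | n + 1 => pgIter T S α K₀ n - (α / (N : ℝ)) • ∑ i, (T i).gradJ (S i) (pgIter T S α K₀ n)

end Multitask

end MTLQG

end

/-!
Along a gain `K` that stabilizes `(A, B)`, the joint second moment of the Kalman estimate and the
estimation error satisfies a linear recursion with a Schur transition matrix, whose fixed point is
block diagonal. Hence the LQG cost of `K` equals, up to a constant independent of `K`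
(`exists_lqgCost_eq`), the state-feedback cost `tr ((Q̃ + Kᵀ R K) Σ_K)`, where
`Σ_K = Σ_ν + (A + B K) Σ_K (A + B K)ᵀ`. Since `Σ_ν ≻ 0`, the Kalman gain has full row rank, so a
history map is onto (`IsHistoryMap.exists_right_inverse`) and `S S† = 1` (`mul_pinv_eq_one`): every
state-feedback gain comes from a lifted controller.

The difference of the costs of two stabilizing gains is an explicit quadratic expression in the
difference of the gains (`costOf_sub`). Three facts follow: `gradJ` is the gradient of `J`
(`hasDerivAt_J`); `J` is gradient dominated, `γ (J K - J K⋆) ≤ ‖∇J K‖²` (`gam_mul_J_sub_le`); and,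
because a bound on the cost bounds `Σ_K` and `Σ_K ⪰ Σ_ν ≻ 0` then gives a uniform geometric decay
rate for the powers of `A + B K`, sublevel sets of `J` inside the stabilizing set are closed
(`isClosed_sublevel_J`).

The gradient of a task is, after vectorization, the output sum of the linear system `(F, C)` started
at `vec Σ_ν`. A feasible pair of the linear matrix inequalities is a contracting quadratic form for
two such systems run in parallel, which bounds the distance of two gradients
(`frobNorm_gradJ_sub_sq_le`), and by convexity the distance of a gradient to the mean gradient
(`frobNorm_gradJ_sub_mean_sq_le`).

As long as the segment from an iterate along the mean gradient stays in the common stabilizing set,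
the descent lemma for inexact gradients (`J_sub_smul_le`) and gradient dominance give
`δ(s) ≤ (1 - s γ / 4) δ(0) + s b / 2` for the suboptimality `δ` after a step of length `s`. Low
heterogeneity makes the right-hand side smaller than the admissible bound, so a continuous
induction shows that the segment cannot leave the set, which is closed
(`segment_subset_stabSet`). Iterating the contraction with `s = α` gives a limsup bound with the
constant `2 / γ`. At a limit point the mean gradient vanishes, so `‖∇Jᵢ‖² ≤ bᵢ`
there, and gradient dominance gives the last claim.
-/

namespace MTLQG

/-! ### Schur stability -/

section Schur

variable {m n : Type*} [Fintype m] [DecidableEq m] [Fintype n] [DecidableEq n]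

section Gelfand

attribute [local instance] Matrix.linftyOpNormedRing Matrix.linftyOpNormedAlgebra

/-- One direction is Gelfand's formula, the other the bound of the spectral radius by
`‖A ^ k‖ ^ (1 / k)`. -/
theorem spectralRadius_lt_one_iff_tendsto_pow (A : Matrix n n ℂ) :
    spectralRadius ℂ A < 1 ↔ Tendsto (fun k : ℕ => A ^ k) atTop (𝓝 0) := by
  have : CompleteSpace (Matrix n n ℂ) := FiniteDimensional.complete ℂ _
  constructor
  · intro h
    obtain ⟨r, hr1, hr2⟩ := ENNReal.lt_iff_exists_nnreal_btwn.1 h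
    have hr : (r : ℝ) < 1 := by exact_mod_cast hr2
    have hev :=
      (spectrum.pow_nnnorm_pow_one_div_tendsto_nhds_spectralRadius A).eventually_lt_const hr1
    refine squeeze_zero_norm' ?_ (tendsto_pow_atTop_nhds_zero_of_lt_one r.2 hr)
    filter_upwards [hev, eventually_gt_atTop 0] with k hk hk0
    have h1 : ((‖A ^ k‖₊ : ENNReal) ^ (1 / (k : ℝ))) ^ (k : ℝ) ≤ (r : ENNReal) ^ (k : ℝ) :=
      ENNReal.rpow_le_rpow hk.le (by positivity)
    rw [← ENNReal.rpow_mul, one_div, inv_mul_cancel₀ (by positivity), ENNReal.rpow_one,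
      ENNReal.rpow_natCast] at h1
    have h2 : ‖A ^ k‖₊ ≤ r ^ k := by exact_mod_cast h1
    exact_mod_cast h2
  · intro h
    have h1 : Tendsto (fun k : ℕ => ‖A ^ (k + 1)‖₊ * ‖(1 : Matrix n n ℂ)‖₊) atTop (𝓝 0) := by
      have := ((h.comp (tendsto_add_atTop_nat 1)).nnnorm).mul_const ‖(1 : Matrix n n ℂ)‖₊
      simpa using this
    obtain ⟨k, hk⟩ := (h1.eventually_lt_const one_pos).exists
    refine (spectrum.spectralRadius_le_pow_nnnorm_pow_one_div ℂ A k).trans_lt ?_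
    rw [← ENNReal.mul_rpow_of_nonneg _ _ (by positivity)]
    refine ENNReal.rpow_lt_one ?_ (by positivity)
    exact_mod_cast hk

end Gelfand

theorem tendsto_matrix_iff {m n α R : Type*} [TopologicalSpace R] {l : Filter α}
    {f : α → Matrix m n R} {M : Matrix m n R} :
    Tendsto f l (𝓝 M) ↔ ∀ i j, Tendsto (fun a => f a i j) l (𝓝 (M i j)) := by
  have h : Tendsto f l (𝓝 M) ↔ Tendsto (fun a => Matrix.of.symm (f a)) l (𝓝 (Matrix.of.symm M)) :=
    Iff.rfl
  rw [h, tendsto_pi_nhds]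
  exact forall_congr' fun i => tendsto_pi_nhds

theorem isSchur_iff_tendsto_pow {A : Matrix n n ℝ} :
    IsSchur A ↔ Tendsto (fun k : ℕ => A ^ k) atTop (𝓝 0) := by
  have hpow : ∀ k : ℕ, (A.map (algebraMap ℝ ℂ)) ^ k = (A ^ k).map (algebraMap ℝ ℂ) := fun k =>
    (map_pow (algebraMap ℝ ℂ).mapMatrix A k).symm
  rw [IsSchur, spectralRadius_lt_one_iff_tendsto_pow]
  simp only [hpow]
  constructor
  · intro h
    rw [tendsto_matrix_iff] at h ⊢
    intro i j
    exact (Complex.continuous_re.tendsto _).comp (h i j)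
  · intro h
    rw [tendsto_matrix_iff] at h ⊢
    intro i j
    have := (Complex.continuous_ofReal.tendsto _).comp (h i j)
    simpa [Function.comp_def] using this

theorem IsSchur.tendsto_pow {A : Matrix n n ℝ} (h : IsSchur A) :
    Tendsto (fun k : ℕ => A ^ k) atTop (𝓝 0) := isSchur_iff_tendsto_pow.1 h

theorem IsSchur.transpose {A : Matrix n n ℝ} (h : IsSchur A) : IsSchur Aᵀ := by
  rw [isSchur_iff_tendsto_pow]
  have := (continuous_id.matrix_transpose.tendsto (0 : Matrix n n ℝ)).comp h.tendsto_pow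
  simpa [Function.comp_def, transpose_pow] using this

theorem IsSchur.mul_comm {A : Matrix m n ℝ} {B : Matrix n m ℝ} (h : IsSchur (A * B)) :
    IsSchur (B * A) := by
  rw [isSchur_iff_tendsto_pow, ← tendsto_add_atTop_iff_nat 1]
  have hk : ∀ k : ℕ, (B * A) ^ (k + 1) = B * (A * B) ^ k * A := by
    intro k
    induction k with
    | zero => simp
    | succ k ih => rw [pow_succ, ih, pow_succ (A * B)]; simp only [Matrix.mul_assoc]
  simp only [hk]
  have hc : Continuous fun X : Matrix m m ℝ => B * X * A := by fun_prop
  have := (hc.tendsto 0).comp h.tendsto_pow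
  simpa [Function.comp_def] using this

theorem IsSchur.fromBlocks {A : Matrix m m ℝ} {D : Matrix n n ℝ} (hA : IsSchur A) (hD : IsSchur D)
    (B : Matrix m n ℝ) : IsSchur (fromBlocks A B 0 D) := by
  unfold IsSchur
  refine lt_of_le_of_lt ?_ (max_lt hA hD)
  rw [fromBlocks_map]
  refine iSup₂_le fun z hz => ?_
  rw [spectrum.mem_iff, isUnit_iff_isUnit_det] at hz
  have hdet : (algebraMap ℂ (Matrix (m ⊕ n) (m ⊕ n) ℂ) z - Matrix.fromBlocks
      (A.map (algebraMap ℝ ℂ)) (B.map (algebraMap ℝ ℂ)) ((0 : Matrix n m ℝ).map (algebraMap ℝ ℂ))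
      (D.map (algebraMap ℝ ℂ))).det = (algebraMap ℂ _ z - A.map (algebraMap ℝ ℂ)).det *
        (algebraMap ℂ _ z - D.map (algebraMap ℝ ℂ)).det := by
    rw [← det_fromBlocks_zero₂₁ _ (-(B.map (algebraMap ℝ ℂ)))]
    congr 1
    rw [Algebra.algebraMap_eq_smul_one, Algebra.algebraMap_eq_smul_one,
      Algebra.algebraMap_eq_smul_one, ← fromBlocks_one, fromBlocks_smul, sub_eq_add_neg,
      fromBlocks_neg, fromBlocks_add]
    simp [sub_eq_add_neg]
  rw [hdet, IsUnit.mul_iff, not_and_or, ← isUnit_iff_isUnit_det, ← isUnit_iff_isUnit_det,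
    ← spectrum.mem_iff, ← spectrum.mem_iff] at hz
  rcases hz with hz | hz
  · exact le_max_of_le_left (le_iSup₂ (f := fun k (_ : k ∈ spectrum ℂ _) => (‖k‖₊ : ENNReal)) z hz)
  · exact le_max_of_le_right (le_iSup₂ (f := fun k (_ : k ∈ spectrum ℂ _) => (‖k‖₊ : ENNReal)) z hz)

/-- A geometric bound on the quadratic forms `|(Aᵀ) ^ k x|²` makes `A` Schur stable. -/
theorem isSchur_of_geometric_bound {A : Matrix n n ℝ} {c r : ℝ} (hr0 : 0 ≤ r) (hr1 : r < 1)
    (h : ∀ (k : ℕ) (x : n → ℝ), ((A ^ k)ᵀ *ᵥ x) ⬝ᵥ ((A ^ k)ᵀ *ᵥ x) ≤ c * r ^ k * (x ⬝ᵥ x)) :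
    IsSchur A := by
  rw [isSchur_iff_tendsto_pow, tendsto_matrix_iff]
  intro i j
  have hb : ∀ k : ℕ, (A ^ k) i j ^ 2 ≤ c * r ^ k := by
    intro k
    have h1 := h k (Pi.single i 1)
    simp only [mulVec_single_one, dotProduct_single, Pi.single_eq_same, mul_one] at h1
    refine le_trans ?_ h1
    rw [dotProduct]
    refine le_trans ?_ (Finset.single_le_sum (f := fun l => (A ^ k)ᵀ.col i l * (A ^ k)ᵀ.col i l)
      (fun l _ => mul_self_nonneg _) (Finset.mem_univ j))
    exact (sq _).le
  have h0 : Tendsto (fun k : ℕ => c * r ^ k) atTop (𝓝 0) := by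
    simpa using (tendsto_pow_atTop_nhds_zero_of_lt_one hr0 hr1).const_mul c
  have h2 : Tendsto (fun k : ℕ => (A ^ k) i j ^ 2) atTop (𝓝 0) :=
    squeeze_zero (fun k => sq_nonneg _) hb h0
  have h3 := h2.sqrt
  simp only [Real.sqrt_sq_eq_abs, Real.sqrt_zero] at h3
  exact (tendsto_zero_iff_abs_tendsto_zero _).2 h3

end Schur

/-! ### Quadratic forms and norms -/

section Quadratic

variable {l m n : Type*} [Fintype l] [Fintype m] [Fintype n]

theorem dotProduct_self_nonneg' (x : n → ℝ) : 0 ≤ x ⬝ᵥ x :=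
  Finset.sum_nonneg fun _ _ => mul_self_nonneg _

theorem dotProduct_sq_le (x y : n → ℝ) : (x ⬝ᵥ y) ^ 2 ≤ (x ⬝ᵥ x) * (y ⬝ᵥ y) := by
  have := Finset.sum_mul_sq_le_sq_mul_sq Finset.univ x y
  simpa [dotProduct, sq] using this

theorem dotProduct_mulVec_transpose (M : Matrix m n ℝ) (x : m → ℝ) (y : n → ℝ) :
    x ⬝ᵥ (M *ᵥ y) = (Mᵀ *ᵥ x) ⬝ᵥ y := by
  rw [dotProduct_mulVec, mulVec_transpose]

/-- The quadratic form of a congruence. -/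
theorem quad_congr (A : Matrix m n ℝ) (X : Matrix n n ℝ) (x : m → ℝ) :
    x ⬝ᵥ ((A * X * Aᵀ) *ᵥ x) = (Aᵀ *ᵥ x) ⬝ᵥ (X *ᵥ (Aᵀ *ᵥ x)) := by
  rw [← mulVec_mulVec, ← mulVec_mulVec, dotProduct_mulVec_transpose]

theorem quad_congr' (A : Matrix n m ℝ) (X : Matrix n n ℝ) (x : m → ℝ) :
    x ⬝ᵥ ((Aᵀ * X * A) *ᵥ x) = (A *ᵥ x) ⬝ᵥ (X *ᵥ (A *ᵥ x)) := by
  simpa using quad_congr Aᵀ X x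

theorem PosSemidef.quad_nonneg {M : Matrix n n ℝ} (h : M.PosSemidef) (x : n → ℝ) :
    0 ≤ x ⬝ᵥ (M *ᵥ x) := by
  simpa using h.dotProduct_mulVec_nonneg x

theorem posSemidef_of_quad {M : Matrix n n ℝ} (hs : Mᵀ = M) (h : ∀ x : n → ℝ, 0 ≤ x ⬝ᵥ (M *ᵥ x)) :
    M.PosSemidef :=
  PosSemidef.of_dotProduct_mulVec_nonneg (by simpa [IsHermitian] using hs) (by simpa using h)

omit [Fintype n] in
theorem PosSemidef.transpose_eq {M : Matrix n n ℝ} (h : M.PosSemidef) : Mᵀ = M := by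
  simpa [IsHermitian] using h.isHermitian

/-- The trace of a congruence, as a sum of quadratic forms over the rows. -/
theorem trace_congr_eq_sum (E : Matrix m n ℝ) (X : Matrix n n ℝ) :
    (E * X * Eᵀ).trace = ∑ i, E.row i ⬝ᵥ (X *ᵥ E.row i) := by
  simp only [trace, diag_apply]
  refine Finset.sum_congr rfl fun i _ => ?_
  rw [mul_apply, dotProduct_mulVec]
  simp [dotProduct, mul_apply, vecMul, row_apply]

theorem trace_mul_nonneg {X Y : Matrix n n ℝ} (hX : X.PosSemidef) (hY : Y.PosSemidef) :
    0 ≤ (X * Y).trace := by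
  classical
  open scoped MatrixOrder in
  obtain ⟨H, rfl⟩ := CStarAlgebra.nonneg_iff_eq_star_mul_self.1 hX.nonneg
  rw [star_eq_conjTranspose]
  rw [trace_mul_comm, ← Matrix.mul_assoc, trace_mul_comm, ← Matrix.mul_assoc]
  exact (hY.mul_mul_conjTranspose_same H).trace_nonneg

section Spec

variable [DecidableEq n]

theorem specNorm_nonneg (M : Matrix m n ℝ) : 0 ≤ specNorm M := norm_nonneg _

theorem mulVec_dotProduct_self_le (M : Matrix m n ℝ) (x : n → ℝ) :
    (M *ᵥ x) ⬝ᵥ (M *ᵥ x) ≤ specNorm M ^ 2 * (x ⬝ᵥ x) := by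
  have h := ContinuousLinearMap.le_opNorm (Matrix.toLpLin 2 2 M).toContinuousLinearMap
    (WithLp.toLp 2 x)
  have h2 := pow_le_pow_left₀ (norm_nonneg _) h 2
  rw [mul_pow] at h2
  simp only [LinearMap.coe_toContinuousLinearMap', toLpLin_apply, EuclideanSpace.norm_sq_eq,
    Real.norm_eq_abs, sq_abs] at h2
  simpa [dotProduct, sq, specNorm] using h2

theorem quad_le_specNorm (M : Matrix n n ℝ) (x : n → ℝ) :
    x ⬝ᵥ (M *ᵥ x) ≤ specNorm M * (x ⬝ᵥ x) := by
  have h1 := dotProduct_sq_le x (M *ᵥ x)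
  have h2 := mulVec_dotProduct_self_le M x
  have h0 := dotProduct_self_nonneg' x
  refine abs_le_of_sq_le_sq' ?_ (mul_nonneg (specNorm_nonneg M) h0) |>.2
  nlinarith

theorem lambdaMin_mul_le_quad {M : Matrix n n ℝ} (hM : Mᵀ = M) (x : n → ℝ) :
    lambdaMin M * (x ⬝ᵥ x) ≤ x ⬝ᵥ (M *ᵥ x) := by
  have hH : M.IsHermitian := by simpa [IsHermitian] using hM
  have hle : ∀ μ ∈ spectrum ℝ M, lambdaMin M ≤ μ := fun μ hμ =>
    csInf_le (finite_real_spectrum.bddBelow) hμ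
  have hps : (M - lambdaMin M • (1 : Matrix n n ℝ)).PosSemidef := by
    have hH' : (M - lambdaMin M • (1 : Matrix n n ℝ)).IsHermitian := by
      simp [IsHermitian, transpose_sub, hM]
    rw [hH'.posSemidef_iff_eigenvalues_nonneg]
    intro i
    have hi := hH'.eigenvalues_mem_spectrum_real i
    have h1 : hH'.eigenvalues i + lambdaMin M ∈ spectrum ℝ M := by
      rw [spectrum.mem_iff] at hi ⊢
      convert hi using 2
      rw [map_add, Algebra.algebraMap_eq_smul_one (lambdaMin M)]
      abel
    have := hle _ h1
    simpa using this
  have := PosSemidef.quad_nonneg hps x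
  rw [sub_mulVec, dotProduct_sub, smul_mulVec, one_mulVec, dotProduct_smul, smul_eq_mul] at this
  linarith

theorem lambdaMin_nonneg {M : Matrix n n ℝ} (hM : M.PosSemidef) : 0 ≤ lambdaMin M := by
  refine Real.sInf_nonneg fun μ hμ => ?_
  rw [hM.isHermitian.spectrum_real_eq_range_eigenvalues] at hμ
  obtain ⟨i, rfl⟩ := hμ
  exact hM.eigenvalues_nonneg i

end Spec

theorem lambdaMin_pos [DecidableEq n] [Nonempty n] {M : Matrix n n ℝ} (hM : M.PosDef) :
    0 < lambdaMin M := by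
  have hne : (spectrum ℝ M).Nonempty := by
    rw [hM.isHermitian.spectrum_real_eq_range_eigenvalues]; exact Set.range_nonempty _
  have := hne.csInf_mem finite_real_spectrum
  rw [hM.isHermitian.spectrum_real_eq_range_eigenvalues] at this
  obtain ⟨i, hi⟩ := this
  rw [lambdaMin, hM.isHermitian.spectrum_real_eq_range_eigenvalues, ← hi]
  exact hM.eigenvalues_pos i

theorem PosDef.exists_coercive {M : Matrix n n ℝ} (hM : M.PosDef) :
    ∃ σ > 0, ∀ x : n → ℝ, σ * (x ⬝ᵥ x) ≤ x ⬝ᵥ (M *ᵥ x) := by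
  classical
  rcases isEmpty_or_nonempty n with hn | hn
  · exact ⟨1, one_pos, fun x => by simp⟩
  · exact ⟨lambdaMin M, lambdaMin_pos hM,
      lambdaMin_mul_le_quad (PosSemidef.transpose_eq hM.posSemidef)⟩

theorem frobNorm_sq (M : Matrix m n ℝ) : frobNorm M ^ 2 = ∑ i, M.row i ⬝ᵥ M.row i := by
  have h : frobNorm M = Real.sqrt (∑ i, M.row i ⬝ᵥ M.row i) := by
    simp [frobNorm, dotProduct, sq, row_apply]
  rw [h, Real.sq_sqrt (Finset.sum_nonneg fun i _ => dotProduct_self_nonneg' _)]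

theorem frobNorm_nonneg (M : Matrix m n ℝ) : 0 ≤ frobNorm M := Real.sqrt_nonneg _

/-- The Frobenius inner product. -/
def frobInner (M N : Matrix m n ℝ) : ℝ := ∑ i, M.row i ⬝ᵥ N.row i

theorem frobInner_eq_trace (M N : Matrix m n ℝ) : frobInner M N = (M * Nᵀ).trace := by
  simp [frobInner, trace, mul_apply, dotProduct, row_apply]

theorem frobInner_self (M : Matrix m n ℝ) : frobInner M M = frobNorm M ^ 2 := (frobNorm_sq M).symm

theorem frobInner_sub_left (M M' N : Matrix m n ℝ) :
    frobInner (M - M') N = frobInner M N - frobInner M' N := by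
  simp [frobInner_eq_trace, Matrix.sub_mul]

theorem frobInner_sub_right (M N N' : Matrix m n ℝ) :
    frobInner M (N - N') = frobInner M N - frobInner M N' := by
  simp [frobInner_eq_trace, Matrix.mul_sub]

theorem frobInner_smul_right (c : ℝ) (M N : Matrix m n ℝ) :
    frobInner M (c • N) = c * frobInner M N := by
  simp [frobInner_eq_trace]

theorem frobInner_comm (M N : Matrix m n ℝ) : frobInner M N = frobInner N M := by
  simp [frobInner, dotProduct_comm]

theorem frobNorm_smul (c : ℝ) (M : Matrix m n ℝ) : frobNorm (c • M) = |c| * frobNorm M := by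
  rw [← abs_of_nonneg (frobNorm_nonneg (c • M)), ← abs_of_nonneg (frobNorm_nonneg M), ← abs_mul,
    ← sq_eq_sq_iff_abs_eq_abs, mul_pow, ← frobInner_self, ← frobInner_self, frobInner_smul_right,
    frobInner_comm, frobInner_smul_right]
  ring

theorem frobInner_le (M N : Matrix m n ℝ) : frobInner M N ≤ frobNorm M * frobNorm N := by
  refine abs_le_of_sq_le_sq' ?_ (mul_nonneg (frobNorm_nonneg M) (frobNorm_nonneg N)) |>.2
  rw [mul_pow, frobNorm_sq, frobNorm_sq]
  have := Finset.sum_mul_sq_le_sq_mul_sq Finset.univ (fun q : m × n => M q.1 q.2)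
    (fun q : m × n => N q.1 q.2)
  simpa [Fintype.sum_prod_type, frobInner, dotProduct, sq, row_apply] using this

theorem eq_zero_of_frobNorm_eq_zero {M : Matrix m n ℝ} (h : frobNorm M = 0) : M = 0 := by
  have h1 : frobNorm M ^ 2 = 0 := by simp [h]
  rw [frobNorm_sq, Finset.sum_eq_zero_iff_of_nonneg fun i _ => dotProduct_self_nonneg' _] at h1
  ext i j
  have h2 := dotProduct_self_eq_zero.1 (h1 i (Finset.mem_univ i))
  exact congrFun h2 j

@[simp] theorem frobNorm_zero : frobNorm (0 : Matrix m n ℝ) = 0 := by simp [frobNorm]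

theorem continuous_frobNorm : Continuous (frobNorm : Matrix m n ℝ → ℝ) := by
  unfold frobNorm; fun_prop

theorem quad_le_frobNorm (M : Matrix n n ℝ) (x : n → ℝ) :
    x ⬝ᵥ (M *ᵥ x) ≤ frobNorm M * (x ⬝ᵥ x) := by
  have h1 := dotProduct_sq_le x (M *ᵥ x)
  have h2 : (M *ᵥ x) ⬝ᵥ (M *ᵥ x) ≤ frobNorm M ^ 2 * (x ⬝ᵥ x) := by
    rw [frobNorm_sq, Finset.sum_mul]
    refine Finset.sum_le_sum fun i _ => ?_
    rw [← sq]
    exact dotProduct_sq_le (M.row i) x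
  have h0 := dotProduct_self_nonneg' x
  refine abs_le_of_sq_le_sq' ?_ (mul_nonneg (frobNorm_nonneg M) h0) |>.2
  nlinarith

/-- Young's inequality in the seminorm given by a positive semidefinite matrix. -/
theorem quad_add_le {Y : Matrix n n ℝ} (hY : Y.PosSemidef) {ε : ℝ} (hε : 0 < ε) (p q : n → ℝ) :
    (p + q) ⬝ᵥ (Y *ᵥ (p + q)) ≤
      (1 + ε) * (p ⬝ᵥ (Y *ᵥ p)) + (1 + ε⁻¹) * (q ⬝ᵥ (Y *ᵥ q)) := by
  have hsym : q ⬝ᵥ (Y *ᵥ p) = p ⬝ᵥ (Y *ᵥ q) := by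
    rw [dotProduct_mulVec_transpose, PosSemidef.transpose_eq hY, dotProduct_comm]
  have h1 := PosSemidef.quad_nonneg hY (ε • p - q)
  simp only [mulVec_sub, mulVec_smul, dotProduct_sub, sub_dotProduct, dotProduct_smul,
    smul_dotProduct, smul_eq_mul, hsym] at h1
  have h2 : (1 + ε) * (p ⬝ᵥ (Y *ᵥ p)) + (1 + ε⁻¹) * (q ⬝ᵥ (Y *ᵥ q)) -
      (p ⬝ᵥ (Y *ᵥ p) + p ⬝ᵥ (Y *ᵥ q) + (p ⬝ᵥ (Y *ᵥ q) + q ⬝ᵥ (Y *ᵥ q))) =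
      ε⁻¹ * (ε * (ε * (p ⬝ᵥ (Y *ᵥ p))) - ε * (p ⬝ᵥ (Y *ᵥ q)) -
        (ε * (p ⬝ᵥ (Y *ᵥ q)) - q ⬝ᵥ (Y *ᵥ q))) := by
    field_simp; ring
  have h3 : 0 ≤ ε⁻¹ * (ε * (ε * (p ⬝ᵥ (Y *ᵥ p))) - ε * (p ⬝ᵥ (Y *ᵥ q)) -
      (ε * (p ⬝ᵥ (Y *ᵥ q)) - q ⬝ᵥ (Y *ᵥ q))) := mul_nonneg (by positivity) (by linarith)
  simp only [mulVec_add, dotProduct_add, add_dotProduct, hsym]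
  linarith

theorem abs_le_frobNorm (M : Matrix m n ℝ) (i : m) (j : n) : |M i j| ≤ frobNorm M := by
  refine abs_le_of_sq_le_sq ?_ (frobNorm_nonneg M)
  rw [frobNorm_sq]
  calc M i j ^ 2 = M.row i j * M.row i j := sq _
    _ ≤ M.row i ⬝ᵥ M.row i := Finset.single_le_sum (f := fun j => M.row i j * M.row i j)
        (fun _ _ => mul_self_nonneg _) (Finset.mem_univ j)
    _ ≤ ∑ i, M.row i ⬝ᵥ M.row i := Finset.single_le_sum (f := fun i => M.row i ⬝ᵥ M.row i)
        (fun _ _ => dotProduct_self_nonneg' _) (Finset.mem_univ i)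

theorem tendsto_of_tendsto_frobNorm_sub {f : ℕ → Matrix m n ℝ} {M : Matrix m n ℝ}
    (h : Tendsto (fun k => frobNorm (f k - M)) atTop (𝓝 0)) : Tendsto f atTop (𝓝 M) := by
  refine tendsto_matrix_iff.2 fun i j => ?_
  rw [tendsto_iff_norm_sub_tendsto_zero]
  exact squeeze_zero (fun k => norm_nonneg _) (fun k => abs_le_frobNorm (f k - M) i j) h

end Quadratic

/-! ### The discrete Lyapunov equation -/

section Lyapunov

variable {n : ℕ} {A Q X : Matrix (Fin n) (Fin n) ℝ}

theorem eq_zero_of_eq_mul_mul_transpose (hA : IsSchur A) (h : X = A * X * Aᵀ) : X = 0 := by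
  have hk : ∀ k : ℕ, X = A ^ k * X * (A ^ k)ᵀ := by
    intro k
    induction k with
    | zero => simp
    | succ k ih =>
      conv_lhs => rw [ih, h]
      simp only [pow_succ, transpose_mul, Matrix.mul_assoc]
  have hc : Continuous fun Z : Matrix (Fin n) (Fin n) ℝ => Z * X * Zᵀ := by fun_prop
  have h1 := (hc.tendsto 0).comp hA.tendsto_pow
  have h2 : (fun Z : Matrix (Fin n) (Fin n) ℝ => Z * X * Zᵀ) ∘ (fun k : ℕ => A ^ k) =
      fun _ => X := funext fun k => (hk k).symm
  rw [h2] at h1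
  simpa using tendsto_nhds_unique tendsto_const_nhds h1

theorem kronecker_mulVec_vec' (A X : Matrix (Fin n) (Fin n) ℝ) :
    (1 - A ⊗ₖ A) *ᵥ X.vec = (X - A * X * Aᵀ).vec := by
  rw [sub_mulVec, one_mulVec, kronecker_mulVec_vec, vec_sub]

theorem isUnit_det_one_sub_kronecker (hA : IsSchur A) : IsUnit (1 - A ⊗ₖ A).det := by
  rw [isUnit_iff_ne_zero]
  intro h
  obtain ⟨v, hv0, hv⟩ := exists_mulVec_eq_zero_iff.2 h
  obtain ⟨X, rfl⟩ := (vec_bijective (m := Fin n) (n := Fin n) (R := ℝ)).2 v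
  rw [kronecker_mulVec_vec', vec_eq_zero_iff, sub_eq_zero] at hv
  exact hv0 (by rw [eq_zero_of_eq_mul_mul_transpose hA hv, vec_zero])

theorem vec_eq_of_lyapunov (hA : IsUnit (1 - A ⊗ₖ A).det) (h : X = Q + A * X * Aᵀ) :
    X.vec = (1 - A ⊗ₖ A)⁻¹ *ᵥ Q.vec := by
  have h1 : Q = X - A * X * Aᵀ := eq_sub_of_add_eq h.symm
  rw [h1, ← kronecker_mulVec_vec', mulVec_mulVec, nonsing_inv_mul _ hA, one_mulVec]

theorem dlyap_eq_of_isUnit (hA : IsUnit (1 - A ⊗ₖ A).det) :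
    dlyap A Q = Q + A * dlyap A Q * Aᵀ := by
  have hex : ∃ X, X = Q + A * X * Aᵀ := by
    obtain ⟨X, hX⟩ := (vec_bijective (m := Fin n) (n := Fin n) (R := ℝ)).2
      ((1 - A ⊗ₖ A)⁻¹ *ᵥ Q.vec)
    refine ⟨X, ?_⟩
    rw [← sub_eq_iff_eq_add, ← vec_inj, ← kronecker_mulVec_vec', hX, mulVec_mulVec,
      mul_nonsing_inv _ hA, one_mulVec]
  unfold dlyap
  rw [dif_pos hex]
  exact hex.choose_spec

theorem eq_dlyap_of_isUnit (hA : IsUnit (1 - A ⊗ₖ A).det) (h : X = Q + A * X * Aᵀ) :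
    X = dlyap A Q := by
  rw [← vec_inj, vec_eq_of_lyapunov hA h, vec_eq_of_lyapunov hA (dlyap_eq_of_isUnit hA)]

theorem dlyap_eq (hA : IsSchur A) : dlyap A Q = Q + A * dlyap A Q * Aᵀ :=
  dlyap_eq_of_isUnit (isUnit_det_one_sub_kronecker hA)

theorem dlyap_transpose_of_isUnit (hA : IsUnit (1 - A ⊗ₖ A).det) (hQ : Qᵀ = Q) :
    (dlyap A Q)ᵀ = dlyap A Q := by
  refine eq_dlyap_of_isUnit hA ?_
  conv_lhs => rw [dlyap_eq_of_isUnit hA]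
  simp [hQ, transpose_add, transpose_mul, Matrix.mul_assoc]

theorem dlyap_transpose (hA : IsSchur A) (hQ : Qᵀ = Q) : (dlyap A Q)ᵀ = dlyap A Q :=
  dlyap_transpose_of_isUnit (isUnit_det_one_sub_kronecker hA) hQ

theorem dlyap_posSemidef (hA : IsSchur A) (hQ : Q.PosSemidef) : (dlyap A Q).PosSemidef := by
  refine posSemidef_of_quad (dlyap_transpose hA (PosSemidef.transpose_eq hQ)) fun x => ?_
  set X := dlyap A Q with hX
  -- the quadratic form of `X` dominates those of `A ^ k * X * (A ^ k)ᵀ`, which tend to zero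
  have hk : ∀ k : ℕ, x ⬝ᵥ ((A ^ k * X * (A ^ k)ᵀ) *ᵥ x) ≤ x ⬝ᵥ (X *ᵥ x) := by
    intro k
    induction k with
    | zero => simp
    | succ k ih =>
      refine le_trans ?_ ih
      have h1 : A ^ k * X * (A ^ k)ᵀ =
          A ^ k * Q * (A ^ k)ᵀ + A ^ (k + 1) * X * (A ^ (k + 1))ᵀ := by
        conv_lhs => rw [hX, dlyap_eq hA]
        simp only [pow_succ, transpose_mul, Matrix.mul_assoc, Matrix.mul_add, Matrix.add_mul, hX]
      rw [h1, add_mulVec, dotProduct_add, quad_congr _ Q]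
      linarith [PosSemidef.quad_nonneg hQ ((A ^ k)ᵀ *ᵥ x)]
  have hc : Continuous fun Z : Matrix (Fin n) (Fin n) ℝ => x ⬝ᵥ ((Z * X * Zᵀ) *ᵥ x) := by fun_prop
  have h1 := (hc.tendsto 0).comp hA.tendsto_pow
  simp only [Matrix.zero_mul, zero_mulVec, dotProduct_zero] at h1
  exact le_of_tendsto' h1 hk

theorem quad_le_quad_dlyap (hA : IsSchur A) (hQ : Q.PosSemidef) (x : Fin n → ℝ) :
    x ⬝ᵥ (Q *ᵥ x) ≤ x ⬝ᵥ (dlyap A Q *ᵥ x) := by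
  rw [dlyap_eq hA, add_mulVec, dotProduct_add, quad_congr]
  linarith [PosSemidef.quad_nonneg (dlyap_posSemidef hA hQ) (Aᵀ *ᵥ x)]

/-- The two Lyapunov equations, for `A` and for `Aᵀ`, are adjoint for the trace pairing. -/
theorem trace_mul_dlyap (hA : IsSchur A) (P : Matrix (Fin n) (Fin n) ℝ) :
    (P * Q).trace = ((P - Aᵀ * P * A) * dlyap A Q).trace := by
  have h : Q = dlyap A Q - A * dlyap A Q * Aᵀ := eq_sub_of_add_eq (dlyap_eq hA).symm
  conv_lhs => rw [h]
  rw [Matrix.mul_sub, Matrix.sub_mul, trace_sub, trace_sub]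
  congr 1
  rw [← Matrix.mul_assoc, trace_mul_comm]
  simp only [Matrix.mul_assoc]

/-- A geometric bound on powers from two-sided bounds on a solution of a Lyapunov equation. Unlike
Schur stability itself it is a closed condition on `A`. -/
theorem geometric_bound_of_lyapunov {σ c : ℝ} (hσ : 0 < σ) (hc : 0 < c) (hσc : σ ≤ c)
    (hQ : ∀ x : Fin n → ℝ, σ * (x ⬝ᵥ x) ≤ x ⬝ᵥ (Q *ᵥ x))
    (hX0 : ∀ x : Fin n → ℝ, 0 ≤ x ⬝ᵥ (X *ᵥ x))
    (hX : ∀ x : Fin n → ℝ, x ⬝ᵥ (X *ᵥ x) ≤ c * (x ⬝ᵥ x)) (h : X = Q + A * X * Aᵀ)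
    (k : ℕ) (x : Fin n → ℝ) :
    ((A ^ k)ᵀ *ᵥ x) ⬝ᵥ ((A ^ k)ᵀ *ᵥ x) ≤ (c / σ) * (1 - σ / c) ^ k * (x ⬝ᵥ x) := by
  have hstep : ∀ y : Fin n → ℝ, (Aᵀ *ᵥ y) ⬝ᵥ (X *ᵥ (Aᵀ *ᵥ y)) ≤ (1 - σ / c) * (y ⬝ᵥ (X *ᵥ y)) := by
    intro y
    have h1 : y ⬝ᵥ (X *ᵥ y) = y ⬝ᵥ (Q *ᵥ y) + (Aᵀ *ᵥ y) ⬝ᵥ (X *ᵥ (Aᵀ *ᵥ y)) := by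
      rw [← quad_congr, ← dotProduct_add, ← add_mulVec, ← h]
    have h2 : σ / c * (y ⬝ᵥ (X *ᵥ y)) ≤ σ * (y ⬝ᵥ y) := by
      rw [div_mul_eq_mul_div, div_le_iff₀ hc]
      nlinarith [hX y]
    nlinarith [hQ y]
  have hr : 0 ≤ 1 - σ / c := by
    rw [sub_nonneg, div_le_one hc]; exact hσc
  have hk : ∀ k : ℕ, ((A ^ k)ᵀ *ᵥ x) ⬝ᵥ (X *ᵥ ((A ^ k)ᵀ *ᵥ x)) ≤
      (1 - σ / c) ^ k * (x ⬝ᵥ (X *ᵥ x)) := by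
    intro k
    induction k with
    | zero => simp
    | succ k ih =>
      have h1 : (A ^ (k + 1))ᵀ *ᵥ x = Aᵀ *ᵥ ((A ^ k)ᵀ *ᵥ x) := by
        rw [pow_succ, transpose_mul, mulVec_mulVec]
      rw [h1, pow_succ', mul_assoc]
      exact (hstep _).trans (mul_le_mul_of_nonneg_left ih hr)
  have h3 : σ * (((A ^ k)ᵀ *ᵥ x) ⬝ᵥ ((A ^ k)ᵀ *ᵥ x)) ≤ (1 - σ / c) ^ k * (c * (x ⬝ᵥ x)) := by
    have hy : ∀ y : Fin n → ℝ, σ * (y ⬝ᵥ y) ≤ y ⬝ᵥ (X *ᵥ y) := by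
      intro y
      have h1 : y ⬝ᵥ (X *ᵥ y) = y ⬝ᵥ (Q *ᵥ y) + (Aᵀ *ᵥ y) ⬝ᵥ (X *ᵥ (Aᵀ *ᵥ y)) := by
        rw [← quad_congr, ← dotProduct_add, ← add_mulVec, ← h]
      linarith [hQ y, hX0 (Aᵀ *ᵥ y)]
    exact (hy _).trans ((hk k).trans (mul_le_mul_of_nonneg_left (hX x) (pow_nonneg hr k)))
  rw [mul_comm, ← le_div_iff₀ hσ] at h3
  refine h3.trans (le_of_eq ?_)
  ring

/-- Lyapunov's criterion: a nonnegative solution for a positive definite right-hand side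
certifies stability. -/
theorem isSchur_of_lyapunov (hQ : Q.PosDef) (hX0 : ∀ x : Fin n → ℝ, 0 ≤ x ⬝ᵥ (X *ᵥ x))
    (h : X = Q + A * X * Aᵀ) : IsSchur A := by
  obtain ⟨σ, hσ, hQ'⟩ := PosDef.exists_coercive hQ
  have hc : 0 < specNorm X + σ := add_pos_of_nonneg_of_pos (specNorm_nonneg X) hσ
  refine isSchur_of_geometric_bound (c := (specNorm X + σ) / σ)
    (r := 1 - σ / (specNorm X + σ)) ?_ ?_
    (geometric_bound_of_lyapunov hσ hc (by linarith [specNorm_nonneg X]) hQ' hX0 (fun x => ?_) h)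
  · rw [sub_nonneg, div_le_one hc]; linarith [specNorm_nonneg X]
  · have : 0 < σ / (specNorm X + σ) := by positivity
    linarith
  · refine (quad_le_specNorm X x).trans ?_
    nlinarith [dotProduct_self_nonneg' x]

theorem continuous_one_sub_kronecker :
    Continuous fun Z : Matrix (Fin n) (Fin n) ℝ => 1 - Z ⊗ₖ Z := by
  refine continuous_const.sub (continuous_matrix fun i j => ?_)
  simp only [kroneckerMap_apply]
  fun_prop

theorem eventually_isUnit_det (hA : IsSchur A) :
    ∀ᶠ Z : Matrix (Fin n) (Fin n) ℝ in 𝓝 A, IsUnit (1 - Z ⊗ₖ Z).det := by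
  have := (continuous_one_sub_kronecker.matrix_det.continuousAt (x := A)).eventually_ne
    (isUnit_iff_ne_zero.1 (isUnit_det_one_sub_kronecker hA))
  simpa only [isUnit_iff_ne_zero] using this

theorem continuousAt_dlyap (hA : IsSchur A) : ContinuousAt (fun Z => dlyap Z Q) A := by
  have hu := isUnit_det_one_sub_kronecker hA
  have hcont := continuous_one_sub_kronecker (n := n)
  have hev := eventually_isUnit_det hA
  have hinv : ContinuousAt (fun Z : Matrix (Fin n) (Fin n) ℝ => (1 - Z ⊗ₖ Z)⁻¹) A := by
    refine ContinuousAt.comp (g := Inv.inv) (continuousAt_matrix_inv _ ?_) hcont.continuousAt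
    have : (Ring.inverse : ℝ → ℝ) = Inv.inv := funext Ring.inverse_eq_inv
    rw [this]
    exact continuousAt_inv₀ (isUnit_iff_ne_zero.1 hu)
  have hvec : ContinuousAt (fun Z : Matrix (Fin n) (Fin n) ℝ => (1 - Z ⊗ₖ Z)⁻¹ *ᵥ Q.vec) A :=
    ContinuousAt.comp (g := fun M : Matrix (Fin n × Fin n) (Fin n × Fin n) ℝ => M *ᵥ Q.vec)
      (Continuous.continuousAt (by fun_prop)) hinv
  refine tendsto_matrix_iff.2 fun i j => ?_
  have h1 := (continuous_apply (j, i)).continuousAt.tendsto.comp hvec.tendsto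
  have h2 : ∀ Z : Matrix (Fin n) (Fin n) ℝ, IsUnit (1 - Z ⊗ₖ Z).det →
      ((1 - Z ⊗ₖ Z)⁻¹ *ᵥ Q.vec) (j, i) = dlyap Z Q i j := by
    intro Z hZ
    rw [← vec_eq_of_lyapunov hZ (dlyap_eq_of_isUnit hZ)]
    rfl
  simp only [Function.comp_def] at h1
  rw [h2 A hu] at h1
  exact h1.congr' (hev.mono fun Z hZ => h2 Z hZ)

theorem isOpen_setOf_isSchur : IsOpen {A : Matrix (Fin n) (Fin n) ℝ | IsSchur A} := by
  rw [isOpen_iff_mem_nhds]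
  intro A hA
  have h1 : ContinuousAt (fun Z => frobNorm (dlyap A 1 - dlyap Z 1)) A :=
    ContinuousAt.comp (g := frobNorm) continuous_frobNorm.continuousAt
      (continuousAt_const.sub (continuousAt_dlyap hA))
  have h2 : ∀ᶠ Z in 𝓝 A, frobNorm (dlyap A 1 - dlyap Z 1) < 1 :=
    h1.eventually_lt_const (by simp)
  filter_upwards [h2, eventually_isUnit_det hA] with Z hZ hZu
  refine isSchur_of_lyapunov (Q := 1) PosDef.one (fun x => ?_) (dlyap_eq_of_isUnit hZu)
  have h4 := quad_le_frobNorm (dlyap A 1 - dlyap Z 1) x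
  have h5 := quad_le_quad_dlyap hA PosSemidef.one x
  rw [sub_mulVec, dotProduct_sub] at h4
  rw [one_mulVec] at h5
  nlinarith [dotProduct_self_nonneg' x]

end Lyapunov

/-! ### Second moments of linear stochastic recursions -/

section SecondMoments

variable {Ω : Type*} [MeasurableSpace Ω] {μ : Measure Ω}
variable {ι κ κ' : Type*} [Fintype ι] [Fintype κ] [Fintype κ']

/-- All coordinates of the random vector `X` are square integrable. -/
def L2Vec (μ : Measure Ω) (X : Ω → κ → ℝ) : Prop := ∀ i, MemLp (fun ω => X ω i) 2 μ

/-- The matrix `E[X Yᵀ]` of second moments. -/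
noncomputable def secMom (μ : Measure Ω) (X : Ω → κ → ℝ) (Y : Ω → κ' → ℝ) : Matrix κ κ' ℝ :=
  Matrix.of fun i j => ∫ ω, X ω i * Y ω j ∂μ

omit [Fintype κ] in
theorem L2Vec.add {X Y : Ω → κ → ℝ} (hX : L2Vec μ X) (hY : L2Vec μ Y) :
    L2Vec μ (fun ω => X ω + Y ω) := fun i => (hX i).add (hY i)

omit [Fintype κ'] in
theorem L2Vec.mulVec {X : Ω → κ → ℝ} (hX : L2Vec μ X) (M : Matrix κ' κ ℝ) :
    L2Vec μ (fun ω => M *ᵥ X ω) := fun i => by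
  simp only [Matrix.mulVec, dotProduct]
  exact memLp_finsetSum _ fun j _ => (hX j).const_mul (M i j)

omit [Fintype κ] [Fintype κ'] in
theorem L2Vec.integrable_mul {X : Ω → κ → ℝ} {Y : Ω → κ' → ℝ} (hX : L2Vec μ X) (hY : L2Vec μ Y)
    (i : κ) (j : κ') : Integrable (fun ω => X ω i * Y ω j) μ := (hX i).integrable_mul (hY j)

omit [Fintype κ] [Fintype κ'] in
theorem secMom_transpose (X : Ω → κ → ℝ) (Y : Ω → κ' → ℝ) :
    (secMom μ X Y)ᵀ = secMom μ Y X := by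
  ext i j
  simp [secMom, mul_comm]

omit [Fintype κ] [Fintype κ'] in
theorem secMom_add_left {X X' : Ω → κ → ℝ} {Y : Ω → κ' → ℝ} (hX : L2Vec μ X) (hX' : L2Vec μ X')
    (hY : L2Vec μ Y) : secMom μ (fun ω => X ω + X' ω) Y = secMom μ X Y + secMom μ X' Y := by
  ext i j
  simp only [secMom, of_apply, Pi.add_apply, add_mul, Matrix.add_apply]
  exact integral_add (hX.integrable_mul hY i j) (hX'.integrable_mul hY i j)

omit [Fintype κ'] [Fintype ι] in
theorem secMom_mulVec_left {X : Ω → κ → ℝ} {Y : Ω → κ' → ℝ} (hX : L2Vec μ X)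
    (hY : L2Vec μ Y) (M : Matrix ι κ ℝ) :
    secMom μ (fun ω => M *ᵥ X ω) Y = M * secMom μ X Y := by
  ext i j
  simp only [secMom, of_apply, Matrix.mul_apply, Matrix.mulVec, dotProduct, Finset.sum_mul,
    mul_assoc]
  rw [integral_finsetSum _ fun k _ => (hX.integrable_mul hY k j).const_mul (M i k)]
  simp only [integral_const_mul]

omit [Fintype κ] [Fintype κ'] in
theorem secMom_add_right {X : Ω → κ → ℝ} {Y Y' : Ω → κ' → ℝ} (hX : L2Vec μ X)
    (hY : L2Vec μ Y) (hY' : L2Vec μ Y') :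
    secMom μ X (fun ω => Y ω + Y' ω) = secMom μ X Y + secMom μ X Y' := by
  rw [← secMom_transpose, secMom_add_left hY hY' hX, transpose_add, secMom_transpose,
    secMom_transpose]

omit [Fintype κ'] [Fintype ι] in
theorem secMom_mulVec_right {X : Ω → κ → ℝ} {Y : Ω → κ' → ℝ} (hX : L2Vec μ X)
    (hY : L2Vec μ Y) (M : Matrix ι κ ℝ) :
    secMom μ Y (fun ω => M *ᵥ X ω) = secMom μ Y X * Mᵀ := by
  rw [← secMom_transpose, secMom_mulVec_left hX hY, transpose_mul, secMom_transpose]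

omit [Fintype ι] in
/-- Second moments of a sum of two linear images of orthogonal random vectors. -/
theorem secMom_affine {X : Ω → κ → ℝ} {Y : Ω → κ' → ℝ} (hX : L2Vec μ X) (hY : L2Vec μ Y)
    (h : secMom μ X Y = 0) (M : Matrix ι κ ℝ) (G : Matrix ι κ' ℝ) :
    secMom μ (fun ω => M *ᵥ X ω + G *ᵥ Y ω) (fun ω => M *ᵥ X ω + G *ᵥ Y ω) =
      M * secMom μ X X * Mᵀ + G * secMom μ Y Y * Gᵀ := by
  have h' : secMom μ Y X = 0 := by rw [← secMom_transpose, h, transpose_zero]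
  have hMX := hX.mulVec M
  have hGY := hY.mulVec G
  rw [secMom_add_left hMX hGY (hMX.add hGY), secMom_add_right hMX hMX hGY,
    secMom_add_right hGY hMX hGY, secMom_mulVec_left hX hMX, secMom_mulVec_left hX hGY,
    secMom_mulVec_left hY hMX, secMom_mulVec_left hY hGY, secMom_mulVec_right hX hX,
    secMom_mulVec_right hY hX, secMom_mulVec_right hX hY, secMom_mulVec_right hY hY, h, h']
  simp [Matrix.mul_assoc]

omit [Fintype κ'] [Fintype ι] in
theorem integral_quad {X : Ω → κ → ℝ} (hX : L2Vec μ X) (Q : Matrix κ κ ℝ) :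
    Integrable (fun ω => X ω ⬝ᵥ (Q *ᵥ X ω)) μ ∧
      ∫ ω, X ω ⬝ᵥ (Q *ᵥ X ω) ∂μ = (Q * secMom μ X X).trace := by
  have hQ := hX.mulVec Q
  have hint : ∀ i, Integrable (fun ω => X ω i * (Q *ᵥ X ω) i) μ := fun i => hX.integrable_mul hQ i i
  simp only [dotProduct]
  refine ⟨integrable_finsetSum _ fun i _ => hint i, ?_⟩
  rw [integral_finsetSum _ fun i _ => hint i, ← secMom_mulVec_left hX hX]
  simp [trace, secMom, mul_comm]

/-- A process driven by white noise is square integrable and orthogonal to the present and future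
noise, and its second moments propagate linearly. -/
theorem secMom_recursion [DecidableEq κ'] {ξ : ℕ → Ω → κ → ℝ} {ζ : ℕ → Ω → κ' → ℝ}
    {M : Matrix κ κ ℝ} {G : Matrix κ κ' ℝ}
    (hζ : ∀ t, L2Vec μ (ζ t)) (horth : ∀ s t, s ≠ t → secMom μ (ζ s) (ζ t) = 0)
    (h0 : ξ 0 = fun _ => 0) (hstep : ∀ t, ξ (t + 1) = fun ω => M *ᵥ ξ t ω + G *ᵥ ζ t ω) (t : ℕ) :
    L2Vec μ (ξ t) ∧ (∀ s, t ≤ s → secMom μ (ξ t) (ζ s) = 0) ∧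
      secMom μ (ξ (t + 1)) (ξ (t + 1)) =
        M * secMom μ (ξ t) (ξ t) * Mᵀ + G * secMom μ (ζ t) (ζ t) * Gᵀ := by
  have key : L2Vec μ (ξ t) ∧ ∀ s, t ≤ s → secMom μ (ξ t) (ζ s) = 0 := by
    induction t with
    | zero =>
      refine ⟨fun i => by simp [h0], fun s _ => ?_⟩
      ext i j
      simp [h0, secMom]
    | succ t ih =>
      obtain ⟨ih1, ih2⟩ := ih
      rw [hstep t]
      refine ⟨(ih1.mulVec M).add ((hζ t).mulVec G), fun s hs => ?_⟩
      rw [secMom_add_left (ih1.mulVec M) ((hζ t).mulVec G) (hζ s), secMom_mulVec_left ih1 (hζ s),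
        secMom_mulVec_left (hζ t) (hζ s), ih2 s (by omega), horth t s (by omega)]
      simp
  refine ⟨key.1, key.2, ?_⟩
  rw [hstep t]
  exact secMom_affine key.1 (hζ t) (key.2 t le_rfl) M G

omit [Fintype κ] in
/-- Linear matrix recursions converge to their fixed point when the dynamics are Schur stable. -/
theorem tendsto_of_lyapunov_recursion [Fintype κ] [DecidableEq κ] {M W X : Matrix κ κ ℝ}
    {Z : ℕ → Matrix κ κ ℝ} (hM : IsSchur M) (hX : X = M * X * Mᵀ + W)
    (hZ : ∀ t, Z (t + 1) = M * Z t * Mᵀ + W) : Tendsto Z atTop (𝓝 X) := by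
  have h : ∀ t, Z t = M ^ t * (Z 0 - X) * (M ^ t)ᵀ + X := by
    intro t
    induction t with
    | zero => simp
    | succ t ih =>
      rw [hZ t, ih, pow_succ', transpose_mul, Matrix.mul_add, Matrix.add_mul, add_assoc, ← hX]
      simp only [Matrix.mul_assoc]
  have hc : Continuous fun Y : Matrix κ κ ℝ => Y * (Z 0 - X) * Yᵀ + X := by fun_prop
  have h1 := (hc.tendsto 0).comp hM.tendsto_pow
  simp only [Matrix.zero_mul, zero_add] at h1
  exact h1.congr fun t => (h t).symm

end SecondMoments

/-! ### The noise process -/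

section Noise

variable {nx nu ny : ℕ} (T : LQGTask nx nu ny)

/-- The law of a single noise pair `(w, v)`. -/
noncomputable abbrev LQGTask.stepLaw (T : LQGTask nx nu ny) :
    Measure (EuclideanSpace ℝ (Fin nx) × EuclideanSpace ℝ (Fin ny)) :=
  (multivariateGaussian 0 T.W).prod (multivariateGaussian 0 T.V)

theorem memLp_eval_gaussian {n : ℕ} (W : Matrix (Fin n) (Fin n) ℝ) (i : Fin n) :
    MemLp (fun x : EuclideanSpace ℝ (Fin n) => x.ofLp i) 2 (multivariateGaussian 0 W) :=
  IsGaussian.memLp_dual _ (EuclideanSpace.proj i) 2 (by simp)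

theorem integral_eval_gaussian {n : ℕ} (W : Matrix (Fin n) (Fin n) ℝ) (i : Fin n) :
    ∫ x : EuclideanSpace ℝ (Fin n), x.ofLp i ∂(multivariateGaussian 0 W) = 0 := by
  have h := ContinuousLinearMap.integral_comp_comm (μ := multivariateGaussian 0 W)
    (EuclideanSpace.proj (𝕜 := ℝ) i) (φ := fun x : EuclideanSpace ℝ (Fin n) => x)
    (IsGaussian.integrable_id)
  rw [integral_id_multivariateGaussian] at h
  simpa using h

theorem integral_eval_mul_eval_gaussian {n : ℕ} {W : Matrix (Fin n) (Fin n) ℝ} (hW : W.PosSemidef)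
    (i j : Fin n) :
    ∫ x : EuclideanSpace ℝ (Fin n), x.ofLp i * x.ofLp j ∂(multivariateGaussian 0 W) = W i j := by
  have h := covariance_eval_multivariateGaussian (μ := 0) hW i j
  rw [covariance_eq_sub (memLp_eval_gaussian W i) (memLp_eval_gaussian W j),
    integral_eval_gaussian, zero_mul, sub_zero] at h
  exact h

/-- The coordinates of a noise pair. -/
def noiseCoord (q : EuclideanSpace ℝ (Fin nx) × EuclideanSpace ℝ (Fin ny)) :
    Fin nx ⊕ Fin ny → ℝ := Sum.elim q.1.ofLp q.2.ofLp

theorem measurable_noiseCoord (a : Fin nx ⊕ Fin ny) :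
    Measurable fun q : EuclideanSpace ℝ (Fin nx) × EuclideanSpace ℝ (Fin ny) => noiseCoord q a := by
  rcases a with i | j
  · simp only [noiseCoord, Sum.elim_inl]; fun_prop
  · simp only [noiseCoord, Sum.elim_inr]; fun_prop

theorem memLp_noiseCoord (a : Fin nx ⊕ Fin ny) : MemLp (fun q => noiseCoord q a) 2 T.stepLaw := by
  rcases a with i | j
  · exact (memLp_eval_gaussian T.W i).comp_fst _
  · exact (memLp_eval_gaussian T.V j).comp_snd _

theorem integral_noiseCoord (a : Fin nx ⊕ Fin ny) : ∫ q, noiseCoord q a ∂T.stepLaw = 0 := by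
  rcases a with i | j
  · simp only [noiseCoord, Sum.elim_inl]
    rw [integral_fun_fst (fun x : EuclideanSpace ℝ (Fin nx) => x.ofLp i), integral_eval_gaussian,
      smul_zero]
  · simp only [noiseCoord, Sum.elim_inr]
    rw [integral_fun_snd (fun x : EuclideanSpace ℝ (Fin ny) => x.ofLp j), integral_eval_gaussian,
      smul_zero]

theorem integral_noiseCoord_mul (a b : Fin nx ⊕ Fin ny) :
    ∫ q, noiseCoord q a * noiseCoord q b ∂T.stepLaw = fromBlocks T.W 0 0 T.V a b := by
  rcases a with i | j <;> rcases b with i' | j' <;> simp only [noiseCoord, Sum.elim_inl,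
    Sum.elim_inr, fromBlocks_apply₁₁, fromBlocks_apply₁₂, fromBlocks_apply₂₁, fromBlocks_apply₂₂]
  · rw [integral_fun_fst (fun x : EuclideanSpace ℝ (Fin nx) => x.ofLp i * x.ofLp i'),
      integral_eval_mul_eval_gaussian T.hW]
    simp
  · rw [integral_prod_mul (fun x : EuclideanSpace ℝ (Fin nx) => x.ofLp i)
      (fun x : EuclideanSpace ℝ (Fin ny) => x.ofLp j'), integral_eval_gaussian]
    simp
  · simp only [mul_comm]
    rw [integral_prod_mul (fun x : EuclideanSpace ℝ (Fin nx) => x.ofLp i')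
      (fun x : EuclideanSpace ℝ (Fin ny) => x.ofLp j), integral_eval_gaussian]
    simp
  · rw [integral_fun_snd (fun x : EuclideanSpace ℝ (Fin ny) => x.ofLp j * x.ofLp j'),
      integral_eval_mul_eval_gaussian T.hV.posSemidef]
    simp

theorem memLp_noise (s : ℕ) (a : Fin nx ⊕ Fin ny) :
    MemLp (fun ω : ℕ → _ => noiseCoord (ω s) a) 2 T.noiseLaw :=
  (memLp_noiseCoord T a).comp_measurePreserving
    (measurePreserving_eval_infinitePi (fun _ : ℕ => T.stepLaw) s)

theorem integral_noise_mul_self (s : ℕ) (a b : Fin nx ⊕ Fin ny) :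
    ∫ ω, noiseCoord (ω s) a * noiseCoord (ω s) b ∂T.noiseLaw = fromBlocks T.W 0 0 T.V a b := by
  rw [← integral_noiseCoord_mul T a b]
  have hp := measurePreserving_eval_infinitePi (fun _ : ℕ => T.stepLaw) s
  rw [← hp.map_eq, integral_map hp.aemeasurable]
  · rfl
  · exact ((measurable_noiseCoord a).mul (measurable_noiseCoord b)).aestronglyMeasurable

theorem integral_noise_mul_of_ne {s t : ℕ} (h : s ≠ t) (a b : Fin nx ⊕ Fin ny) :
    ∫ ω, noiseCoord (ω s) a * noiseCoord (ω t) b ∂T.noiseLaw = 0 := by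
  have hmean : ∫ ω, noiseCoord (ω s) a ∂T.noiseLaw = 0 := by
    rw [← integral_noiseCoord T a]
    have hp := measurePreserving_eval_infinitePi (fun _ : ℕ => T.stepLaw) s
    rw [← hp.map_eq, integral_map hp.aemeasurable]
    · rfl
    · exact (measurable_noiseCoord a).aestronglyMeasurable
  have hind : iIndepFun (fun (s : ℕ) (ω : ℕ → EuclideanSpace ℝ (Fin nx) ×
      EuclideanSpace ℝ (Fin ny)) => ω s) T.noiseLaw :=
    iIndepFun_infinitePi (P := fun _ : ℕ => T.stepLaw) (X := fun _ q => q) fun _ => measurable_id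
  have h2 := (hind.indepFun h).comp (measurable_noiseCoord a) (measurable_noiseCoord b)
  have h3 := h2.integral_fun_mul_eq_mul_integral (memLp_noise T s a).aestronglyMeasurable
    (memLp_noise T t b).aestronglyMeasurable
  simp only [Function.comp_def] at h3
  rw [h3, hmean, zero_mul]

end Noise

/-! ### The LQG cost of a stabilizing gain -/

section Kalman

variable {nx nu ny : ℕ} {T : LQGTask nx nu ny}

/-- The innovation covariance `C Σ̃ Cᵀ + V`. -/
noncomputable abbrev LQGTask.innovCov (T : LQGTask nx nu ny) : Matrix (Fin ny) (Fin ny) ℝ :=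
  T.C * T.predCov * T.Cᵀ + T.V

/-- If the filtering Riccati equation had no stabilizing solution, then `predCov`, and with it
`noiseCov`, would vanish. -/
theorem isDareSolution_predCov (hν : T.noiseCov.PosDef) (hn : 0 < nx) :
    IsDareSolution T.Aᵀ T.Cᵀ T.W T.V T.predCov := by
  by_cases h : ∃ P, IsDareSolution T.Aᵀ T.Cᵀ T.W T.V P
  · rw [LQGTask.predCov, dare, dif_pos h]
    exact h.choose_spec
  · exfalso
    have h0 : T.predCov = 0 := by rw [LQGTask.predCov, dare, dif_neg h]
    have h1 : T.noiseCov = 0 := by simp [LQGTask.noiseCov, LQGTask.kalmanGain, h0]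
    have := hν.diag_pos (i := ⟨0, hn⟩)
    simp [h1] at this

section Gain

variable (h : IsDareSolution T.Aᵀ T.Cᵀ T.W T.V T.predCov)
include h

theorem isUnit_innovCov : IsUnit T.innovCov.det := by
  have := h.isUnit
  rwa [transpose_transpose, add_comm] at this

theorem kalmanGain_mul_innovCov : T.kalmanGain * T.innovCov = T.predCov * T.Cᵀ := by
  rw [LQGTask.kalmanGain, Matrix.mul_assoc, nonsing_inv_mul _ (isUnit_innovCov h), Matrix.mul_one]

theorem innovCov_transpose : T.innovCovᵀ = T.innovCov := by
  simp [transpose_add, transpose_mul, h.symm, PosSemidef.transpose_eq T.hV.posSemidef,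
    Matrix.mul_assoc]

theorem innovCov_mul_kalmanGain_transpose : T.innovCov * T.kalmanGainᵀ = T.C * T.predCov := by
  have := congrArg transpose (kalmanGain_mul_innovCov h)
  rwa [transpose_mul, transpose_mul, innovCov_transpose h, transpose_transpose, h.symm] at this

theorem predCov_eq :
    T.predCov = T.W + T.A * ((1 - T.kalmanGain * T.C) * T.predCov) * T.Aᵀ := by
  have h1 := h.eq
  rw [transpose_transpose, transpose_transpose, add_comm T.V] at h1
  have h2 : T.A * T.predCov * T.Cᵀ * (T.C * T.predCov * T.Cᵀ + T.V)⁻¹ * T.C * T.predCov * T.Aᵀ =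
      T.A * (T.kalmanGain * T.C * T.predCov) * T.Aᵀ := by
    simp only [LQGTask.kalmanGain, Matrix.mul_assoc]
  rw [h2] at h1
  conv_lhs => rw [h1]
  simp only [Matrix.sub_mul, Matrix.mul_sub, Matrix.one_mul, add_sub_assoc]

/-- The estimation error dynamics are stable. -/
theorem isSchur_error : IsSchur ((1 - T.kalmanGain * T.C) * T.A) := by
  refine IsSchur.mul_comm ?_
  have h1 := h.stabilizing.transpose
  have h2 : (T.Aᵀ - T.Cᵀ * ((T.V + T.Cᵀᵀ * T.predCov * T.Cᵀ)⁻¹ * T.Cᵀᵀ * T.predCov * T.Aᵀ))ᵀ =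
      T.A * (1 - T.kalmanGain * T.C) := by
    have h3 : T.V + T.Cᵀᵀ * T.predCov * T.Cᵀ = T.innovCov := by
      rw [transpose_transpose, add_comm]
    have h4 : T.kalmanGain = T.predCov * T.Cᵀ * T.innovCov⁻¹ := rfl
    rw [h3, h4]
    simp only [transpose_sub, transpose_mul, transpose_transpose, transpose_nonsing_inv,
      innovCov_transpose h, h.symm, Matrix.mul_sub, Matrix.mul_one, Matrix.mul_assoc]
  rwa [h2] at h1

end Gain

/-- The noise entering the filter between the times `t` and `t + 1`. -/
noncomputable def stepNoise (t : ℕ)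
    (ω : ℕ → EuclideanSpace ℝ (Fin nx) × EuclideanSpace ℝ (Fin ny)) : Fin nx ⊕ Fin ny → ℝ :=
  Sum.elim (ω t).1.ofLp (ω (t + 1)).2.ofLp

/-- The estimate `x̂` and the estimation error `x - x̂` in closed loop. -/
noncomputable def errorState (T : LQGTask nx nu ny) (K : Matrix (Fin nu) (Fin nx) ℝ) (t : ℕ)
    (ω : ℕ → EuclideanSpace ℝ (Fin nx) × EuclideanSpace ℝ (Fin ny)) : Fin nx ⊕ Fin nx → ℝ :=
  Sum.elim (T.closedLoop K ω t).2 ((T.closedLoop K ω t).1 - (T.closedLoop K ω t).2)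

/-- The dynamics of `errorState`. -/
noncomputable def errorDyn (T : LQGTask nx nu ny) (K : Matrix (Fin nu) (Fin nx) ℝ) :
    Matrix (Fin nx ⊕ Fin nx) (Fin nx ⊕ Fin nx) ℝ :=
  fromBlocks (T.A + T.B * K) (T.kalmanGain * T.C * T.A) 0 ((1 - T.kalmanGain * T.C) * T.A)

/-- The noise input matrix of `errorState`. -/
noncomputable def errorNoise (T : LQGTask nx nu ny) :
    Matrix (Fin nx ⊕ Fin nx) (Fin nx ⊕ Fin ny) ℝ :=
  fromBlocks (T.kalmanGain * T.C) T.kalmanGain (1 - T.kalmanGain * T.C) (-T.kalmanGain)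

theorem errorState_succ (K : Matrix (Fin nu) (Fin nx) ℝ) (t : ℕ)
    (ω : ℕ → EuclideanSpace ℝ (Fin nx) × EuclideanSpace ℝ (Fin ny)) :
    errorState T K (t + 1) ω =
      errorDyn T K *ᵥ errorState T K t ω + errorNoise T *ᵥ stepNoise t ω := by
  simp only [errorState, errorDyn, errorNoise, stepNoise, fromBlocks_mulVec, LQGTask.closedLoop,
    LQGTask.filterStep, Sum.elim_comp_inl, Sum.elim_comp_inr]
  ext (i | i)
  · simp only [Sum.elim_inl, Pi.add_apply, mulVec_add, mulVec_sub, add_mulVec, sub_mulVec,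
      ← mulVec_mulVec, Pi.sub_apply]
    ring
  · simp only [Sum.elim_inr, Pi.add_apply, mulVec_add, mulVec_sub, add_mulVec, sub_mulVec,
      ← mulVec_mulVec, Pi.sub_apply, one_mulVec, zero_mulVec, neg_mulVec, Pi.neg_apply,
      Pi.zero_apply]
    ring

theorem l2Vec_stepNoise (t : ℕ) : L2Vec T.noiseLaw (stepNoise (nx := nx) (ny := ny) t) := by
  rintro (i | j)
  · exact memLp_noise T t (.inl i)
  · exact memLp_noise T (t + 1) (.inr j)

theorem integral_inl_mul_inr (s t : ℕ) (i : Fin nx) (j : Fin ny) :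
    ∫ ω, noiseCoord (ω s) (.inl i) * noiseCoord (ω t) (.inr j) ∂T.noiseLaw = 0 := by
  rcases eq_or_ne s t with rfl | h
  · simpa using integral_noise_mul_self T s (.inl i) (.inr j)
  · exact integral_noise_mul_of_ne T h _ _

theorem secMom_stepNoise_of_ne {s t : ℕ} (h : s ≠ t) :
    secMom T.noiseLaw (stepNoise s) (stepNoise t) = 0 := by
  ext (i | i) (j | j)
  · exact integral_noise_mul_of_ne T h (.inl i) (.inl j)
  · exact integral_inl_mul_inr s (t + 1) i j
  · refine Eq.trans ?_ (integral_inl_mul_inr (T := T) t (s + 1) j i)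
    simp [secMom, stepNoise, noiseCoord, mul_comm]
  · exact integral_noise_mul_of_ne T (by omega : s + 1 ≠ t + 1) (.inr i) (.inr j)

theorem secMom_stepNoise_self (t : ℕ) :
    secMom T.noiseLaw (stepNoise t) (stepNoise t) = fromBlocks T.W 0 0 T.V := by
  ext (i | i) (j | j)
  · exact integral_noise_mul_self T t (.inl i) (.inl j)
  · exact integral_inl_mul_inr t (t + 1) i j
  · refine Eq.trans ?_ (integral_inl_mul_inr (T := T) t (t + 1) j i)
    simp [secMom, stepNoise, noiseCoord, mul_comm]
  · exact integral_noise_mul_self T (t + 1) (.inr i) (.inr j)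

theorem errorState_recursion (K : Matrix (Fin nu) (Fin nx) ℝ) (t : ℕ) :
    L2Vec T.noiseLaw (errorState T K t) ∧
    (∀ s, t ≤ s → secMom T.noiseLaw (errorState T K t) (stepNoise s) = 0) ∧
    secMom T.noiseLaw (errorState T K (t + 1)) (errorState T K (t + 1)) =
      errorDyn T K * secMom T.noiseLaw (errorState T K t) (errorState T K t) * (errorDyn T K)ᵀ +
      errorNoise T * fromBlocks T.W 0 0 T.V * (errorNoise T)ᵀ := by
  have h := secMom_recursion (ξ := errorState T K) (ζ := stepNoise) (M := errorDyn T K)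
    (G := errorNoise T) (l2Vec_stepNoise (T := T)) (fun s t hst => secMom_stepNoise_of_ne hst)
    (by funext ω i; rcases i with i | i <;> simp [errorState, LQGTask.closedLoop])
    (fun t => funext fun ω => errorState_succ K t ω) t
  rwa [secMom_stepNoise_self] at h

/-- In stationarity the estimate and the estimation error are uncorrelated, with covariances
`Σ_K` and `(1 - L C) Σ̃`. -/
theorem stationary_eq (h : IsDareSolution T.Aᵀ T.Cᵀ T.W T.V T.predCov)
    {K : Matrix (Fin nu) (Fin nx) ℝ} (hK : IsSchur (T.A + T.B * K)) :
    fromBlocks (dlyap (T.A + T.B * K) T.noiseCov) 0 0 ((1 - T.kalmanGain * T.C) * T.predCov) =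
      errorDyn T K * fromBlocks (dlyap (T.A + T.B * K) T.noiseCov) 0 0
        ((1 - T.kalmanGain * T.C) * T.predCov) * (errorDyn T K)ᵀ +
      errorNoise T * fromBlocks T.W 0 0 T.V * (errorNoise T)ᵀ := by
  have hP := predCov_eq h
  have hL := innovCov_mul_kalmanGain_transpose h
  rw [LQGTask.innovCov, Matrix.add_mul] at hL
  set L := T.kalmanGain with hLdef
  set X := dlyap (T.A + T.B * K) T.noiseCov with hX
  have hX' : X = T.noiseCov + (T.A + T.B * K) * X * (T.A + T.B * K)ᵀ := dlyap_eq hK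
  have hVL : T.V * Lᵀ = T.C * T.predCov - T.C * T.predCov * T.Cᵀ * Lᵀ := eq_sub_of_add_eq' hL
  -- `A (1 - L C) Σ̃ Aᵀ + W = Σ̃`, applied between arbitrary factors
  have hmid : ∀ U Z : Matrix (Fin nx) (Fin nx) ℝ,
      U * T.A * ((1 - L * T.C) * T.predCov) * (T.Aᵀ * Z) + U * T.W * Z = U * T.predCov * Z := by
    intro U Z
    conv_rhs => rw [hP]
    simp only [Matrix.mul_add, Matrix.add_mul, Matrix.mul_assoc]
    rw [add_comm]
  have e11 : X = (T.A + T.B * K) * X * (T.A + T.B * K)ᵀ +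
      (L * T.C * T.A * ((1 - L * T.C) * T.predCov) * (T.Aᵀ * (L * T.C)ᵀ) +
        L * T.C * T.W * (L * T.C)ᵀ) + L * T.V * Lᵀ := by
    rw [hmid]
    conv_lhs => rw [hX']
    rw [LQGTask.noiseCov, ← hLdef, Matrix.mul_add, Matrix.add_mul, transpose_mul]
    simp only [Matrix.mul_assoc]
    abel
  have e12 : (0 : Matrix (Fin nx) (Fin nx) ℝ) =
      (L * T.C * T.A * ((1 - L * T.C) * T.predCov) * (T.Aᵀ * (1 - L * T.C)ᵀ) +
        L * T.C * T.W * (1 - L * T.C)ᵀ) + L * T.V * (-L)ᵀ := by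
    rw [hmid, transpose_neg, Matrix.mul_neg, Matrix.mul_assoc L T.V, hVL, transpose_sub,
      transpose_one, transpose_mul]
    simp only [Matrix.mul_sub, Matrix.mul_one, Matrix.mul_assoc]
    abel
  have e21 : (0 : Matrix (Fin nx) (Fin nx) ℝ) =
      ((1 - L * T.C) * T.A * ((1 - L * T.C) * T.predCov) * (T.Aᵀ * (L * T.C)ᵀ) +
        (1 - L * T.C) * T.W * (L * T.C)ᵀ) + -L * T.V * Lᵀ := by
    have hLV : L * T.V * Lᵀ = L * (T.C * T.predCov - T.C * T.predCov * T.Cᵀ * Lᵀ) := by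
      rw [Matrix.mul_assoc, hVL]
    have hLt : T.predCov * (T.Cᵀ * Lᵀ) = L * (T.C * T.predCov) := by
      have h1 := kalmanGain_mul_innovCov h
      rw [← Matrix.mul_assoc, ← h1, Matrix.mul_assoc, ← hL, ← Matrix.add_mul]
    rw [hmid, Matrix.neg_mul, Matrix.neg_mul, hLV, transpose_mul, Matrix.mul_assoc _ T.predCov, hLt]
    simp only [Matrix.mul_sub, Matrix.sub_mul, Matrix.one_mul, Matrix.mul_assoc]
    rw [hLt]
    abel
  have e22 : (1 - L * T.C) * T.predCov =
      ((1 - L * T.C) * T.A * ((1 - L * T.C) * T.predCov) * (T.Aᵀ * (1 - L * T.C)ᵀ) +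
        (1 - L * T.C) * T.W * (1 - L * T.C)ᵀ) + -L * T.V * (-L)ᵀ := by
    have h1 : ((1 - L * T.C) * T.A * ((1 - L * T.C) * T.predCov) * (T.Aᵀ * (1 - L * T.C)ᵀ) +
        (1 - L * T.C) * T.W * (1 - L * T.C)ᵀ) = (1 - L * T.C) * T.predCov -
        ((1 - L * T.C) * T.A * ((1 - L * T.C) * T.predCov) * (T.Aᵀ * (L * T.C)ᵀ) +
        (1 - L * T.C) * T.W * (L * T.C)ᵀ) := by
      rw [hmid, hmid, transpose_sub, transpose_one, Matrix.mul_sub, Matrix.mul_one]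
    have h2 := e21
    rw [h1, transpose_neg, Matrix.mul_neg, Matrix.neg_mul, Matrix.neg_mul, neg_neg]
    rw [Matrix.neg_mul, Matrix.neg_mul] at h2
    rw [eq_comm, sub_add, sub_eq_self, sub_eq_add_neg]
    exact h2.symm
  simp only [errorDyn, errorNoise, fromBlocks_transpose, fromBlocks_multiply, fromBlocks_add,
    Matrix.mul_zero, Matrix.zero_mul, add_zero, zero_add, transpose_zero, transpose_mul, ← hLdef]
  rw [fromBlocks_inj]
  simp only [transpose_mul] at e11 e12 e21 e22
  refine ⟨?_, ?_, ?_, ?_⟩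
  · rw [← add_assoc, add_assoc ((T.A + T.B * K) * X * (T.A + T.B * K)ᵀ)]
    exact e11
  · rw [← add_assoc]; exact e12
  · rw [← add_assoc]; exact e21
  · rw [← add_assoc]; exact e22

theorem tendsto_secMom_errorState (h : IsDareSolution T.Aᵀ T.Cᵀ T.W T.V T.predCov)
    {K : Matrix (Fin nu) (Fin nx) ℝ} (hK : IsSchur (T.A + T.B * K)) :
    Tendsto (fun t => secMom T.noiseLaw (errorState T K t) (errorState T K t)) atTop
      (𝓝 (fromBlocks (dlyap (T.A + T.B * K) T.noiseCov) 0 0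
        ((1 - T.kalmanGain * T.C) * T.predCov))) :=
  tendsto_of_lyapunov_recursion (hK.fromBlocks (isSchur_error h) _) (stationary_eq h hK)
    fun t => (errorState_recursion K t).2.2

/-- The matrix that adds the two components of a pair of vectors. -/
def sumMat (n : ℕ) : Matrix (Fin n) (Fin n ⊕ Fin n) ℝ := fromCols 1 1

/-- The matrix that selects the first component of a pair of vectors. -/
def fstMat (n : ℕ) : Matrix (Fin n) (Fin n ⊕ Fin n) ℝ := fromCols 1 0

theorem closedLoop_fst_eq (K : Matrix (Fin nu) (Fin nx) ℝ) (t : ℕ)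
    (ω : ℕ → EuclideanSpace ℝ (Fin nx) × EuclideanSpace ℝ (Fin ny)) :
    (T.closedLoop K ω t).1 = sumMat nx *ᵥ errorState T K t ω := by
  simp [errorState, sumMat, fromCols_mulVec]

theorem closedLoop_snd_eq (K : Matrix (Fin nu) (Fin nx) ℝ) (t : ℕ)
    (ω : ℕ → EuclideanSpace ℝ (Fin nx) × EuclideanSpace ℝ (Fin ny)) :
    (T.closedLoop K ω t).2 = fstMat nx *ᵥ errorState T K t ω := by
  simp [errorState, fstMat, fromCols_mulVec]

theorem l2Vec_outputNoise (t : ℕ) :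
    L2Vec T.noiseLaw (fun ω => (ω t).2.ofLp) := fun j => memLp_noise T t (.inr j)

/-- The state at time `t` is orthogonal to the output noise at the same time. -/
theorem secMom_closedLoop_outputNoise (K : Matrix (Fin nu) (Fin nx) ℝ) (t : ℕ) :
    secMom T.noiseLaw (fun ω => (T.closedLoop K ω t).1) (fun ω => (ω t).2.ofLp) = 0 := by
  cases t with
  | zero => ext i j; simp [secMom, LQGTask.closedLoop]
  | succ t =>
    obtain ⟨hξ, horth, -⟩ := errorState_recursion (T := T) K t
    have hn := l2Vec_stepNoise (T := T) t
    have h1 : (fun ω => (T.closedLoop K ω (t + 1)).1) = fun ω =>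
        fromCols (T.A + T.B * K) T.A *ᵥ errorState T K t ω +
          (fromCols 1 0 : Matrix (Fin nx) (Fin nx ⊕ Fin ny) ℝ) *ᵥ stepNoise t ω := by
      funext ω
      simp only [LQGTask.closedLoop, errorState, stepNoise, fromCols_mulVec, Sum.elim_comp_inl,
        Sum.elim_comp_inr, one_mulVec, zero_mulVec, add_zero, add_mulVec, mulVec_sub,
        ← mulVec_mulVec]
      abel
    have h2 : (fun ω : ℕ → EuclideanSpace ℝ (Fin nx) × EuclideanSpace ℝ (Fin ny) =>
        (ω (t + 1)).2.ofLp) = fun ω =>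
          (fromCols 0 1 : Matrix (Fin ny) (Fin nx ⊕ Fin ny) ℝ) *ᵥ stepNoise t ω := by
      funext ω
      simp [stepNoise, fromCols_mulVec]
    rw [h1, h2, secMom_mulVec_right hn ((hξ.mulVec _).add (hn.mulVec _)),
      secMom_add_left (hξ.mulVec _) (hn.mulVec _) hn, secMom_mulVec_left hξ hn,
      secMom_mulVec_left hn hn, horth t le_rfl, secMom_stepNoise_self]
    simp [fromCols_mul_fromBlocks, transpose_fromCols, fromCols_mul_fromRows]

theorem integral_stageCost (K : Matrix (Fin nu) (Fin nx) ℝ) (t : ℕ) :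
    Integrable (fun ω => T.stageCost K ω t) T.noiseLaw ∧
    ∫ ω, T.stageCost K ω t ∂T.noiseLaw =
      (T.Q * (T.C * (sumMat nx * secMom T.noiseLaw (errorState T K t) (errorState T K t) *
        (sumMat nx)ᵀ) * T.Cᵀ + T.V)).trace +
      (T.R * (K * (fstMat nx * secMom T.noiseLaw (errorState T K t) (errorState T K t) *
        (fstMat nx)ᵀ) * Kᵀ)).trace := by
  obtain ⟨hξ, -, -⟩ := errorState_recursion (T := T) K t
  have hv := l2Vec_outputNoise (T := T) t
  have hx : L2Vec T.noiseLaw (fun ω => (T.closedLoop K ω t).1) := by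
    simp only [closedLoop_fst_eq]; exact hξ.mulVec _
  have hxh : L2Vec T.noiseLaw (fun ω => (T.closedLoop K ω t).2) := by
    simp only [closedLoop_snd_eq]; exact hξ.mulVec _
  have hy : L2Vec T.noiseLaw (fun ω => T.C *ᵥ (T.closedLoop K ω t).1 + (ω t).2.ofLp) :=
    (hx.mulVec _).add hv
  have hu : L2Vec T.noiseLaw (fun ω => K *ᵥ (T.closedLoop K ω t).2) := hxh.mulVec _
  have hvv : secMom T.noiseLaw (fun ω => (ω t).2.ofLp) (fun ω => (ω t).2.ofLp) = T.V := by
    ext i j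
    exact integral_noise_mul_self T t (.inr i) (.inr j)
  have hxx : secMom T.noiseLaw (fun ω => (T.closedLoop K ω t).1)
      (fun ω => (T.closedLoop K ω t).1) = sumMat nx *
        secMom T.noiseLaw (errorState T K t) (errorState T K t) * (sumMat nx)ᵀ := by
    simp only [closedLoop_fst_eq]
    rw [secMom_mulVec_left hξ (hξ.mulVec _), secMom_mulVec_right hξ hξ, Matrix.mul_assoc]
  have hxxh : secMom T.noiseLaw (fun ω => (T.closedLoop K ω t).2)
      (fun ω => (T.closedLoop K ω t).2) = fstMat nx *
        secMom T.noiseLaw (errorState T K t) (errorState T K t) * (fstMat nx)ᵀ := by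
    simp only [closedLoop_snd_eq]
    rw [secMom_mulVec_left hξ (hξ.mulVec _), secMom_mulVec_right hξ hξ, Matrix.mul_assoc]
  have hyy := secMom_affine hx hv (secMom_closedLoop_outputNoise K t) T.C 1
  simp only [one_mulVec, Matrix.one_mul, transpose_one, Matrix.mul_one] at hyy
  have huu : secMom T.noiseLaw (fun ω => K *ᵥ (T.closedLoop K ω t).2)
      (fun ω => K *ᵥ (T.closedLoop K ω t).2) = K * secMom T.noiseLaw
        (fun ω => (T.closedLoop K ω t).2) (fun ω => (T.closedLoop K ω t).2) * Kᵀ := by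
    rw [secMom_mulVec_left hxh hu, secMom_mulVec_right hxh hxh, Matrix.mul_assoc]
  obtain ⟨hi1, he1⟩ := integral_quad hy T.Q
  obtain ⟨hi2, he2⟩ := integral_quad hu T.R
  refine ⟨hi1.add hi2, ?_⟩
  simp only [LQGTask.stageCost]
  rw [integral_add hi1 hi2, he1, he2, hyy, huu, hvv, hxx, hxxh]

/-- The LQG cost of a stabilizing gain is that of a state feedback problem driven by noise of
covariance `Σ_ν`, up to a constant that does not depend on the gain. -/
theorem exists_lqgCost_eq (hν : T.noiseCov.PosDef) (hn : 0 < nx) :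
    ∃ c : ℝ, ∀ K : Matrix (Fin nu) (Fin nx) ℝ, IsSchur (T.A + T.B * K) →
      T.lqgCost K = ((T.Qt + Kᵀ * T.R * K) * dlyap (T.A + T.B * K) T.noiseCov).trace + c := by
  have h := isDareSolution_predCov hν hn
  refine ⟨(T.Q * (T.C * ((1 - T.kalmanGain * T.C) * T.predCov) * T.Cᵀ + T.V)).trace,
    fun K hK => ?_⟩
  set g : Matrix (Fin nx ⊕ Fin nx) (Fin nx ⊕ Fin nx) ℝ → ℝ := fun M =>
      (T.Q * (T.C * (sumMat nx * M * (sumMat nx)ᵀ) * T.Cᵀ + T.V)).trace +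
      (T.R * (K * (fstMat nx * M * (fstMat nx)ᵀ) * Kᵀ)).trace with hg
  have hgc : Continuous g := by rw [hg]; fun_prop
  have hlim := (hgc.tendsto _).comp (tendsto_secMom_errorState h hK)
  have hces := hlim.cesaro
  have hcost : T.lqgCost K = g (fromBlocks (dlyap (T.A + T.B * K) T.noiseCov) 0 0
      ((1 - T.kalmanGain * T.C) * T.predCov)) := by
    refine Tendsto.limsup_eq (hces.congr fun k => ?_)
    rw [integral_finsetSum _ fun t _ => (integral_stageCost K t).1, one_div]
    congr 1
    exact Finset.sum_congr rfl fun t _ => (integral_stageCost K t).2.symm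
  rw [hcost, hg]
  simp only [sumMat, fstMat, transpose_fromCols, fromCols_mul_fromBlocks, fromCols_mul_fromRows,
    Matrix.mul_zero, Matrix.zero_mul, Matrix.one_mul, Matrix.mul_one, transpose_one, transpose_zero, add_zero,
    zero_add, Matrix.mul_add, Matrix.add_mul, trace_add, LQGTask.Qt]
  rw [← Matrix.mul_assoc T.R, trace_mul_comm _ Kᵀ, ← Matrix.mul_assoc Kᵀ,
    ← Matrix.mul_assoc T.Q (T.C * dlyap _ _), trace_mul_comm _ T.Cᵀ]
  simp only [Matrix.mul_assoc]
  ring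

end Kalman

/-! ### State feedback costs -/

section Feedback

variable {nx nu ny : ℕ} (T : LQGTask nx nu ny) (K K' : Matrix (Fin nu) (Fin nx) ℝ)

/-- The stationary covariance of the state estimate under the gain `K`. -/
noncomputable def LQGTask.covOf : Matrix (Fin nx) (Fin nx) ℝ := dlyap (T.A + T.B * K) T.noiseCov

/-- The value matrix of the gain `K`. -/
noncomputable def LQGTask.valueOf : Matrix (Fin nx) (Fin nx) ℝ :=
  dlyap (T.A + T.B * K)ᵀ (T.Qt + Kᵀ * T.R * K)

/-- The curvature `R + Bᵀ P_K B` of the cost at the gain `K`. -/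
noncomputable def LQGTask.curvOf : Matrix (Fin nu) (Fin nu) ℝ :=
  T.R + T.Bᵀ * T.valueOf K * T.B

/-- The matrix `E_K = 2 ((R + Bᵀ P_K B) K + Bᵀ P_K A)`. -/
noncomputable def LQGTask.gradOf : Matrix (Fin nu) (Fin nx) ℝ :=
  (2 : ℝ) • (T.curvOf K * K + T.Bᵀ * T.valueOf K * T.A)

/-- The cost of the gain `K`, up to the constant contributed by the estimation error. -/
noncomputable def LQGTask.costOf : ℝ := ((T.Qt + Kᵀ * T.R * K) * T.covOf K).trace

variable {T K K'}

theorem Qt_posSemidef : T.Qt.PosSemidef := by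
  simpa [LQGTask.Qt] using T.hQ.conjTranspose_mul_mul_same T.C

theorem stageMat_posSemidef : (T.Qt + Kᵀ * T.R * K).PosSemidef :=
  Qt_posSemidef.add (by simpa using T.hR.posSemidef.conjTranspose_mul_mul_same K)

theorem valueOf_posSemidef (hK : IsSchur (T.A + T.B * K)) : (T.valueOf K).PosSemidef :=
  dlyap_posSemidef hK.transpose stageMat_posSemidef

theorem valueOf_eq (hK : IsSchur (T.A + T.B * K)) :
    T.valueOf K = T.Qt + Kᵀ * T.R * K + (T.A + T.B * K)ᵀ * T.valueOf K * (T.A + T.B * K) := by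
  have := dlyap_eq (Q := T.Qt + Kᵀ * T.R * K) hK.transpose
  rwa [transpose_transpose] at this

theorem covOf_posSemidef (hν : T.noiseCov.PosDef) (hK : IsSchur (T.A + T.B * K)) :
    (T.covOf K).PosSemidef := dlyap_posSemidef hK hν.posSemidef

theorem curvOf_sub_posSemidef {r : ℝ}
    (hr : ∀ x : Fin nu → ℝ, r * (x ⬝ᵥ x) ≤ x ⬝ᵥ (T.R *ᵥ x)) (hK : IsSchur (T.A + T.B * K)) :
    (T.curvOf K - r • 1).PosSemidef := by
  have h1 : (T.Bᵀ * T.valueOf K * T.B).PosSemidef := by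
    simpa using (valueOf_posSemidef hK).conjTranspose_mul_mul_same T.B
  refine posSemidef_of_quad ?_ fun x => ?_
  · simp [LQGTask.curvOf, transpose_sub, transpose_add, PosSemidef.transpose_eq T.hR.posSemidef,
      PosSemidef.transpose_eq (valueOf_posSemidef hK), Matrix.mul_assoc]
  · rw [LQGTask.curvOf, sub_mulVec, add_mulVec, dotProduct_sub, dotProduct_add, smul_mulVec,
      one_mulVec, dotProduct_smul, smul_eq_mul]
    linarith [hr x, PosSemidef.quad_nonneg h1 x]

/-- The exact expansion of the cost around the gain `K`, weighted by the covariance of `K'`. -/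
theorem costOf_sub (hν : T.noiseCov.PosDef) (hK : IsSchur (T.A + T.B * K))
    (hK' : IsSchur (T.A + T.B * K')) :
    T.costOf K' - T.costOf K = ((K' - K)ᵀ * T.gradOf K * T.covOf K').trace +
      ((K' - K)ᵀ * T.curvOf K * (K' - K) * T.covOf K').trace := by
  obtain ⟨D, rfl⟩ : ∃ D, K' = K + D := ⟨K' - K, by abel⟩
  rw [add_sub_cancel_left]
  set P := T.valueOf K with hPdef
  have hPs : Pᵀ = P := PosSemidef.transpose_eq (valueOf_posSemidef hK)
  have hRs : T.Rᵀ = T.R := PosSemidef.transpose_eq T.hR.posSemidef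
  have hcs : (T.covOf (K + D))ᵀ = T.covOf (K + D) :=
    PosSemidef.transpose_eq (covOf_posSemidef hν hK')
  have hP : P = T.Qt + Kᵀ * T.R * K + (T.A + T.B * K)ᵀ * P * (T.A + T.B * K) := valueOf_eq hK
  set E := T.curvOf K * K + T.Bᵀ * P * T.A with hE
  have hcost : T.costOf K = ((P - (T.A + T.B * (K + D))ᵀ * P * (T.A + T.B * (K + D))) *
      T.covOf (K + D)).trace := by
    have h1 := trace_mul_dlyap (Q := T.noiseCov) hK P
    have h2 := trace_mul_dlyap (Q := T.noiseCov) hK' P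
    rw [LQGTask.costOf, LQGTask.covOf, LQGTask.covOf, ← h2, h1, ← eq_sub_of_add_eq hP.symm]
  have hmat : T.Qt + (K + D)ᵀ * T.R * (K + D) -
      (P - (T.A + T.B * (K + D))ᵀ * P * (T.A + T.B * (K + D))) =
      Dᵀ * E + Eᵀ * D + Dᵀ * T.curvOf K * D := by
    rw [sub_sub_eq_add_sub, sub_eq_iff_eq_add]
    conv_rhs => rw [hP]
    simp only [hE, LQGTask.curvOf, ← hPdef, transpose_add, transpose_mul, transpose_transpose, hPs,
      hRs, Matrix.mul_add, Matrix.add_mul, Matrix.mul_assoc]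
    abel
  have htr : (Eᵀ * D * T.covOf (K + D)).trace = (Dᵀ * E * T.covOf (K + D)).trace := by
    rw [← trace_transpose, transpose_mul, transpose_mul, transpose_transpose, hcs, trace_mul_comm]
  rw [hcost]
  conv_lhs => rw [LQGTask.costOf]
  rw [← trace_sub, ← Matrix.sub_mul, hmat, Matrix.add_mul, Matrix.add_mul, trace_add, trace_add,
    htr, LQGTask.gradOf, ← hPdef, ← hE, Matrix.mul_smul, Matrix.smul_mul, trace_smul, smul_eq_mul]
  ring

/-- Gradient dominance with respect to any stabilizing gain `K'`: completing the square in
`costOf_sub`. -/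
theorem costOf_sub_le (hν : T.noiseCov.PosDef) {r : ℝ} (hr0 : 0 < r)
    (hr : ∀ x : Fin nu → ℝ, r * (x ⬝ᵥ x) ≤ x ⬝ᵥ (T.R *ᵥ x)) (hK : IsSchur (T.A + T.B * K))
    (hK' : IsSchur (T.A + T.B * K')) :
    T.costOf K - T.costOf K' ≤ specNorm (T.covOf K') / (4 * r) * frobNorm (T.gradOf K) ^ 2 := by
  have h := costOf_sub hν hK hK'
  set D := K' - K
  set E := T.gradOf K
  set X := T.covOf K'
  have hX := covOf_posSemidef hν hK'
  have hN : ((1 / (4 * r)) • (Eᵀ * E) + (1 / 2 : ℝ) • (Dᵀ * E + Eᵀ * D) +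
      r • (Dᵀ * D)).PosSemidef := by
    refine posSemidef_of_quad ?_ fun x => ?_
    · simp [transpose_add, transpose_mul, add_comm]
    · have e1 : ∀ U Z : Matrix (Fin nu) (Fin nx) ℝ,
          x ⬝ᵥ ((Uᵀ * Z) *ᵥ x) = (U *ᵥ x) ⬝ᵥ (Z *ᵥ x) := fun U Z => by
        rw [← mulVec_mulVec, dotProduct_mulVec_transpose, transpose_transpose]
      simp only [add_mulVec, smul_mulVec, dotProduct_add, dotProduct_smul, smul_eq_mul, e1]
      rw [dotProduct_comm (E *ᵥ x) (D *ᵥ x)]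
      have h2 := dotProduct_self_nonneg' (E *ᵥ x + (2 * r) • (D *ᵥ x))
      simp only [dotProduct_add, add_dotProduct, dotProduct_smul, smul_dotProduct,
        smul_eq_mul] at h2
      rw [dotProduct_comm (E *ᵥ x) (D *ᵥ x)] at h2
      have h3 : 1 / (4 * r) * ((E *ᵥ x) ⬝ᵥ (E *ᵥ x)) +
          1 / 2 * ((D *ᵥ x) ⬝ᵥ (E *ᵥ x) + (D *ᵥ x) ⬝ᵥ (E *ᵥ x)) + r * ((D *ᵥ x) ⬝ᵥ (D *ᵥ x)) =
          (1 / (4 * r)) * ((E *ᵥ x) ⬝ᵥ (E *ᵥ x) + 2 * r * ((D *ᵥ x) ⬝ᵥ (E *ᵥ x)) +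
            2 * r * ((D *ᵥ x) ⬝ᵥ (E *ᵥ x) + 2 * r * ((D *ᵥ x) ⬝ᵥ (D *ᵥ x)))) := by
        field_simp; ring
      rw [h3]
      exact mul_nonneg (by positivity) h2
  have h1 := trace_mul_nonneg hN hX
  have hM : 0 ≤ (Dᵀ * (T.curvOf K - r • 1) * D * X).trace := by
    refine trace_mul_nonneg ?_ hX
    simpa using (curvOf_sub_posSemidef hr hK).conjTranspose_mul_mul_same D
  have htr : (Eᵀ * D * X).trace = (Dᵀ * E * X).trace := by
    rw [← trace_transpose, transpose_mul, transpose_mul, transpose_transpose,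
      PosSemidef.transpose_eq hX, trace_mul_comm]
  have hE : (Eᵀ * E * X).trace ≤ specNorm X * frobNorm E ^ 2 := by
    rw [Matrix.mul_assoc, trace_mul_comm, trace_congr_eq_sum, frobNorm_sq, Finset.mul_sum]
    exact Finset.sum_le_sum fun i _ => quad_le_specNorm _ _
  simp only [Matrix.add_mul, Matrix.smul_mul, Matrix.mul_sub, Matrix.sub_mul, Matrix.mul_smul,
    Matrix.mul_one, trace_add, trace_sub, trace_smul, smul_eq_mul] at h1 hM
  have h4 : 1 / (4 * r) * (Eᵀ * E * X).trace ≤ specNorm X / (4 * r) * frobNorm E ^ 2 := by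
    rw [div_mul_eq_mul_div, one_mul, div_mul_eq_mul_div]
    gcongr
  linarith

/-- Along a line of gains the cost is differentiable at a stabilizing gain. -/
theorem hasDerivAt_costOf (hν : T.noiseCov.PosDef) (hK : IsSchur (T.A + T.B * K))
    (D : Matrix (Fin nu) (Fin nx) ℝ) :
    HasDerivAt (fun s : ℝ => T.costOf (K + s • D)) (Dᵀ * T.gradOf K * T.covOf K).trace 0 := by
  have hcont : Continuous fun s : ℝ => T.A + T.B * (K + s • D) := by fun_prop
  have h0 : T.A + T.B * (K + (0 : ℝ) • D) = T.A + T.B * K := by simp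
  have hsch : ∀ᶠ s : ℝ in 𝓝 0, IsSchur (T.A + T.B * (K + s • D)) :=
    hcont.continuousAt.eventually (isOpen_setOf_isSchur.mem_nhds (by simpa [h0] using hK))
  have hcov : Tendsto (fun s : ℝ => T.covOf (K + s • D)) (𝓝 0) (𝓝 (T.covOf K)) := by
    have h1 : ContinuousAt (fun s : ℝ => dlyap (T.A + T.B * (K + s • D)) T.noiseCov) 0 :=
      ContinuousAt.comp (g := fun Z => dlyap Z T.noiseCov)
        (by rw [h0]; exact continuousAt_dlyap hK) hcont.continuousAt
    have h2 := h1.tendsto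
    rwa [h0] at h2
  have hg : Tendsto (fun s : ℝ => (Dᵀ * T.gradOf K * T.covOf (K + s • D)).trace +
      s * (Dᵀ * T.curvOf K * D * T.covOf (K + s • D)).trace) (𝓝 0)
      (𝓝 (Dᵀ * T.gradOf K * T.covOf K).trace) := by
    have hc : ∀ N : Matrix (Fin nx) (Fin nx) ℝ,
        Tendsto (fun s : ℝ => (N * T.covOf (K + s • D)).trace) (𝓝 0)
          (𝓝 (N * T.covOf K).trace) := fun N => by
      have : Continuous fun Z : Matrix (Fin nx) (Fin nx) ℝ => (N * Z).trace := by fun_prop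
      exact (this.tendsto _).comp hcov
    have := (hc (Dᵀ * T.gradOf K)).add
      ((tendsto_id (α := ℝ) (x := 𝓝 0)).mul (hc (Dᵀ * T.curvOf K * D)))
    simpa using this
  rw [hasDerivAt_iff_tendsto_slope]
  refine (hg.mono_left nhdsWithin_le_nhds).congr' ?_
  filter_upwards [self_mem_nhdsWithin, nhdsWithin_le_nhds hsch] with s hs hsK
  have hs : s ≠ 0 := hs
  have h1 := costOf_sub hν hK hsK
  rw [add_sub_cancel_left] at h1
  rw [slope_def_field, zero_smul, add_zero, h1, sub_zero]
  simp only [transpose_smul, Matrix.smul_mul, Matrix.mul_smul, trace_smul, smul_eq_mul]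
  field_simp

theorem continuousAt_costOf (hK : IsSchur (T.A + T.B * K)) : ContinuousAt T.costOf K := by
  have hcont : Continuous fun Z : Matrix (Fin nu) (Fin nx) ℝ => T.A + T.B * Z := by fun_prop
  have h1 : ContinuousAt (fun Z => T.covOf Z) K :=
    ContinuousAt.comp (g := fun Z => dlyap Z T.noiseCov) (continuousAt_dlyap hK) hcont.continuousAt
  have h2 : ContinuousAt (fun Z : Matrix (Fin nu) (Fin nx) ℝ => T.Qt + Zᵀ * T.R * Z) K :=
    Continuous.continuousAt (by fun_prop)
  exact (continuous_id.matrix_trace (R := ℝ) (n := Fin nx)).continuousAt.comp (h2.mul h1)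

theorem quad_le_trace {X : Matrix (Fin nx) (Fin nx) ℝ} (hX : X.PosSemidef) (x : Fin nx → ℝ) :
    x ⬝ᵥ (X *ᵥ x) ≤ X.trace * (x ⬝ᵥ x) := by
  have h1 : ((x ⬝ᵥ x) • (1 : Matrix (Fin nx) (Fin nx) ℝ) - vecMulVec x x).PosSemidef := by
    refine posSemidef_of_quad ?_ fun y => ?_
    · simp [transpose_sub, transpose_vecMulVec]
    · rw [sub_mulVec, dotProduct_sub, smul_mulVec, one_mulVec, dotProduct_smul, vecMulVec_mulVec,
        smul_eq_mul]
      have := dotProduct_sq_le x y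
      rw [op_smul_eq_smul, dotProduct_smul, smul_eq_mul, dotProduct_comm y x]
      linarith [sq (x ⬝ᵥ y)]
  have h2 := trace_mul_nonneg h1 hX
  rw [Matrix.sub_mul, trace_sub, Matrix.smul_mul, Matrix.one_mul, trace_smul, smul_eq_mul,
    vecMulVec_mul, trace_vecMulVec, dotProduct_comm x (x ᵥ* X), ← dotProduct_mulVec] at h2
  linarith

/-- Coercivity of the cost when a stabilizing gain `K'` with vanishing gradient exists: a bound on
the cost bounds the second moment of the deviation `(K - K') x` from the gain `K'`, hence, since `K'` is
stabilizing, the covariance itself. -/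
theorem exists_covOf_le (hν : T.noiseCov.PosDef) (hK' : IsSchur (T.A + T.B * K'))
    (hE : T.gradOf K' = 0) (ℓ : ℝ) :
    ∃ c > 0, ∀ K, IsSchur (T.A + T.B * K) → T.costOf K - T.costOf K' ≤ ℓ →
      ∀ x : Fin nx → ℝ, x ⬝ᵥ (T.covOf K *ᵥ x) ≤ c * (x ⬝ᵥ x) := by
  obtain ⟨r, hr0, hr⟩ := PosDef.exists_coercive T.hR
  -- `Y` is a Lyapunov function for `K'`; `ε` is so small that Young's inequality costs at most
  -- half of the decay of `Y`
  set Y := dlyap (T.A + T.B * K')ᵀ 1 with hY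
  have hYeq : Y = 1 + (T.A + T.B * K')ᵀ * Y * (T.A + T.B * K') := by
    have := dlyap_eq (Q := 1) hK'.transpose
    rwa [transpose_transpose] at this
  have hYps : Y.PosSemidef := dlyap_posSemidef hK'.transpose PosSemidef.one
  set y := specNorm Y + 1 with hy
  have hy0 : 0 < y := by have := specNorm_nonneg Y; linarith
  set ε := 1 / (2 * y) with hε
  have hε0 : 0 < ε := by positivity
  have hεy : ε * y = 1 / 2 := by rw [hε]; field_simp
  set b := specNorm (T.Bᵀ * Y * T.B)
  have hb : 0 ≤ b := specNorm_nonneg _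
  set c₁ := (1 + ε⁻¹) * b
  have hc₁ : 0 ≤ c₁ := by positivity
  refine ⟨|2 * ((Y * T.noiseCov).trace + c₁ * (ℓ / r))| + 1, by positivity, fun K hK hℓ x => ?_⟩
  set D := K - K' with hD
  set X := T.covOf K
  have hX : X.PosSemidef := covOf_posSemidef hν hK
  have hA : T.A + T.B * K = (T.A + T.B * K') + T.B * D := by
    rw [hD, Matrix.mul_sub]; abel
  have hdev : r * (Dᵀ * D * X).trace ≤ ℓ := by
    have h1 := costOf_sub hν hK' hK
    rw [hE, ← hD] at h1
    have hM : 0 ≤ (Dᵀ * (T.curvOf K' - r • 1) * D * X).trace := by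
      refine trace_mul_nonneg ?_ hX
      simpa using (curvOf_sub_posSemidef hr hK').conjTranspose_mul_mul_same D
    simp only [Matrix.mul_sub, Matrix.sub_mul, Matrix.mul_smul, Matrix.smul_mul, Matrix.mul_one,
      trace_sub, trace_smul, smul_eq_mul] at hM
    simp only [Matrix.mul_zero, Matrix.zero_mul, trace_zero, zero_add] at h1
    linarith
  have hN : (Y - (T.A + T.B * K)ᵀ * Y * (T.A + T.B * K) - (1 / 2 : ℝ) • 1 +
      c₁ • (Dᵀ * D)).PosSemidef := by
    refine posSemidef_of_quad ?_ fun z => ?_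
    · simp [transpose_sub, transpose_add, transpose_mul, PosSemidef.transpose_eq hYps,
        Matrix.mul_assoc]
    · simp only [add_mulVec, sub_mulVec, smul_mulVec, one_mulVec, dotProduct_add, dotProduct_sub,
        dotProduct_smul, smul_eq_mul]
      rw [quad_congr', hA, add_mulVec]
      have e1 : z ⬝ᵥ ((Dᵀ * D) *ᵥ z) = (D *ᵥ z) ⬝ᵥ (D *ᵥ z) := by
        rw [← mulVec_mulVec, dotProduct_mulVec_transpose, transpose_transpose]
      rw [e1]
      set p := (T.A + T.B * K') *ᵥ z
      set q := (T.B * D) *ᵥ z with hq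
      have hqY : q ⬝ᵥ (Y *ᵥ q) ≤ b * ((D *ᵥ z) ⬝ᵥ (D *ᵥ z)) := by
        rw [hq, ← mulVec_mulVec, ← quad_congr']
        exact quad_le_specNorm _ _
      have hpY : z ⬝ᵥ (Y *ᵥ z) = z ⬝ᵥ z + p ⬝ᵥ (Y *ᵥ p) := by
        conv_lhs => rw [hYeq]
        rw [add_mulVec, dotProduct_add, one_mulVec, quad_congr']
      have hyoung := quad_add_le hYps hε0 p q
      have hzY : ε * (z ⬝ᵥ (Y *ᵥ z)) ≤ 1 / 2 * (z ⬝ᵥ z) := by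
        rw [← hεy, mul_assoc]
        refine mul_le_mul_of_nonneg_left ?_ hε0.le
        have := quad_le_specNorm Y z
        nlinarith [dotProduct_self_nonneg' z]
      have hc : c₁ * ((D *ᵥ z) ⬝ᵥ (D *ᵥ z)) = (1 + ε⁻¹) * (b * ((D *ᵥ z) ⬝ᵥ (D *ᵥ z))) := by
        ring
      have hc' : (1 + ε⁻¹) * (q ⬝ᵥ (Y *ᵥ q)) ≤ (1 + ε⁻¹) * (b * ((D *ᵥ z) ⬝ᵥ (D *ᵥ z))) :=
        mul_le_mul_of_nonneg_left hqY (by positivity)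
      have hz0 := dotProduct_self_nonneg' z
      have hεz : 0 ≤ ε * (z ⬝ᵥ z) := mul_nonneg hε0.le hz0
      nlinarith
  have h1 := trace_mul_nonneg hN hX
  simp only [Matrix.add_mul, Matrix.sub_mul, Matrix.smul_mul, Matrix.one_mul, trace_add, trace_sub,
    trace_smul, smul_eq_mul] at h1
  have h2 : (Y * T.noiseCov).trace =
      (Y * X).trace - ((T.A + T.B * K)ᵀ * Y * (T.A + T.B * K) * X).trace := by
    rw [trace_mul_dlyap hK Y, Matrix.sub_mul, trace_sub]
    rfl
  have h3 : (Dᵀ * D * X).trace ≤ ℓ / r := by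
    rw [le_div_iff₀ hr0]; linarith
  have h4 : X.trace ≤ 2 * ((Y * T.noiseCov).trace + c₁ * (ℓ / r)) := by
    have := mul_le_mul_of_nonneg_left h3 hc₁
    linarith
  refine (quad_le_trace hX x).trans (mul_le_mul_of_nonneg_right ?_ (dotProduct_self_nonneg' x))
  linarith [le_abs_self (2 * ((Y * T.noiseCov).trace + c₁ * (ℓ / r)))]

/-- Sublevel sets of the cost within the stabilizing gains have no limit points outside. -/
theorem isClosed_sublevel_costOf (hν : T.noiseCov.PosDef) (hK' : IsSchur (T.A + T.B * K'))
    (hE : T.gradOf K' = 0) (ℓ : ℝ) :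
    IsClosed {K | IsSchur (T.A + T.B * K) ∧ T.costOf K - T.costOf K' ≤ ℓ} := by
  obtain ⟨c, hc, hcov⟩ := exists_covOf_le hν hK' hE ℓ
  obtain ⟨σ, hσ, hνσ⟩ := PosDef.exists_coercive hν
  set c' := c + σ with hc'def
  have hc' : 0 < c' := by positivity
  refine isClosed_of_closure_subset fun K hKcl => ?_
  have hr0 : 0 ≤ 1 - σ / c' := by rw [sub_nonneg, div_le_one hc']; linarith
  have hr1 : 1 - σ / c' < 1 := by
    have : 0 < σ / c' := by positivity
    linarith
  -- on the sublevel set the powers of the closed loop matrix decay uniformly, and for each power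
  -- the bound passes to the limit
  have hbound : ∀ (k : ℕ) (x : Fin nx → ℝ), (((T.A + T.B * K) ^ k)ᵀ *ᵥ x) ⬝ᵥ
      (((T.A + T.B * K) ^ k)ᵀ *ᵥ x) ≤ (c' / σ) * (1 - σ / c') ^ k * (x ⬝ᵥ x) := by
    intro k x
    have hcl : IsClosed {Z : Matrix (Fin nu) (Fin nx) ℝ | (((T.A + T.B * Z) ^ k)ᵀ *ᵥ x) ⬝ᵥ
        (((T.A + T.B * Z) ^ k)ᵀ *ᵥ x) ≤ (c' / σ) * (1 - σ / c') ^ k * (x ⬝ᵥ x)} :=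
      isClosed_le (by fun_prop) continuous_const
    refine closure_minimal (fun Z hZ => ?_) hcl hKcl
    refine geometric_bound_of_lyapunov hσ hc' (by linarith) hνσ
      (PosSemidef.quad_nonneg (covOf_posSemidef hν hZ.1)) (fun x => ?_) (dlyap_eq hZ.1) k x
    refine (hcov Z hZ.1 hZ.2 x).trans ?_
    have := dotProduct_self_nonneg' x
    rw [hc'def, add_mul]
    have := mul_nonneg hσ.le this
    linarith
  have hK : IsSchur (T.A + T.B * K) := isSchur_of_geometric_bound hr0 hr1 hbound
  refine ⟨hK, ?_⟩
  have : (𝓝[{K | IsSchur (T.A + T.B * K) ∧ T.costOf K - T.costOf K' ≤ ℓ}] K).NeBot :=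
    mem_closure_iff_nhdsWithin_neBot.1 hKcl
  have hlim : Tendsto (fun Z => T.costOf Z - T.costOf K')
      (𝓝[{K | IsSchur (T.A + T.B * K) ∧ T.costOf K - T.costOf K' ≤ ℓ}] K)
      (𝓝 (T.costOf K - T.costOf K')) :=
    ((continuousAt_costOf hK).tendsto.sub_const _).mono_left nhdsWithin_le_nhds
  exact le_of_tendsto hlim (by filter_upwards [self_mem_nhdsWithin] with Z hZ using hZ.2)

end Feedback

/-! ### History representations and the Moore–Penrose inverse -/

section History

variable {nx nu ny p : ℕ} {T : LQGTask nx nu ny} {S : Matrix (Fin nx) (Hist p nu ny) ℝ}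

theorem optFilter_congr {y y' : ℕ → Fin ny → ℝ} {t : ℕ} (h : ∀ s ≤ t, y s = y' s) :
    T.optFilter y t = T.optFilter y' t := by
  induction t with
  | zero => rfl
  | succ t ih =>
    rw [LQGTask.optFilter, LQGTask.optFilter, ih fun s hs => h s (by omega), h (t + 1) le_rfl]

/-- Since `Σ_ν` is positive definite the Kalman gain has full row rank, so that one output value
steers the estimate anywhere; hence a history map is onto. -/
theorem IsHistoryMap.exists_right_inverse (hν : T.noiseCov.PosDef) (hS : T.IsHistoryMap S) :
    ∃ X : Matrix (Hist p nu ny) (Fin nx) ℝ, S * X = 1 := by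
  have hLinv : ∃ G : Matrix (Fin ny) (Fin nx) ℝ, T.kalmanGain * G = 1 := by
    refine ⟨(T.C * T.predCov * T.Cᵀ + T.V) * T.kalmanGainᵀ * T.noiseCov⁻¹, ?_⟩
    have hu : IsUnit T.noiseCov.det := (isUnit_iff_isUnit_det _).1 hν.isUnit
    rw [← Matrix.mul_assoc, ← Matrix.mul_assoc]
    exact mul_nonsing_inv _ hu
  obtain ⟨G, hG⟩ := hLinv
  rw [← mulVec_surjective_iff_exists_right_inverse]
  intro x
  set z := T.optFilter (fun _ => 0) p
  set a := T.A *ᵥ z + T.B *ᵥ (T.optGain *ᵥ z) with ha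
  set y : ℕ → Fin ny → ℝ := Function.update (fun _ => 0) (p + 1) (T.C *ᵥ a + G *ᵥ (x - a)) with hy
  have hz : T.optFilter y p = z := optFilter_congr fun s hs => by
    rw [hy, Function.update_of_ne (by omega)]
  have hx : T.optFilter y (p + 1) = x := by
    rw [LQGTask.optFilter, hz, LQGTask.filterStep, ← ha, hy, Function.update_self,
      add_sub_cancel_left, mulVec_mulVec, hG, one_mulVec]
    abel
  exact ⟨_, (hS y (p + 1) (by omega)).symm.trans hx⟩

/-- For a matrix with a right inverse `Mᵀ (M Mᵀ)⁻¹` satisfies the Moore–Penrose conditions, so the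
pseudoinverse exists, and any solution of those conditions is a right inverse. -/
theorem mul_pinv_eq_one {m n : Type*} [Fintype m] [Fintype n] [DecidableEq m] {M : Matrix m n ℝ}
    {X : Matrix n m ℝ} (h : M * X = 1) : M * pinv M = 1 := by
  have hdet : IsUnit (M * Mᵀ).det := by
    rw [isUnit_iff_ne_zero]
    intro h0
    obtain ⟨v, hv0, hv⟩ := exists_mulVec_eq_zero_iff.2 h0
    have h1 : Mᵀ *ᵥ v = 0 := by
      rw [← dotProduct_self_eq_zero]
      rw [← mulVec_mulVec] at hv
      have := congrArg (fun w => v ⬝ᵥ w) hv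
      simpa [dotProduct_mulVec_transpose] using this
    apply hv0
    have h2 := congrArg (fun w => Xᵀ *ᵥ w) h1
    simpa [mulVec_mulVec, ← transpose_mul, h] using h2
  have hex : ∃ X, IsMoorePenrose M X := by
    have h1 : M * (Mᵀ * (M * Mᵀ)⁻¹) = 1 := by
      rw [← Matrix.mul_assoc, mul_nonsing_inv _ hdet]
    refine ⟨Mᵀ * (M * Mᵀ)⁻¹, ?_, ?_, ?_, ?_⟩
    · rw [h1, Matrix.one_mul]
    · rw [Matrix.mul_assoc, h1, Matrix.mul_one]
    · rw [h1, transpose_one]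
    · simp [transpose_mul, transpose_nonsing_inv, Matrix.mul_assoc]
  have hp : IsMoorePenrose M (pinv M) := by
    rw [pinv, dif_pos hex]
    exact hex.choose_spec
  calc M * pinv M = M * pinv M * (M * X) := by rw [h, Matrix.mul_one]
    _ = M * X := by rw [← Matrix.mul_assoc, hp.mul_mul_left]
    _ = 1 := h

end History

/-! ### Lifted controllers -/

section Lifted

variable {nx nu ny p : ℕ} {T : LQGTask nx nu ny} {S : Matrix (Fin nx) (Hist p nu ny) ℝ}
  {K K' Kopt D : Ctrl p nu ny}

theorem Acl_eq : T.Acl S K = T.A + T.B * (K * pinv S) := by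
  rw [LQGTask.Acl, Matrix.mul_assoc]

theorem mem_stabilizing_iff : K ∈ T.stabilizing S ↔ IsSchur (T.A + T.B * (K * pinv S)) := by
  rw [← Acl_eq]; rfl

theorem stateCov_eq : T.stateCov S K = T.covOf (K * pinv S) := by
  rw [LQGTask.stateCov, Acl_eq, LQGTask.covOf]

theorem gradE_eq : T.gradE S K = T.gradOf (K * pinv S) := by
  have h : T.valueMat S K = T.valueOf (K * pinv S) := by
    rw [LQGTask.valueMat, Acl_eq, LQGTask.valueOf, transpose_mul]
    simp only [Matrix.mul_assoc]
  rw [LQGTask.gradE, h, LQGTask.gradOf, LQGTask.curvOf, Matrix.mul_assoc _ K]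

theorem gradJ_eq : T.gradJ S K = T.gradOf (K * pinv S) * T.covOf (K * pinv S) * (pinv S)ᵀ := by
  rw [LQGTask.gradJ, gradE_eq, stateCov_eq]

theorem frobInner_gradJ (D : Ctrl p nu ny) : frobInner (T.gradJ S K) D =
    ((D * pinv S)ᵀ * T.gradOf (K * pinv S) * T.covOf (K * pinv S)).trace := by
  rw [frobInner_eq_trace, gradJ_eq, trace_mul_comm, transpose_mul, Matrix.mul_assoc (pinv S)ᵀ,
    Matrix.mul_assoc (pinv S)ᵀ, trace_mul_comm (pinv S)ᵀ]
  simp only [Matrix.mul_assoc]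

theorem isOpen_stabilizing : IsOpen (T.stabilizing S : Set (Ctrl p nu ny)) := by
  have : Continuous fun K : Ctrl p nu ny => T.Acl S K := by unfold LQGTask.Acl; fun_prop
  exact isOpen_setOf_isSchur.preimage this

variable (hν : T.noiseCov.PosDef) (hn : 0 < nx)
include hν hn

theorem J_sub (hK : K ∈ T.stabilizing S) (hK' : K' ∈ T.stabilizing S) :
    T.J S K - T.J S K' = T.costOf (K * pinv S) - T.costOf (K' * pinv S) := by
  obtain ⟨c, hc⟩ := exists_lqgCost_eq hν hn
  rw [LQGTask.J, LQGTask.J, hc _ (mem_stabilizing_iff.1 hK), hc _ (mem_stabilizing_iff.1 hK')]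
  simp only [LQGTask.costOf, LQGTask.covOf]
  ring

theorem continuousAt_J (hK : K ∈ T.stabilizing S) : ContinuousAt (T.J S) K := by
  have h1 : ContinuousAt (fun Z : Ctrl p nu ny => T.costOf (Z * pinv S)) K :=
    ContinuousAt.comp (g := T.costOf) (continuousAt_costOf (mem_stabilizing_iff.1 hK))
      (Continuous.continuousAt (by fun_prop))
  have h2 : (fun Z : Ctrl p nu ny => T.J S K + (T.costOf (Z * pinv S) - T.costOf (K * pinv S)))
      =ᶠ[𝓝 K] T.J S := by
    filter_upwards [isOpen_stabilizing.mem_nhds hK] with Z hZ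
    rw [← J_sub hν hn hZ hK]
    ring
  exact (ContinuousAt.add continuousAt_const (h1.sub continuousAt_const)).congr h2

/-- `gradJ` is the gradient of the cost for the Frobenius inner product. -/
theorem hasDerivAt_J (s : ℝ) (hK : K + s • D ∈ T.stabilizing S) :
    HasDerivAt (fun s : ℝ => T.J S (K + s • D)) (frobInner (T.gradJ S (K + s • D)) D) s := by
  have h0 := hasDerivAt_costOf hν (mem_stabilizing_iff.1 hK) (D * pinv S)
  rw [← frobInner_gradJ] at h0
  have h1 : HasDerivAt (fun u : ℝ => T.costOf ((K + s • D) * pinv S + (u - s) • (D * pinv S)))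
      (frobInner (T.gradJ S (K + s • D)) D) s :=
    HasDerivAt.comp_sub_const (f := fun u : ℝ =>
      T.costOf ((K + s • D) * pinv S + u • (D * pinv S))) s s (by simpa using h0)
  have hcont : Continuous fun u : ℝ => K + u • D := by fun_prop
  have hev : ∀ᶠ u : ℝ in 𝓝 s, K + u • D ∈ T.stabilizing S :=
    hcont.continuousAt.eventually (isOpen_stabilizing.mem_nhds hK)
  refine (h1.add_const (T.J S (K + s • D) - T.costOf ((K + s • D) * pinv S))).congr_of_eventuallyEq
    ?_
  filter_upwards [hev] with u hu
  have h2 : (K + s • D) * pinv S + (u - s) • (D * pinv S) = (K + u • D) * pinv S := by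
    simp only [Matrix.add_mul, Matrix.smul_mul, sub_smul]; abel
  rw [h2]
  linarith [J_sub hν hn hu hK]

omit hn in
/-- The gradient controls `E_K`, because `Σ_K ⪰ Σ_ν` and `∇J K * Sᵀ = E_K Σ_K` by `S S† = 1`. -/
theorem frobNorm_gradOf_le (hS : S * pinv S = 1) (hK : K ∈ T.stabilizing S) :
    lambdaMin T.noiseCov ^ 2 * frobNorm (T.gradOf (K * pinv S)) ^ 2 ≤
      specNorm S ^ 2 * frobNorm (T.gradJ S K) ^ 2 := by
  have hKs := mem_stabilizing_iff.1 hK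
  set E := T.gradOf (K * pinv S)
  set X := T.covOf (K * pinv S)
  have hX : X.PosSemidef := covOf_posSemidef hν hKs
  have hES : E * X = T.gradJ S K * Sᵀ := by
    rw [gradJ_eq, Matrix.mul_assoc _ (pinv S)ᵀ, ← transpose_mul, hS, transpose_one, Matrix.mul_one]
  have hlam := lambdaMin_nonneg hν.posSemidef
  have h1 : ∀ x : Fin nx → ℝ, lambdaMin T.noiseCov ^ 2 * (x ⬝ᵥ x) ≤ (X *ᵥ x) ⬝ᵥ (X *ᵥ x) := by
    intro x
    have h2 : lambdaMin T.noiseCov * (x ⬝ᵥ x) ≤ x ⬝ᵥ (X *ᵥ x) :=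
      (lambdaMin_mul_le_quad (PosSemidef.transpose_eq hν.posSemidef) x).trans
        (quad_le_quad_dlyap hKs hν.posSemidef x)
    have h3 := dotProduct_sq_le x (X *ᵥ x)
    have h0 := dotProduct_self_nonneg' x
    rcases h0.eq_or_lt with h0 | h0
    · rw [← h0, mul_zero]; exact dotProduct_self_nonneg' _
    · have h4 : (lambdaMin T.noiseCov * (x ⬝ᵥ x)) ^ 2 ≤ (x ⬝ᵥ x) * ((X *ᵥ x) ⬝ᵥ (X *ᵥ x)) :=
        (pow_le_pow_left₀ (by positivity) h2 2).trans h3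
      refine le_of_mul_le_mul_left (le_trans (le_of_eq ?_) h4) h0
      ring
  have hrowE : ∀ i, (E * X).row i = X *ᵥ E.row i := fun i => by
    rw [← PosSemidef.transpose_eq hX, mulVec_transpose, PosSemidef.transpose_eq hX]; rfl
  have hrowG : ∀ i, (T.gradJ S K * Sᵀ).row i = S *ᵥ (T.gradJ S K).row i := fun i => by
    rw [← vecMul_transpose]; rfl
  rw [frobNorm_sq, frobNorm_sq, Finset.mul_sum, Finset.mul_sum]
  refine Finset.sum_le_sum fun i _ => (h1 _).trans ?_
  rw [← hrowE, hES, hrowG]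
  exact mulVec_dotProduct_self_le _ _

/-- Gradient dominance of the cost. -/
theorem gam_mul_J_sub_le (hS : S * pinv S = 1) (hγ : 0 < T.gam S Kopt)
    (hK : K ∈ T.stabilizing S) (hKopt : Kopt ∈ T.stabilizing S) :
    T.gam S Kopt * (T.J S K - T.J S Kopt) ≤ frobNorm (T.gradJ S K) ^ 2 := by
  have hr0 : 0 ≤ lambdaMin T.R := lambdaMin_nonneg T.hR.posSemidef
  have hspec0 := specNorm_nonneg (T.stateCov S Kopt)
  have hr : 0 < lambdaMin T.R := hr0.lt_of_ne fun h => by simp [LQGTask.gam, ← h] at hγ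
  have hspec : 0 < specNorm (T.stateCov S Kopt) := hspec0.lt_of_ne fun h => by
    simp [LQGTask.gam, ← h] at hγ
  have hSn : 0 < specNorm S := (specNorm_nonneg S).lt_of_ne fun h => by
    simp [LQGTask.gam, ← h] at hγ
  have h1 := costOf_sub_le hν hr
    (lambdaMin_mul_le_quad (PosSemidef.transpose_eq T.hR.posSemidef))
    (mem_stabilizing_iff.1 hK) (mem_stabilizing_iff.1 hKopt)
  have h2 := frobNorm_gradOf_le hν hS hK
  rw [← stateCov_eq] at h1
  rw [J_sub hν hn hK hKopt]
  refine (mul_le_mul_of_nonneg_left h1 hγ.le).trans ?_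
  have h3 : T.gam S Kopt * (specNorm (T.stateCov S Kopt) / (4 * lambdaMin T.R) *
      frobNorm (T.gradOf (K * pinv S)) ^ 2) =
      (lambdaMin T.noiseCov ^ 2 * frobNorm (T.gradOf (K * pinv S)) ^ 2) / specNorm S ^ 2 := by
    rw [LQGTask.gam]; field_simp
  rw [h3, div_le_iff₀ (by positivity)]
  linarith

theorem gradJ_eq_zero_of_isOptimal (hopt : T.IsOptimal S Kopt) : T.gradJ S Kopt = 0 := by
  have h1 := hasDerivAt_J hν hn (K := Kopt) (D := T.gradJ S Kopt) (S := S) 0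
    (by simpa using hopt.1)
  have hcont : Continuous fun u : ℝ => Kopt + u • T.gradJ S Kopt := by fun_prop
  have hmin : IsLocalMin (fun s : ℝ => T.J S (Kopt + s • T.gradJ S Kopt)) 0 := by
    have hev : ∀ᶠ u : ℝ in 𝓝 0, Kopt + u • T.gradJ S Kopt ∈ T.stabilizing S :=
      hcont.continuousAt.eventually (isOpen_stabilizing.mem_nhds (by simpa using hopt.1))
    filter_upwards [hev] with u hu
    simpa using hopt.2 _ hu
  have h2 := hmin.hasDerivAt_eq_zero h1
  rw [zero_smul, add_zero, frobInner_self] at h2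
  exact eq_zero_of_frobNorm_eq_zero (pow_eq_zero_iff two_ne_zero |>.1 h2)

/-- Relative to the whole space, not just to the stabilizing set: the cost blows up towards the
boundary of that set. -/
theorem isClosed_sublevel_J (hS : S * pinv S = 1) (hopt : T.IsOptimal S Kopt) (ℓ : ℝ) :
    IsClosed {K : Ctrl p nu ny | K ∈ T.stabilizing S ∧ T.J S K - T.J S Kopt ≤ ℓ} := by
  have hE : T.gradOf (Kopt * pinv S) = 0 := by
    have h1 := frobNorm_gradOf_le hν hS hopt.1
    rw [gradJ_eq_zero_of_isOptimal hν hn hopt, frobNorm_zero] at h1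
    have : Nonempty (Fin nx) := ⟨⟨0, hn⟩⟩
    have hpos := lambdaMin_pos hν
    have h2 := sq_nonneg (frobNorm (T.gradOf (Kopt * pinv S)))
    have h3 : frobNorm (T.gradOf (Kopt * pinv S)) ^ 2 = 0 := by
      by_contra hne
      have : 0 < frobNorm (T.gradOf (Kopt * pinv S)) ^ 2 := h2.lt_of_ne (Ne.symm hne)
      have := mul_pos (pow_pos hpos 2) this
      linarith
    exact eq_zero_of_frobNorm_eq_zero (pow_eq_zero_iff two_ne_zero |>.1 h3)
  have h := isClosed_sublevel_costOf hν (mem_stabilizing_iff.1 hopt.1) hE ℓ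
  have hc : Continuous fun K : Ctrl p nu ny => K * pinv S := by fun_prop
  convert h.preimage hc using 1
  ext K
  simp only [Set.mem_ofPred_eq, Set.mem_preimage]
  rw [mem_stabilizing_iff]
  refine and_congr_right fun hK => ?_
  rw [J_sub hν hn (mem_stabilizing_iff.2 hK) hopt.1]

end Lifted

/-! ### Bisimulation bounds on the gradient mismatch -/

section Bisim

variable {ι κ : Type*} [Fintype ι] [Fintype κ] [DecidableEq ι]

omit [DecidableEq ι] in
/-- A feasible pair `(M, λ)` bounds the output `C s` at the fixed point of `s = F s + ν`: in the
seminorm of `M` the map `F` contracts by `√(1 - λ)`. -/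
theorem BisimFeasible.output_le {F : Matrix ι ι ℝ} {C : Matrix κ ι ℝ} {M : Matrix ι ι ℝ} {lam : ℝ}
    (h : BisimFeasible F C M lam) {s ν : ι → ℝ} (hs : s = F *ᵥ s + ν) :
    (C *ᵥ s) ⬝ᵥ (C *ᵥ s) ≤ bisimValue ν M lam := by
  have hCC : (Cᵀ * C).PosSemidef := by simpa using posSemidef_conjTranspose_mul_self C
  have hM : M.PosSemidef := by simpa using h.output.add hCC
  have hout := PosSemidef.quad_nonneg h.output s
  have hdec := PosSemidef.quad_nonneg h.decay s
  rw [sub_mulVec, dotProduct_sub, ← mulVec_mulVec, dotProduct_mulVec_transpose Cᵀ,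
    transpose_transpose] at hout
  rw [sub_mulVec, sub_mulVec, dotProduct_sub, dotProduct_sub, quad_congr', neg_mulVec, smul_mulVec,
    dotProduct_neg, dotProduct_smul, smul_eq_mul] at hdec
  set r := Real.sqrt (1 - lam) with hr
  have hlam : 0 < 1 - lam := by linarith [h.lt_one]
  have hr0 : 0 < r := Real.sqrt_pos.2 hlam
  have hr2 : r ^ 2 = 1 - lam := Real.sq_sqrt hlam.le
  have hr1 : r < 1 := by
    rw [hr, Real.sqrt_lt' one_pos]; linarith [h.pos]
  have hη : 0 < 1 / r - 1 := by
    rw [sub_pos, lt_div_iff₀ hr0]; linarith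
  have hyoung := quad_add_le hM hη (F *ᵥ s) ν
  rw [← hs] at hyoung
  have hden : lam - (1 / r - 1) * (1 - lam) = 1 - r := by
    have : lam = 1 - r ^ 2 := by linarith
    rw [this]; field_simp; ring
  unfold bisimValue
  rw [← hr, hden, le_div_iff₀ (by linarith)]
  have h1 : (1 + (1 / r - 1)) * ((F *ᵥ s) ⬝ᵥ (M *ᵥ (F *ᵥ s))) ≤ r * (s ⬝ᵥ (M *ᵥ s)) := by
    have h2 : (F *ᵥ s) ⬝ᵥ (M *ᵥ (F *ᵥ s)) ≤ r ^ 2 * (s ⬝ᵥ (M *ᵥ s)) := by rw [hr2]; linarith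
    calc (1 + (1 / r - 1)) * ((F *ᵥ s) ⬝ᵥ (M *ᵥ (F *ᵥ s)))
        ≤ (1 + (1 / r - 1)) * (r ^ 2 * (s ⬝ᵥ (M *ᵥ s))) :=
          mul_le_mul_of_nonneg_left h2 (by linarith)
      _ = r * (s ⬝ᵥ (M *ᵥ s)) := by field_simp; ring
  nlinarith

/-- For stable `F` the constraints are feasible: with `N = Cᵀ C + 1` and `m` so large that
`(F ^ m)ᵀ N F ^ m ⪯ N / 2`, a finite geometrically weighted sum of the `(F ^ k)ᵀ N F ^ k` works. -/
theorem exists_bisimFeasible {F : Matrix ι ι ℝ} (hF : IsSchur F) (C : Matrix κ ι ℝ) :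
    ∃ M lam, BisimFeasible F C M lam := by
  set N : Matrix ι ι ℝ := Cᵀ * C + 1 with hN
  have hCC : (Cᵀ * C).PosSemidef := by simpa using posSemidef_conjTranspose_mul_self C
  have hNps : N.PosSemidef := hCC.add PosSemidef.one
  set g : ℕ → Matrix ι ι ℝ := fun k => (F ^ k)ᵀ * N * F ^ k with hg
  have hgps : ∀ k, (g k).PosSemidef := fun k => by
    simpa [hg] using hNps.conjTranspose_mul_mul_same (F ^ k)
  have hg0 : Tendsto (fun k => frobNorm (g k)) atTop (𝓝 0) := by
    have hc : Continuous fun Z : Matrix ι ι ℝ => Zᵀ * N * Z := by fun_prop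
    have := ((continuous_frobNorm.comp hc).tendsto 0).comp hF.tendsto_pow
    simpa [Function.comp_def, hg] using this
  obtain ⟨m, hm, hm0⟩ := ((hg0.eventually_lt_const (by norm_num : (0 : ℝ) < 1 / 2)).and
    (eventually_gt_atTop 0)).exists
  set ρ : ℝ := (1 / 2) ^ (1 / (m : ℝ)) with hρ
  have hρ0 : 0 < ρ := by positivity
  have hρ1 : ρ < 1 := Real.rpow_lt_one (by norm_num) (by norm_num) (by positivity)
  have hρm : ρ ^ m = 1 / 2 := by
    rw [hρ, ← Real.rpow_natCast, ← Real.rpow_mul (by norm_num), one_div_mul_cancel (by positivity),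
      Real.rpow_one]
  set M : Matrix ι ι ℝ := ∑ k ∈ Finset.range m, (ρ⁻¹ ^ k) • g k with hM
  have hshift : Fᵀ * M * F = ρ • (M - N + (2 : ℝ) • g m) := by
    have h1 : ∀ k, Fᵀ * g k * F = g (k + 1) := fun k => by
      simp only [hg, pow_succ, transpose_mul, Matrix.mul_assoc]
    have h2 : Fᵀ * M * F = ρ • ∑ k ∈ Finset.range m, (ρ⁻¹ ^ (k + 1)) • g (k + 1) := by
      rw [hM, Matrix.mul_sum, Matrix.sum_mul, Finset.smul_sum]
      refine Finset.sum_congr rfl fun k _ => ?_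
      rw [Matrix.mul_smul, Matrix.smul_mul, h1, smul_smul, pow_succ' ρ⁻¹, ← mul_assoc,
        mul_inv_cancel₀ hρ0.ne', one_mul]
    rw [h2]
    congr 1
    have h3 := Finset.sum_range_succ (fun k => (ρ⁻¹ ^ k) • g k) m
    rw [Finset.sum_range_succ'] at h3
    have h4 : g 0 = N := by simp [hg]
    have h5 : ρ⁻¹ ^ m = 2 := by rw [inv_pow, hρm]; norm_num
    rw [pow_zero, one_smul, h4, h5, ← hM] at h3
    rw [eq_sub_of_add_eq h3]
    abel
  refine ⟨M, 1 - ρ, by linarith, by linarith, ?_, ?_⟩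
  · obtain ⟨m', rfl⟩ : ∃ m', m = m' + 1 := ⟨m - 1, by omega⟩
    have h4 : M - Cᵀ * C = ∑ k ∈ Finset.range m', (ρ⁻¹ ^ (k + 1)) • g (k + 1) + 1 := by
      rw [hM, Finset.sum_range_succ']
      simp [hg, hN]
      abel
    rw [h4]
    exact (posSemidef_sum _ fun k _ => (hgps _).smul (by positivity)).add PosSemidef.one
  · have h5 : -((1 - ρ) • M) - (Fᵀ * M * F - M) = ρ • (N - (2 : ℝ) • g m) := by
      rw [hshift]
      module
    rw [h5]
    refine PosSemidef.smul (posSemidef_of_quad ?_ fun x => ?_) hρ0.le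
    · rw [transpose_sub, transpose_smul, PosSemidef.transpose_eq hNps,
        PosSemidef.transpose_eq (hgps m)]
    · have h6 := quad_le_frobNorm (g m) x
      have h7 := PosSemidef.quad_nonneg hCC x
      have h8 := dotProduct_self_nonneg' x
      rw [hN, sub_mulVec, dotProduct_sub, add_mulVec, dotProduct_add, one_mulVec, smul_mulVec,
        dotProduct_smul, smul_eq_mul]
      nlinarith

theorem IsSchur.kronecker_self {A : Matrix ι ι ℝ} (hA : IsSchur A) : IsSchur (A ⊗ₖ A) := by
  have hpow : ∀ k : ℕ, (A ⊗ₖ A) ^ k = (A ^ k) ⊗ₖ (A ^ k) := by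
    intro k
    induction k with
    | zero => simp
    | succ k ih => rw [pow_succ, ih, ← mul_kronecker_mul, ← pow_succ]
  rw [isSchur_iff_tendsto_pow, tendsto_matrix_iff]
  intro i j
  simp only [hpow, kroneckerMap_apply]
  have h := tendsto_matrix_iff.1 hA.tendsto_pow
  simpa using (h i.1 j.1).mul (h i.2 j.2)

omit [DecidableEq ι] in
theorem frobNorm_sq_eq_vec (M : Matrix ι κ ℝ) : frobNorm M ^ 2 = M.vec ⬝ᵥ M.vec := by
  rw [frobNorm_sq, vec_dotProduct_vec, trace_mul_comm, ← frobInner_eq_trace]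
  rfl

end Bisim

section Heterogeneity

variable {nx nu ny p N : ℕ}

/-- The heterogeneity of two tasks dominates the squared distance of their gradients. -/
theorem frobNorm_gradJ_sub_sq_le {T₁ T₂ : LQGTask nx nu ny}
    {S₁ S₂ : Matrix (Fin nx) (Hist p nu ny) ℝ} {K : Ctrl p nu ny}
    (h₁ : K ∈ T₁.stabilizing S₁) (h₂ : K ∈ T₂.stabilizing S₂) :
    frobNorm (T₁.gradJ S₁ K - T₂.gradJ S₂ K) ^ 2 ≤ bisimHet T₁ T₂ S₁ S₂ K := by
  have h₁' : IsSchur (T₁.Acl S₁ K) := h₁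
  have h₂' : IsSchur (T₂.Acl S₂ K) := h₂
  refine le_csInf ?_ ?_
  · obtain ⟨M, lam, h⟩ := exists_bisimFeasible
      (h₁'.kronecker_self.fromBlocks h₂'.kronecker_self 0)
      (Matrix.fromCols (T₁.Cout S₁ K) (-(T₂.Cout S₂ K)))
    exact ⟨_, M, lam, h, rfl⟩
  · rintro b ⟨M, lam, hfeas, rfl⟩
    have hfix : ∀ (T : LQGTask nx nu ny) (S : Matrix (Fin nx) (Hist p nu ny) ℝ),
        IsSchur (T.Acl S K) →
        (T.stateCov S K).vec = T.F S K *ᵥ (T.stateCov S K).vec + T.noiseCov.vec := by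
      intro T S h
      rw [LQGTask.F, kronecker_mulVec_vec, ← vec_add, vec_inj, add_comm]
      exact dlyap_eq h
    have hout : ∀ (T : LQGTask nx nu ny) (S : Matrix (Fin nx) (Hist p nu ny) ℝ),
        T.Cout S K *ᵥ (T.stateCov S K).vec = (T.gradJ S K).vec := by
      intro T S
      rw [LQGTask.Cout, kronecker_mulVec_vec]
      rfl
    have hs : Sum.elim (T₁.stateCov S₁ K).vec (T₂.stateCov S₂ K).vec =
        Matrix.fromBlocks (T₁.F S₁ K) 0 0 (T₂.F S₂ K) *ᵥ
          Sum.elim (T₁.stateCov S₁ K).vec (T₂.stateCov S₂ K).vec +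
        Sum.elim T₁.noiseCov.vec T₂.noiseCov.vec := by
      rw [fromBlocks_mulVec, Sum.elim_comp_inl, Sum.elim_comp_inr, zero_mulVec, zero_mulVec,
        add_zero, zero_add]
      conv_lhs => rw [hfix T₁ S₁ h₁', hfix T₂ S₂ h₂']
      ext (i | i) <;> rfl
    have h := hfeas.output_le hs
    rwa [fromCols_mulVec, Sum.elim_comp_inl, Sum.elim_comp_inr, neg_mulVec, hout, hout,
      ← sub_eq_add_neg, ← vec_sub, ← frobNorm_sq_eq_vec] at h

theorem frobNorm_sum_sq_le {m n ι : Type*} [Fintype m] [Fintype n] (s : Finset ι)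
    (M : ι → Matrix m n ℝ) :
    frobNorm (∑ j ∈ s, M j) ^ 2 ≤ s.card * ∑ j ∈ s, frobNorm (M j) ^ 2 := by
  have h : ∀ M : Matrix m n ℝ, frobNorm M ^ 2 = ∑ q : m × n, M q.1 q.2 ^ 2 := fun M => by
    rw [frobNorm_sq]
    simp [Fintype.sum_prod_type, dotProduct, sq, row_apply]
  simp only [h]
  rw [Finset.sum_comm, Finset.mul_sum]
  refine Finset.sum_le_sum fun q _ => ?_
  rw [Matrix.sum_apply]
  exact sq_sum_le_card_mul_sum_sq

/-- The average heterogeneity dominates the squared distance of a task gradient to the mean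
gradient. -/
theorem frobNorm_gradJ_sub_mean_sq_le {T : Fin N → LQGTask nx nu ny}
    {S : Fin N → Matrix (Fin nx) (Hist p nu ny) ℝ} {K : Ctrl p nu ny}
    (hK : ∀ j, K ∈ (T j).stabilizing (S j)) (i : Fin N) :
    frobNorm ((T i).gradJ (S i) K - (1 / (N : ℝ)) • ∑ j, (T j).gradJ (S j) K) ^ 2 ≤
      avgHet T S i K := by
  have hN : 0 < N := i.pos
  have hN' : (0 : ℝ) < N := by exact_mod_cast hN
  have hmean : (T i).gradJ (S i) K - (1 / (N : ℝ)) • ∑ j, (T j).gradJ (S j) K =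
      (1 / (N : ℝ)) • ∑ j ∈ Finset.univ.erase i, ((T i).gradJ (S i) K - (T j).gradJ (S j) K) := by
    have h1 : ∑ j ∈ Finset.univ.erase i, ((T i).gradJ (S i) K - (T j).gradJ (S j) K) =
        ∑ j, ((T i).gradJ (S i) K - (T j).gradJ (S j) K) :=
      Finset.sum_erase _ (sub_self _)
    rw [h1, Finset.sum_sub_distrib, smul_sub, Finset.sum_const, Finset.card_univ, Fintype.card_fin,
      ← Nat.cast_smul_eq_nsmul ℝ, smul_smul, one_div, inv_mul_cancel₀ hN'.ne', one_smul]
  have hsum : frobNorm (∑ j ∈ Finset.univ.erase i,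
      ((T i).gradJ (S i) K - (T j).gradJ (S j) K)) ^ 2 ≤
      ((N : ℝ) - 1) * ∑ j ∈ Finset.univ.erase i, bisimHet (T i) (T j) (S i) (S j) K := by
    refine (frobNorm_sum_sq_le _ _).trans ?_
    rw [Finset.card_erase_of_mem (Finset.mem_univ i), Finset.card_univ, Fintype.card_fin,
      Nat.cast_sub hN, Nat.cast_one]
    have : (1 : ℝ) ≤ N := by exact_mod_cast hN
    refine mul_le_mul_of_nonneg_left ?_ (by linarith)
    exact Finset.sum_le_sum fun j _ => frobNorm_gradJ_sub_sq_le (hK i) (hK j)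
  have hb0 : 0 ≤ ∑ j ∈ Finset.univ.erase i, bisimHet (T i) (T j) (S i) (S j) K :=
    Finset.sum_nonneg fun j _ => (sq_nonneg _).trans (frobNorm_gradJ_sub_sq_le (hK i) (hK j))
  rw [hmean, frobNorm_smul, mul_pow, sq_abs, avgHet]
  rcases Nat.lt_or_ge 1 N with h1 | h1
  · have h1' : (1 : ℝ) < N := by exact_mod_cast h1
    refine (mul_le_mul_of_nonneg_left hsum (by positivity)).trans ?_
    rw [← mul_assoc]
    refine mul_le_mul_of_nonneg_right ?_ hb0
    rw [div_pow, one_pow, div_mul_eq_mul_div, one_mul,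
      div_le_div_iff₀ (by positivity) (by linarith)]
    nlinarith
  · have : N = 1 := by omega
    subst this
    have he : (Finset.univ : Finset (Fin 1)).erase i = ∅ := by
      rw [Subsingleton.elim i 0]; rfl
    simp only [he, Finset.sum_empty, frobNorm_zero]
    simp

end Heterogeneity

/-! ### Descent along the mean gradient -/

section Descent

variable {nx nu ny p N : ℕ}

/-- In state dimension zero the constant `gam` is zero, by division by a zero norm. -/
theorem pos_of_gam_pos {T : LQGTask nx nu ny} {S : Matrix (Fin nx) (Hist p nu ny) ℝ}
    {K : Ctrl p nu ny} (h : 0 < T.gam S K) : 0 < nx := by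
  rcases Nat.eq_zero_or_pos nx with rfl | h0
  · exfalso
    have h1 : T.stateCov S K = 0 := by ext i; exact i.elim0
    have h2 : specNorm (0 : Matrix (Fin 0) (Fin 0) ℝ) = 0 := by simp [specNorm]
    rw [LQGTask.gam, h1, h2, zero_mul, div_zero] at h
    exact lt_irrefl _ h
  · exact h0

theorem neg_frobInner_eq {m n : Type*} [Fintype m] [Fintype n] (g G : Matrix m n ℝ) :
    -frobInner g G = -(1 / 2) * (frobNorm g ^ 2 + frobNorm G ^ 2 - frobNorm (g - G) ^ 2) := by
  rw [← frobInner_self (g - G), frobInner_sub_left, frobInner_sub_right, frobInner_sub_right,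
    frobInner_self, frobInner_self, frobInner_comm G g]
  ring

/-- The descent lemma for an inexact gradient `G`; the Lipschitz bound is needed on the segment
only. -/
theorem J_sub_smul_le {T : LQGTask nx nu ny} {S : Matrix (Fin nx) (Hist p nu ny) ℝ}
    (hν : T.noiseCov.PosDef) (hn : 0 < nx) {K G : Ctrl p nu ny} {L τ : ℝ}
    (hτ0 : 0 ≤ τ) (hτL : τ * L ≤ 1)
    (hstab : ∀ s ∈ Set.Icc 0 τ, K - s • G ∈ T.stabilizing S)
    (hL : ∀ s ∈ Set.Icc 0 τ, frobNorm (T.gradJ S (K - s • G) - T.gradJ S K) ≤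
      L * frobNorm (K - s • G - K)) :
    T.J S (K - τ • G) ≤ T.J S K - τ / 2 * frobNorm (T.gradJ S K) ^ 2 +
      τ / 2 * frobNorm (T.gradJ S K - G) ^ 2 := by
  have hsub : ∀ s : ℝ, K + s • (-G) = K - s • G := fun s => by rw [smul_neg, sub_eq_add_neg]
  have hderiv : ∀ s ∈ Set.Icc 0 τ, HasDerivAt (fun s : ℝ => T.J S (K - s • G) +
      s * frobInner (T.gradJ S K) G - L / 2 * s ^ 2 * frobNorm G ^ 2)
      (frobInner (T.gradJ S (K - s • G)) (-G) + frobInner (T.gradJ S K) G -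
        L * s * frobNorm G ^ 2) s := by
    intro s hs
    have h1 := hasDerivAt_J hν hn (K := K) (D := -G) (S := S) s (by rw [hsub]; exact hstab s hs)
    simp only [hsub] at h1
    have h2 := (hasDerivAt_id s).mul_const (frobInner (T.gradJ S K) G)
    have h3 := (((hasDerivAt_id s).pow 2).const_mul (L / 2)).mul_const (frobNorm G ^ 2)
    refine ((h1.add h2).sub h3).congr_deriv ?_
    simp only [id, Nat.add_one_sub_one, pow_one, Nat.cast_ofNat]
    ring
  have hanti : AntitoneOn (fun s : ℝ => T.J S (K - s • G) +
      s * frobInner (T.gradJ S K) G - L / 2 * s ^ 2 * frobNorm G ^ 2) (Set.Icc 0 τ) := by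
    refine antitoneOn_of_deriv_nonpos (convex_Icc 0 τ)
      (fun s hs => (hderiv s hs).continuousAt.continuousWithinAt)
      (fun s hs => (hderiv s (interior_subset hs)).differentiableAt.differentiableWithinAt)
      fun s hs => ?_
    have hs' := interior_subset hs
    rw [(hderiv s hs').deriv]
    have h1 := hL s hs'
    rw [sub_sub_cancel_left, ← neg_smul, frobNorm_smul, abs_neg, abs_of_nonneg hs'.1] at h1
    have h2 := frobInner_le (T.gradJ S (K - s • G) - T.gradJ S K) (-G)
    have h3 : frobNorm (-G) = frobNorm G := by
      simpa using frobNorm_smul (-1) G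
    have h4 : frobInner (T.gradJ S K) (-G) = -frobInner (T.gradJ S K) G := by
      simpa using frobInner_smul_right (-1) (T.gradJ S K) G
    rw [frobInner_sub_left, h3, h4] at h2
    have h5 := mul_le_mul_of_nonneg_right h1 (frobNorm_nonneg G)
    nlinarith
  have h := hanti (Set.left_mem_Icc.2 hτ0) (Set.right_mem_Icc.2 hτ0) hτ0
  simp only [zero_smul, sub_zero, zero_mul, add_zero, ne_eq, OfNat.ofNat_ne_zero,
    not_false_eq_true, zero_pow, mul_zero] at h
  have h6 := neg_frobInner_eq (T.gradJ S K) G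
  have h7 : 0 ≤ τ * (1 - τ * L) * frobNorm G ^ 2 :=
    mul_nonneg (mul_nonneg hτ0 (by linarith)) (sq_nonneg _)
  have h8 : τ * -frobInner (T.gradJ S K) G = τ * (-(1 / 2) * (frobNorm (T.gradJ S K) ^ 2 +
      frobNorm G ^ 2 - frobNorm (T.gradJ S K - G) ^ 2)) := by rw [h6]
  nlinarith

/-- If every `d (n + 1)` is at most a convex combination of `d n` and a multiple of `b n`, the
upper limits compare accordingly. -/
theorem limsup_le_of_contraction {d b : ℕ → ℝ} {q a : ℝ} (hq0 : 0 < q) (hq1 : q < 1) (ha : 0 < a)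
    (hd0 : ∀ n, 0 ≤ d n) (hb : BddAbove (Set.range b))
    (hstep : ∀ n, d (n + 1) ≤ (1 - q) * d n + a * b n) :
    limsup d atTop ≤ a / q * limsup b atTop := by
  refine le_of_forall_gt_imp_ge_of_dense fun c hc => ?_
  have hc' : limsup b atTop < c * q / a := by
    rw [lt_div_iff₀ ha]
    rw [div_mul_eq_mul_div, div_lt_iff₀ hq0] at hc
    linarith
  obtain ⟨B, hB1, hB2⟩ := exists_between hc'
  have hev := eventually_lt_of_limsup_lt hB1 hb.isBoundedUnder_of_range
  obtain ⟨n₀, hn₀⟩ := eventually_atTop.1 hev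
  have hind : ∀ k, d (k + n₀) ≤ (1 - q) ^ k * (d n₀ - a * B / q) + a * B / q := by
    intro k
    induction k with
    | zero => simp
    | succ k ih =>
      have h1 := hstep (k + n₀)
      have h2 := hn₀ (k + n₀) (by omega)
      rw [show k + 1 + n₀ = k + n₀ + 1 by ring]
      have h3 : a * b (k + n₀) ≤ a * B := mul_le_mul_of_nonneg_left h2.le ha.le
      have h4 := mul_le_mul_of_nonneg_left ih (by linarith : 0 ≤ 1 - q)
      have h5 : (1 - q) * ((1 - q) ^ k * (d n₀ - a * B / q) + a * B / q) + a * B =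
          (1 - q) ^ (k + 1) * (d n₀ - a * B / q) + a * B / q := by
        field_simp; ring
      linarith
  have hlim : Tendsto (fun k => (1 - q) ^ k * (d n₀ - a * B / q) + a * B / q) atTop
      (𝓝 (a * B / q)) := by
    have := ((tendsto_pow_atTop_nhds_zero_of_lt_one (by linarith : 0 ≤ 1 - q)
      (by linarith)).mul_const (d n₀ - a * B / q)).add_const (a * B / q)
    simpa using this
  have hBc : a * B / q < c := by
    rw [div_lt_iff₀ hq0]
    rw [lt_div_iff₀ ha] at hB2
    linarith
  have hev2 : ∀ᶠ n in atTop, d n ≤ c := by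
    obtain ⟨k₀, hk₀⟩ := eventually_atTop.1 (hlim.eventually_lt_const hBc)
    refine eventually_atTop.2 ⟨k₀ + n₀, fun n hn => ?_⟩
    have h1 := hind (n - n₀)
    rw [Nat.sub_add_cancel (by omega)] at h1
    exact h1.trans (hk₀ (n - n₀) (by omega)).le
  exact limsup_le_of_le (isCoboundedUnder_le_of_le atTop (x := 0) hd0) hev2

end Descent

section Multitask

variable {nx nu ny p N : ℕ}

/-- The mean of the task gradients. -/
noncomputable def meanGrad (T : Fin N → LQGTask nx nu ny)
    (S : Fin N → Matrix (Fin nx) (Hist p nu ny) ℝ) (K : Ctrl p nu ny) : Ctrl p nu ny :=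
  (1 / (N : ℝ)) • ∑ j, (T j).gradJ (S j) K

variable {T : Fin N → LQGTask nx nu ny} {S : Fin N → Matrix (Fin nx) (Hist p nu ny) ℝ}

theorem pgIter_succ (α : ℝ) (K₀ : Ctrl p nu ny) (n : ℕ) :
    pgIter T S α K₀ (n + 1) = pgIter T S α K₀ n - α • meanGrad T S (pgIter T S α K₀ n) := by
  rw [pgIter, meanGrad, smul_smul, mul_one_div]

variable {Kopt : Fin N → Ctrl p nu ny} {K₀ : Ctrl p nu ny} {β L : Fin N → ℝ} {α : ℝ}

theorem isClosed_stabSet (hν : ∀ i, (T i).noiseCov.PosDef) (hn : ∀ _ : Fin N, 0 < nx)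
    (hS : ∀ i, S i * pinv (S i) = 1) (hopt : ∀ i, (T i).IsOptimal (S i) (Kopt i)) :
    IsClosed (stabSet T S Kopt β K₀) := by
  have h : stabSet T S Kopt β K₀ = ⋂ i, {K | K ∈ (T i).stabilizing (S i) ∧
      (T i).J (S i) K - (T i).J (S i) (Kopt i) ≤
        β i * ((T i).J (S i) K₀ - (T i).J (S i) (Kopt i))} := by
    ext K
    simp [stabSet]
  rw [h]
  exact isClosed_iInter fun i => isClosed_sublevel_J (hν i) (hn i) (hS i) (hopt i) _

variable (hν : ∀ i, (T i).noiseCov.PosDef) (hS : ∀ i, S i * pinv (S i) = 1)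
  (hopt : ∀ i, (T i).IsOptimal (S i) (Kopt i)) (hγ : ∀ i, 0 < (T i).gam (S i) (Kopt i))
  (hLpos : ∀ i, 0 < L i)
  (hL : ∀ i, ∀ K ∈ stabSet T S Kopt β K₀, ∀ K' ∈ stabSet T S Kopt β K₀,
    frobNorm ((T i).gradJ (S i) K - (T i).gradJ (S i) K') ≤ L i * frobNorm (K - K'))
  (hαL : ∀ i, α < 1 / (4 * L i))
include hν hS hopt hγ hLpos hL hαL

/-- The contraction of the suboptimality over a step along the mean gradient that stays in the
common stabilizing set. -/
theorem subopt_le_of_segment {K : Ctrl p nu ny} {s : ℝ} (hs0 : 0 ≤ s) (hsα : s ≤ α)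
    (hseg : ∀ t ∈ Set.Icc 0 s, K - t • meanGrad T S K ∈ stabSet T S Kopt β K₀) (i : Fin N) :
    (T i).J (S i) (K - s • meanGrad T S K) - (T i).J (S i) (Kopt i) ≤
      (1 - s * (T i).gam (S i) (Kopt i) / 4) * ((T i).J (S i) K - (T i).J (S i) (Kopt i)) +
        s / 2 * avgHet T S i K := by
  have hn := pos_of_gam_pos (hγ i)
  have hK : K ∈ stabSet T S Kopt β K₀ := by simpa using hseg 0 (Set.left_mem_Icc.2 hs0)
  have hsL : s * L i ≤ 1 := by
    have h1 := hαL i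
    rw [lt_div_iff₀ (by linarith [hLpos i])] at h1
    nlinarith [hLpos i]
  have h1 := J_sub_smul_le (hν i) hn hs0 hsL (fun t ht => (hseg t ht i).1)
    (fun t ht => hL i _ (hseg t ht) _ hK)
  have h2 := frobNorm_gradJ_sub_mean_sq_le (fun j => (hK j).1) i
  have h3 := gam_mul_J_sub_le (hν i) hn (hS i) (hγ i) (hK i).1 (hopt i).1
  have h4 : 0 ≤ (T i).J (S i) K - (T i).J (S i) (Kopt i) := sub_nonneg.2 ((hopt i).2 _ (hK i).1)
  have h5 := mul_le_mul_of_nonneg_left h2 (by linarith : 0 ≤ s / 2)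
  have h6 := mul_le_mul_of_nonneg_left h3 (by linarith : 0 ≤ s / 2)
  have h7 : 0 ≤ s / 4 * ((T i).gam (S i) (Kopt i) *
      ((T i).J (S i) K - (T i).J (S i) (Kopt i))) := by
    have := (hγ i).le; positivity
  rw [meanGrad] at h1 ⊢
  linarith

variable (hβ : ∀ i, 1 ≤ β i) (hαγ : ∀ i, α < 4 / (T i).gam (S i) (Kopt i))
  (hhet : ∀ i, ∀ K ∈ stabSet T S Kopt β K₀, avgHet T S i K ≤ (T i).gam (S i) (Kopt i) / 6 *
    ((T i).J (S i) K₀ - (T i).J (S i) (Kopt i)))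
include hβ hαγ hhet

omit hS hLpos hL hαL hβ hαγ in
/-- If the initial controller is optimal for some task, low heterogeneity forces the mean gradient
to vanish. -/
theorem meanGrad_eq_zero {K : Ctrl p nu ny} (hK : K ∈ stabSet T S Kopt β K₀) {i : Fin N}
    (hi : (T i).J (S i) K₀ - (T i).J (S i) (Kopt i) = 0) : meanGrad T S K = 0 := by
  have hn := pos_of_gam_pos (hγ i)
  have h1 := hhet i K hK
  have h2 := frobNorm_gradJ_sub_mean_sq_le (fun j => (hK j).1) i
  have h3 := (hK i).2
  rw [hi, mul_zero] at h1 h3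
  have hKopt : (T i).IsOptimal (S i) K :=
    ⟨(hK i).1, fun K' hK' => (sub_nonpos.1 h3).trans ((hopt i).2 K' hK')⟩
  have h4 := gradJ_eq_zero_of_isOptimal (hν i) hn hKopt
  have h5 : frobNorm ((T i).gradJ (S i) K - meanGrad T S K) = 0 :=
    pow_eq_zero_iff two_ne_zero |>.1 (le_antisymm (h2.trans h1) (sq_nonneg _))
  have h6 := eq_zero_of_frobNorm_eq_zero h5
  rwa [h4, zero_sub, neg_eq_zero] at h6

/-- A step along the mean gradient stays in the common stabilizing set. The set is closed, and it
cannot be left along the segment: the suboptimalities are strictly below their bounds after any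
positive time, and where one starts at its bound, it decreases initially. -/
theorem segment_subset_stabSet {K : Ctrl p nu ny} (hK : K ∈ stabSet T S Kopt β K₀) :
    ∀ s ∈ Set.Icc 0 α, K - s • meanGrad T S K ∈ stabSet T S Kopt β K₀ := by
  by_cases hG : meanGrad T S K = 0
  · intro s _
    simpa [hG] using hK
  set G := meanGrad T S K with hGdef
  have hΔ : ∀ i, 0 < (T i).J (S i) K₀ - (T i).J (S i) (Kopt i) := fun i => by
    refine lt_of_le_of_ne ?_ fun h => hG (meanGrad_eq_zero hν hopt hγ hhet hK h.symm)
    have h1 := (sub_nonneg.2 ((hopt i).2 _ (hK i).1)).trans (hK i).2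
    exact nonneg_of_mul_nonneg_right h1 (by linarith [hβ i])
  have hcont : Continuous fun s : ℝ => K - s • G := by fun_prop
  have hclosed := (isClosed_stabSet (β := β) (K₀ := K₀) hν (fun i => pos_of_gam_pos (hγ i)) hS
    hopt).preimage hcont
  refine (hclosed.inter isClosed_Icc).Icc_subset_of_forall_mem_nhdsGT_of_Icc_subset
    (by simpa using hK) fun t ht hseg => ?_
  -- the constraint of each task persists for a short time after `t`
  have hall : ∀ i, ∀ᶠ s in 𝓝[>] t, K - s • G ∈ (T i).stabilizing (S i) ∧
      (T i).J (S i) (K - s • G) - (T i).J (S i) (Kopt i) ≤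
        β i * ((T i).J (S i) K₀ - (T i).J (S i) (Kopt i)) := by
    intro i
    have hn := pos_of_gam_pos (hγ i)
    have htmem : K - t • G ∈ stabSet T S Kopt β K₀ := hseg (Set.right_mem_Icc.2 ht.1)
    have hst : ∀ᶠ s in 𝓝[>] t, K - s • G ∈ (T i).stabilizing (S i) :=
      nhdsWithin_le_nhds (hcont.continuousAt.eventually (isOpen_stabilizing.mem_nhds (htmem i).1))
    refine hst.and ?_
    have hJc : ContinuousAt (fun s : ℝ => (T i).J (S i) (K - s • G) - (T i).J (S i) (Kopt i)) t :=
      (ContinuousAt.comp (f := fun s : ℝ => K - s • G) (x := t) (g := (T i).J (S i))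
        (continuousAt_J (hν i) hn (htmem i).1) hcont.continuousAt).sub continuousAt_const
    have hβΔ : 0 < β i * ((T i).J (S i) K₀ - (T i).J (S i) (Kopt i)) :=
      mul_pos (by linarith [hβ i]) (hΔ i)
    have hb : avgHet T S i K ≤ (T i).gam (S i) (Kopt i) / 6 *
        (β i * ((T i).J (S i) K₀ - (T i).J (S i) (Kopt i))) := by
      refine (hhet i K hK).trans (mul_le_mul_of_nonneg_left ?_ (by linarith [hγ i]))
      nlinarith [hβ i, hΔ i]
    rcases (htmem i).2.lt_or_eq with hlt | heq
    · filter_upwards [nhdsWithin_le_nhds (hJc.eventually_lt_const hlt)] with s hs using hs.le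
    have ht0 : t = 0 := by
      by_contra hne
      have htpos : 0 < t := lt_of_le_of_ne ht.1 (Ne.symm hne)
      have h1 := subopt_le_of_segment hν hS hopt hγ hLpos hL hαL ht.1 ht.2.le hseg i
      have h2 : 0 ≤ 1 - t * (T i).gam (S i) (Kopt i) / 4 := by
        have := hαγ i
        rw [lt_div_iff₀ (hγ i)] at this
        nlinarith [hγ i, ht.2]
      have h3 := mul_le_mul_of_nonneg_left (hK i).2 h2
      have h4 := mul_le_mul_of_nonneg_left hb (by linarith : 0 ≤ t / 2)
      have h5 := mul_pos (mul_pos htpos (hγ i)) hβΔ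
      rw [← hGdef, heq] at h1
      nlinarith
    subst ht0
    rw [zero_smul, sub_zero] at heq
    have h1 := hasDerivAt_J (hν i) hn (K := K) (D := -G) (S := S i) 0 (by simpa using (hK i).1)
    rw [zero_smul, add_zero] at h1
    have hneg : frobInner ((T i).gradJ (S i) K) (-G) < 0 := by
      have h4 : frobInner ((T i).gradJ (S i) K) (-G) = -frobInner ((T i).gradJ (S i) K) G := by
        simpa using frobInner_smul_right (-1) ((T i).gradJ (S i) K) G
      rw [h4, neg_frobInner_eq]
      have h2 := frobNorm_gradJ_sub_mean_sq_le (fun j => (hK j).1) i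
      have h3 := gam_mul_J_sub_le (hν i) hn (hS i) (hγ i) (hK i).1 (hopt i).1
      rw [← meanGrad, ← hGdef] at h2
      rw [heq] at h3
      have h5 := mul_pos (hγ i) hβΔ
      nlinarith [sq_nonneg (frobNorm G)]
    have h2 := (hasDerivAt_iff_tendsto_slope.1 h1).eventually_lt_const hneg
    have h3 := nhdsWithin_mono (0 : ℝ) (fun s (hs : s ∈ Set.Ioi (0 : ℝ)) => ne_of_gt hs) h2
    filter_upwards [h3, self_mem_nhdsWithin] with s hs hs0
    have hs0 : 0 < s := hs0
    rw [slope_def_field, sub_zero, div_neg_iff] at hs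
    rcases hs with hs | hs
    · linarith [hs.2]
    · have h6 : K + s • -G = K - s • G := by rw [smul_neg, sub_eq_add_neg]
      rw [h6, zero_smul, add_zero] at hs
      linarith [hs.1]
  filter_upwards [eventually_all.2 hall] with s hs
  exact hs

end Multitask

end MTLQG

open MTLQG

theorem theoremV2 {nx nu ny p N : ℕ}
    -- the training tasks
    (T : Fin N → MTLQG.LQGTask nx nu ny)
    (hctrb : ∀ i, MTLQG.Controllable (T i).A (T i).B)
    (hobs : ∀ i, MTLQG.Observable (T i).A (T i).C)
    (hν : ∀ i, (T i).noiseCov.PosDef)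
    -- their history representations and optimal lifted controllers
    (S : Fin N → Matrix (Fin nx) (MTLQG.Hist p nu ny) ℝ)
    (hS : ∀ i, (T i).IsHistoryMap (S i))
    (Kopt : Fin N → MTLQG.Ctrl p nu ny)
    (hopt : ∀ i, (T i).IsOptimal (S i) (Kopt i))
    -- initialization and common stabilizing set
    (K₀ : MTLQG.Ctrl p nu ny) (β : Fin N → ℝ) (hβ : ∀ i, 1 ≤ β i)
    (hK₀ : K₀ ∈ MTLQG.stabSet T S Kopt β K₀)
    -- smoothness constants
    (L : Fin N → ℝ) (hLpos : ∀ i, 0 < L i)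
    (hL : ∀ i, ∀ K ∈ MTLQG.stabSet T S Kopt β K₀, ∀ K' ∈ MTLQG.stabSet T S Kopt β K₀,
      MTLQG.frobNorm ((T i).gradJ (S i) K - (T i).gradJ (S i) K') ≤
        L i * MTLQG.frobNorm (K - K'))
    -- step size
    (α : ℝ) (hα : 0 < α) (hαL : ∀ i, α < 1 / (4 * L i))
    (hαγ : ∀ i, α < 4 / (T i).gam (S i) (Kopt i))
    -- low heterogeneity
    (hhet : ∀ i, ∀ K ∈ MTLQG.stabSet T S Kopt β K₀,
      MTLQG.avgHet T S i K ≤ (T i).gam (S i) (Kopt i) / 6 *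
        ((T i).J (S i) K₀ - (T i).J (S i) (Kopt i))) :
    (∀ n, MTLQG.pgIter T S α K₀ n ∈ MTLQG.stabSet T S Kopt β K₀) ∧
    (∀ i, Filter.limsup
        (fun n => (T i).J (S i) (MTLQG.pgIter T S α K₀ n) - (T i).J (S i) (Kopt i)) Filter.atTop ≤
      3 / (T i).gam (S i) (Kopt i) *
        Filter.limsup (fun n => MTLQG.avgHet T S i (MTLQG.pgIter T S α K₀ n)) Filter.atTop) ∧
    (∀ Kinf : MTLQG.Ctrl p nu ny,
      Filter.Tendsto (MTLQG.pgIter T S α K₀) Filter.atTop (nhds Kinf) →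
      Kinf ∈ MTLQG.stabSet T S Kopt β K₀ ∧
      ∀ i, (T i).J (S i) Kinf - (T i).J (S i) (Kopt i) ≤
        3 / (T i).gam (S i) (Kopt i) * MTLQG.avgHet T S i Kinf) := by
  have hγ : ∀ i, 0 < (T i).gam (S i) (Kopt i) := fun i => by
    have h1 := hα.trans (hαγ i)
    by_contra h2
    exact absurd h1 (not_lt.2 (div_nonpos_of_nonneg_of_nonpos (by norm_num) (not_lt.1 h2)))
  have hSp : ∀ i, S i * pinv (S i) = 1 := fun i => by
    obtain ⟨X, hX⟩ := IsHistoryMap.exists_right_inverse (hν i) (hS i)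
    exact mul_pinv_eq_one hX
  have hseg := fun K hK =>
    segment_subset_stabSet (K := K) hν hSp hopt hγ hLpos hL hαL hβ hαγ hhet hK
  have hmem : ∀ n, pgIter T S α K₀ n ∈ stabSet T S Kopt β K₀ := by
    intro n
    induction n with
    | zero => exact hK₀
    | succ n ih =>
      rw [pgIter_succ]
      exact hseg _ ih α (Set.right_mem_Icc.2 hα.le)
  have hb0 : ∀ i, ∀ K ∈ stabSet T S Kopt β K₀, 0 ≤ avgHet T S i K := fun i K hK =>
    (sq_nonneg _).trans (frobNorm_gradJ_sub_mean_sq_le (fun j => (hK j).1) i)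
  refine ⟨hmem, fun i => ?_, fun Kinf hlim => ?_⟩
  · have hγi := hγ i
    have hbdd : BddAbove (Set.range fun n => avgHet T S i (pgIter T S α K₀ n)) :=
      ⟨_, Set.forall_mem_range.2 fun n => hhet i _ (hmem n)⟩
    have hq1 : α * (T i).gam (S i) (Kopt i) / 4 < 1 := by
      have := hαγ i
      rw [lt_div_iff₀ hγi] at this
      linarith
    have h1 := limsup_le_of_contraction (q := α * (T i).gam (S i) (Kopt i) / 4) (a := α / 2)
      (d := fun n => (T i).J (S i) (pgIter T S α K₀ n) - (T i).J (S i) (Kopt i))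
      (by positivity) hq1 (by positivity)
      (fun n => sub_nonneg.2 ((hopt i).2 _ (hmem n i).1)) hbdd fun n => by
        rw [pgIter_succ]
        exact subopt_le_of_segment hν hSp hopt hγ hLpos hL hαL hα.le le_rfl (hseg _ (hmem n)) i
    refine h1.trans (mul_le_mul_of_nonneg_right ?_ ?_)
    · rw [div_le_div_iff₀ (by positivity) hγi]
      nlinarith [mul_pos hα hγi]
    · exact le_limsup_of_frequently_le (Frequently.of_forall fun n => hb0 i _ (hmem n))
        hbdd.isBoundedUnder_of_range
  · have hn : ∀ _ : Fin N, 0 < nx := fun i => pos_of_gam_pos (hγ i)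
    have hinf : Kinf ∈ stabSet T S Kopt β K₀ :=
      (isClosed_stabSet hν hn hSp hopt).mem_of_tendsto hlim (Eventually.of_forall hmem)
    refine ⟨hinf, fun i => ?_⟩
    -- the mean gradient vanishes at the limit
    have hgrad : ∀ j, Tendsto (fun n => (T j).gradJ (S j) (pgIter T S α K₀ n)) atTop
        (𝓝 ((T j).gradJ (S j) Kinf)) := by
      intro j
      refine tendsto_of_tendsto_frobNorm_sub (squeeze_zero (fun n => frobNorm_nonneg _)
        (fun n => hL j _ (hmem n) _ hinf) ?_)
      have h1 : Tendsto (fun n => pgIter T S α K₀ n - Kinf) atTop (𝓝 0) := by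
        simpa using hlim.sub_const Kinf
      have h2 := ((continuous_frobNorm.tendsto 0).comp h1).const_mul (L j)
      simpa using h2
    have hmean : Tendsto (fun n => α • meanGrad T S (pgIter T S α K₀ n)) atTop
        (𝓝 (α • meanGrad T S Kinf)) :=
      ((tendsto_finsetSum _ fun j _ => hgrad j).const_smul _).const_smul α
    have hzero : Tendsto (fun n => α • meanGrad T S (pgIter T S α K₀ n)) atTop (𝓝 0) := by
      have h1 := hlim.sub (hlim.comp (tendsto_add_atTop_nat 1))
      rw [sub_self] at h1
      refine h1.congr fun n => ?_
      simp only [Function.comp_apply]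
      rw [pgIter_succ]
      abel
    have hG : meanGrad T S Kinf = 0 := by
      have h1 := tendsto_nhds_unique hmean hzero
      exact (smul_eq_zero.1 h1).resolve_left hα.ne'
    have h2 := frobNorm_gradJ_sub_mean_sq_le (fun j => (hinf j).1) i
    rw [← meanGrad, hG, sub_zero] at h2
    have h3 := gam_mul_J_sub_le (hν i) (hn i) (hSp i) (hγ i) (hinf i).1 (hopt i).1
    have h4 := hb0 i _ hinf
    rw [div_mul_eq_mul_div, le_div_iff₀ (hγ i)]
    linarith
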